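/- Let $N\ge 1$, $\alpha\in(1/3,1)$. A \emph{smooth cutoff} (of width $\varepsilon>0$) is a smooth nondecreasing $F:\mathbb R\to\mathbb R$ with $F=0$ on $(-\infty,1]$ and $F=1$ on $[1+\varepsilon,\infty)$. Fix such an $F$ and put, on $\mathbb R^N$, $F_1=F(|x|/t^\alpha)$, $F_1'=F'(|x|/t^\alpha)$. Let $p=-i\nabla$, let $g$ be a smooth vector field with $g(x)=x/|x|$ for $|x|\ge 2$, $\gamma=\frac12(g\cdot p+p\cdot g)$, $r=|x|$, $\partial_r=\frac{x}{|x|}\cdot\nabla$, let $-\Delta_r$ be minus the radial part of the Laplacian, $L^2=\sum_{j<k}(x_jp_k-x_kp_j)^2$, $D=|\partial|=(-\Delta)^{1/2}$ and $\langle D\rangle=(1+D^2)^{1/2}$. The operator relations (1), (3), (5) below are understood as relations between quadratic (sesquilinear) forms on Schwartz functions, with $\langle v,\sqrt{F_1'}\gamma^2\sqrt{F_1'}u\rangle=\langle\gamma\sqrt{F_1'}v,\gamma\sqrt{F_1'}u\rangle$ and $\langle v,\sqrt{F_1'}(-\Delta_r)\sqrt{F_1'}u\rangle=\langle\partial_r\sqrt{F_1'}v,\partial_r\sqrt{F_1'}u\rangle$;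 $\langle A\rangle$ is $\langle\psi,A\psi\rangle$, and $\|\cdot\|$ is the norm of $L^2(\mathbb R^N)$. Then: (1) $\gamma^2F_1'+F_1'\gamma^2=2\sqrt{F_1'}\,\gamma^2\sqrt{F_1'}+O(t^{-2\alpha})=2\sqrt{F_1'}(-\Delta_r)\sqrt{F_1'}+O(t^{-2\alpha})$: the form of each error is at most $Ct^{-2\alpha}\|u\|\|v\|$ for all Schwartz $u,v$, with $C$ independent of $t,u,v$; the first equality holds for all $t\ge1$, the second for all $t\ge 1$ with $t^\alpha\ge2$. (2) For $t\ge 1$, pointwise, $\alpha F_1'/t\le t^{-\alpha}F_1'\,\alpha|x|/t\le(1+\varepsilon)\,\alpha F_1'/t$. (3) For every $a>0$ there is $C$ such that for all $t\ge1$ and all Schwartz $\psi$ $$\big|\mathrm{Re}\,\langle \tfrac1t F_1'\gamma\rangle\big|\le a\,\big\langle t^{-\alpha}\sqrt{F_1'}\gamma^2\sqrt{F_1'}\big\rangle+C\,\big\langle t^{-1-(1-\alpha)}F_1'\big\rangle .$$ (4) Let $\Phi$ be a smooth cutoff, $V:\mathbb R^N\to\mathbb R$ measurable, $m\ge0$ real,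 and suppose $\langle x\rangle^mV$ is bounded, where $\langle x\rangle=(1+|x|^2)^{1/2}$. Let $H=-\Delta+V$ and $\tilde F_0(A\ge\eta)=\Phi(A/\eta)$ for $A=H$ and $A=-\Delta$. Then for every $\eta_0>0$ there is $C$ such that for all $0<\eta\le\eta_0$, all $t\ge1$ and all Schwartz $\psi$ $$\|F_1\tilde F_0(H\ge\eta)\psi-F_1\tilde F_0(-\Delta\ge\eta)\psi\|\le C\,\eta^{-m-1}t^{-m\alpha}\|\psi\| ,$$ and also $\|F_1\tilde F_0(H\ge\eta)\psi-F_1\tilde F_0(-\Delta\ge\eta)\psi\|\le C\,\eta^{-m-1}t^{-m\alpha}\|\langle D\rangle^m\psi\|$. (5) Let $\Phi$ be a smooth cutoff and $F_0=F_0(-\Delta\ge\eta)=\Phi(-\Delta/\eta)$. There are a smooth function $\tilde F$ on $\mathbb R$ and constants $c_1,c_2>0$ and $C$ such that $c_1FF'\le\tilde F\le c_2FF'$ and, with $\tilde F_1=\tilde F(|x|/t^\alpha)$, for all $\eta>0$ and $t\ge1$, on Schwartz functions, $$F_0\Big[t^{-\alpha}\sqrt{F_1'}(-\Delta_r)\sqrt{F_1'}+F_1\frac{L^2}{r^3}\Big]F_0\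 \ge\ \tfrac12\,\eta\,t^{-\alpha}F_0\tilde F_1F_0-C\,t^{-3\alpha}.$$ -/

import Mathlib

open MeasureTheory Complex
open scoped SchwartzMap FourierTransform ContDiff ENNReal Laplacian ComplexConjugate

noncomputable section

namespace TwoBody

/-- Configuration space `ℝᴺ`. -/
abbrev Space (N : ℕ) : Type := EuclideanSpace ℝ (Fin N)

/-- The Hilbert space `L²(ℝᴺ; ℂ)`. -/
abbrev L2 (N : ℕ) : Type := Lp ℂ 2 (volume : Measure (Space N))

/-- `F` is a smooth characteristic function of `[1, ∞)`: smooth, nondecreasing, zero on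
`(-∞, 1]` and one on `[1 + ε, ∞)`. -/
structure IsSmoothCutoff (F : ℝ → ℝ) (ε : ℝ) : Prop where
  pos : 0 < ε
  smooth : ContDiff ℝ ∞ F
  mono : Monotone F
  zero : ∀ l, l ≤ 1 → F l = 0
  one : ∀ l, 1 + ε ≤ l → F l = 1

/-- The function `x ↦ G (|x| / t ^ α)` on `ℝᴺ`. -/
def scaled {N : ℕ} (G : ℝ → ℝ) (α t : ℝ) (x : Space N) : ℝ := G (‖x‖ / t ^ α)

/-- The function `√F'` of a real variable. -/
def sqrtDeriv (F : ℝ → ℝ) (l : ℝ) : ℝ := Real.sqrt (deriv F l)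

/-- The momentum operator `p_j = -i ∂_j`, acting on functions by pointwise differentiation. -/
def momentum {N : ℕ} (j : Fin N) (w : Space N → ℂ) (x : Space N) : ℂ :=
  -I * fderiv ℝ w x (EuclideanSpace.single j 1)

/-- A smooth vector field on `ℝᴺ` that equals `x / |x|` for `|x| ≥ 2`. -/
structure IsRadialField {N : ℕ} (g : Space N → Space N) : Prop where
  smooth : ContDiff ℝ ∞ g
  eq_unit : ∀ x, 2 ≤ ‖x‖ → g x = ‖x‖⁻¹ • x

/-- `γ = ½ (g · p + p · g)`. -/
def gamma {N : ℕ} (g : Space N → Space N) (w : Space N → ℂ) (x : Space N) : ℂ :=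
  (1 / 2) * ∑ j, (((g x j : ℝ) : ℂ) * momentum j w x
    + momentum j (fun y => ((g y j : ℝ) : ℂ) * w y) x)

/-- The radial derivative `∂_r w = (x / |x|) · ∇w`. For `w, w'` supported away from the origin,
`⟨w, -Δ_r w'⟩ = ⟨∂_r w, ∂_r w'⟩`. -/
def radialDeriv {N : ℕ} (w : Space N → ℂ) (x : Space N) : ℂ := fderiv ℝ w x (‖x‖⁻¹ • x)

/-- The component `x_j p_k - x_k p_j` of the angular momentum `x × p`;
`L² = ∑_{j < k} (x_j p_k - x_k p_j)²`. -/
def angMom {N : ℕ} (j k : Fin N) (w : Space N → ℂ) (x : Space N) : ℂ :=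
  ((x j : ℝ) : ℂ) * momentum k w x - ((x k : ℝ) : ℂ) * momentum j w x

/-- The function `f (-Δ) ψ` for a Schwartz function `ψ`: the Fourier multiplier with symbol
`f (4π²|ξ|²)` (the Fourier transform has the kernel `exp (-2πi x·ξ)`). -/
def freeFun {N : ℕ} (f : ℝ → ℝ) (ψ : 𝓢(Space N, ℂ)) : 𝓢(Space N, ℂ) :=
  SchwartzMap.fourierMultiplierCLM ℂ
    (fun ξ : Space N => ((f (4 * Real.pi ^ 2 * ‖ξ‖ ^ 2) : ℝ) : ℂ)) ψ

/-- `u` is in the domain of `H = -Δ + V` on `L²(ℝᴺ)` and `H u = w`. For bounded `V` this is the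
self-adjoint operator with domain `{u ∈ L² : Δu ∈ L²}`; the equation is the distributional one. -/
def HamiltonianEq {N : ℕ} (V : Space N → ℝ) (u w : L2 N) : Prop :=
  ∀ φ : 𝓢(Space N, ℂ), ∫ x, u x * (-(Δ φ) x + ((V x : ℝ) : ℂ) * φ x) = ∫ x, w x * φ x

/-- `R = (H + κ)⁻¹`: `R w = u` means exactly that `u` is in the domain of `H` and
`H u + κ u = w`. There is at most one such `R`. -/
def IsResolvent {N : ℕ} (V : Space N → ℝ) (κ : ℝ) (R : L2 N →L[ℂ] L2 N) : Prop :=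
  ∀ w u : L2 N, R w = u ↔ HamiltonianEq V u (w - (κ : ℂ) • u)

/-- A number `κ` with `H + κ ≥ 1`, for bounded `V`. -/
def shift {N : ℕ} (V : Space N → ℝ) : ℝ := 1 + ⨆ x, |V x|

open Classical in
/-- The bounded positive operator `(H + κ)⁻¹`, for `κ = shift V`. -/
def resolventOp {N : ℕ} (V : Space N → ℝ) : L2 N →L[ℂ] L2 N :=
  if h : ∃ R, IsResolvent V (shift V) R then h.choose else 0

/-- The continuous functional calculus of a bounded self-adjoint operator on a Hilbert space. -/
def boundedFun {X : Type*} [NormedAddCommGroup X] [InnerProductSpace ℂ X] [CompleteSpace X]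
    (f : ℝ → ℝ) (R : X →L[ℂ] X) : X →L[ℂ] X := cfc (p := IsSelfAdjoint) f R

/-- The bounded operator `f (H)` for `H = -Δ + V` with bounded `V` and a continuous `f` that
equals one near `+∞`, by the continuous functional calculus: `f (H) = f̃ ((H + κ)⁻¹)` with
`f̃ (r) = f (1 / r - κ)` for `r > 0` and `f̃ (0) = f (+∞) = 1`. -/
def hamiltonianFun {N : ℕ} (V : Space N → ℝ) (f : ℝ → ℝ) : L2 N →L[ℂ] L2 N :=
  boundedFun (fun r : ℝ => if r ≤ 0 then 1 else f (1 / r - shift V)) (resolventOp V)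

/-- The `L²` norm of a Schwartz function. -/
def norm2 {N : ℕ} (ψ : 𝓢(Space N, ℂ)) : ℝ := ‖ψ.toLp 2 volume‖

/-- `⟨D⟩ᵐ ψ = (1 - Δ)^{m/2} ψ`, where `D = |∂| = (-Δ)^{1/2}`. -/
def japD {N : ℕ} (m : ℝ) (ψ : 𝓢(Space N, ℂ)) : 𝓢(Space N, ℂ) :=
  freeFun (fun l => (1 + l) ^ (m / 2)) ψ

/-- The `L²` norm of `F₁ Φ(H / η) ψ - F₁ Φ(-Δ / η) ψ`, where `F₁ = F (|x| / t ^ α)`. -/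
def localizationError {N : ℕ} (V : Space N → ℝ) (F Φ : ℝ → ℝ) (α t η : ℝ)
    (ψ : 𝓢(Space N, ℂ)) : ℝ≥0∞ :=
  eLpNorm (fun x => ((scaled F α t x : ℝ) : ℂ) *
    (hamiltonianFun V (fun l => Φ (l / η)) (ψ.toLp 2 volume) x
      - freeFun (fun l => Φ (l / η)) ψ x)) 2 volume

/-- The form `⟨v, (γ² F₁' + F₁' γ²) u⟩`. -/
def symForm {N : ℕ} (g : Space N → Space N) (F : ℝ → ℝ) (α t : ℝ) (u v : Space N → ℂ) : ℂ :=
  ∫ x, (gamma g (gamma g (fun y => ((scaled (deriv F) α t y : ℝ) : ℂ) * u y)) x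
    + ((scaled (deriv F) α t x : ℝ) : ℂ) * gamma g (gamma g u) x) * conj (v x)

/-- The form `⟨v, √F₁' γ² √F₁' u⟩ = ⟨γ √F₁' v, γ √F₁' u⟩`. -/
def gammaForm {N : ℕ} (g : Space N → Space N) (F : ℝ → ℝ) (α t : ℝ) (u v : Space N → ℂ) : ℂ :=
  ∫ x, gamma g (fun y => ((scaled (sqrtDeriv F) α t y : ℝ) : ℂ) * u y) x
    * conj (gamma g (fun y => ((scaled (sqrtDeriv F) α t y : ℝ) : ℂ) * v y) x)

/-- The form `⟨v, √F₁' (-Δ_r) √F₁' u⟩ = ⟨∂_r √F₁' v, ∂_r √F₁' u⟩`. -/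
def radialForm {N : ℕ} (F : ℝ → ℝ) (α t : ℝ) (u v : Space N → ℂ) : ℂ :=
  ∫ x, radialDeriv (fun y => ((scaled (sqrtDeriv F) α t y : ℝ) : ℂ) * u y) x
    * conj (radialDeriv (fun y => ((scaled (sqrtDeriv F) α t y : ℝ) : ℂ) * v y) x)

/-- `⟨φ, F₁ L² / r³ φ⟩ = ∑_{j < k} ∫ F₁ r⁻³ |(x_j p_k - x_k p_j) φ|²` (the `x_j p_k - x_k p_j` are
symmetric and commute with radial functions). -/
def angularForm {N : ℕ} (F : ℝ → ℝ) (α t : ℝ) (φ : Space N → ℂ) : ℝ :=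
  ∑ j, ∑ k ∈ Finset.Ioi j, ∫ x, scaled F α t x / ‖x‖ ^ 3 * ‖angMom j k φ x‖ ^ 2

/-- `⟨φ, G (|x| / t ^ α) φ⟩`. -/
def densityForm {N : ℕ} (G : ℝ → ℝ) (α t : ℝ) (φ : Space N → ℂ) : ℝ :=
  ∫ x, scaled G α t x * ‖φ x‖ ^ 2

end TwoBody

end

namespace TwoBody

noncomputable section

/-! ### One-dimensional cutoffs -/

section Cutoff

variable {F : ℝ → ℝ} {ε : ℝ}

/-! Write h = √F₁' and T = t^α. Relations (1), (3) and (5) are commutator estimates in which h need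
not be smooth. A nonnegative function with bounded second derivative has a Lipschitz square root
(`lipschitzWith_sqrt_comp`), so h is Lipschitz with constant O(T⁻¹) and by Rademacher has a gradient
almost everywhere. This is all that is used about h.

(1) Since [h, γ] = i g·∇h commutes with h, γ²h² + h²γ² - 2hγ²h = [h, [h, γ²]] = 2[h, γ]² =
-2(g·∇h)², which is O(T⁻²) (`integral_symmetrization`). For |x| > 2 one has γ = -i(∂_r +
(N-1)/(2r)), and integrating the cross term by parts leaves a potential of order r⁻²
(`integral_gamma_sub_radial`). (2) only uses that F₁' lives on T ≤ |x| ≤ (1+ε)T. (3) The real part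
of ⟨h²γ⟩ is that of ⟨hψ, γhψ⟩, and a weighted arithmetic-geometric mean inequality finishes.

(4) Put A = (-Δ+κ)⁻¹ and R = (H+κ)⁻¹, so that A - R = AVR. An energy cutoff at scale η is a smooth
function of the resolvent, hence a superposition ∫ k̂(s) exp(2πisR) ds (`boundedFun_eq_integral`).
By Duhamel's formula, comparing exp(iτA) with exp(iτR) behind F₁ only requires a bound for F₁
exp(iσA) A V, where the propagator is the free one. The part of V far from the origin is O(T^{-m})
by decay. For the near part, A is conjugated by exponential weights as in the Combes-Thomas method:
the conjugated operator differs from A by at most 1 in norm, so propagation costs e^{|σ|} against a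
gain e^{-aT}. Interpolating with the trivial bound gives (1+|σ|)^m T^{-m}
(`IsSmoothCutoff.exists_propagation_bound`). Finally k' has size η⁻¹ on intervals of length O(η), so
the integral of |s|(1+|s|)^m |k̂(s)| is O(η^{-m-1}) (`exists_fourier_cutoffKernel_le`).

(5) Take F̃ = cFF' and w = (FF')(|x|/T). By Lagrange's identity |∇φ|² splits into its radial and
angular parts, and on supp w the two terms on the left dominate c T⁻¹ w|∇φ|² up to O(T⁻³)‖φ‖². For φ
with frequencies above η, the form of w|∇φ|² - (η/2) w|φ|² has the Fourier kernel ŵ(ξ-ξ')(4π²ξ·ξ' -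
η/2). With b(ξ) = (4π²|ξ|² - η/2)^{1/2} the bracket equals b(ξ)b(ξ') + O(|ξ-ξ'|²). The first term
gives a nonnegative form, and the second is bounded by Schur's test through the second moment of ŵ,
which is O(T⁻²) (`integral_mul_grad_sq_ge`). -/

theorem IsSmoothCutoff.nonneg (hF : IsSmoothCutoff F ε) (l : ℝ) : 0 ≤ F l := by
  rcases le_total l 1 with h | h
  · rw [hF.zero l h]
  · rw [← hF.zero 1 le_rfl]; exact hF.mono h

theorem IsSmoothCutoff.le_one (hF : IsSmoothCutoff F ε) (l : ℝ) : F l ≤ 1 := by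
  rcases le_total l (1 + ε) with h | h
  · rw [← hF.one (1 + ε) le_rfl]; exact hF.mono h
  · rw [hF.one l h]

theorem IsSmoothCutoff.deriv_nonneg (hF : IsSmoothCutoff F ε) (l : ℝ) : 0 ≤ deriv F l :=
  hF.mono.deriv_nonneg

/-- Each such point, the endpoint 1 included, is a global minimum of `F`, so no one-sided argument
is needed. -/
theorem IsSmoothCutoff.deriv_eq_zero_of_le (hF : IsSmoothCutoff F ε) {l : ℝ} (hl : l ≤ 1) :
    deriv F l = 0 := by
  refine IsLocalMin.deriv_eq_zero (Filter.Eventually.of_forall fun y => ?_)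
  rw [hF.zero l hl]; exact hF.nonneg y

theorem IsSmoothCutoff.deriv_eq_zero_of_ge (hF : IsSmoothCutoff F ε) {l : ℝ} (hl : 1 + ε ≤ l) :
    deriv F l = 0 := by
  refine IsLocalMax.deriv_eq_zero (Filter.Eventually.of_forall fun y => ?_)
  rw [hF.one l hl]; exact hF.le_one y

theorem IsSmoothCutoff.contDiff_deriv (hF : IsSmoothCutoff F ε) : ContDiff ℝ ∞ (deriv F) :=
  (contDiff_infty_iff_deriv.mp hF.smooth).2

/-- Nonnegativity of f forces the quadratic s ↦ f(x) + s f'(x) + M s² to be nonnegative, so its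
discriminant is at most zero. The mean value theorem gives the remainder M s² instead of M s²/2; the
resulting 4M is exactly what the Lipschitz constant √M of √f requires. -/
theorem sq_deriv_le_of_nonneg {f : ℝ → ℝ} (hf : ContDiff ℝ 2 f) (h0 : ∀ x, 0 ≤ f x) {M : ℝ}
    (hM : 0 < M) (hb : ∀ x, |deriv (deriv f) x| ≤ M) (x : ℝ) : deriv f x ^ 2 ≤ 4 * M * f x := by
  have hd : Differentiable ℝ f := hf.differentiable (by norm_num)
  have hd' : ContDiff ℝ 1 (deriv f) := by
    have : ContDiff ℝ (1 + 1) f := by simpa [one_add_one_eq_two] using hf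
    exact (contDiff_succ_iff_deriv.mp this).2.2
  have hdd : Differentiable ℝ (deriv f) := hd'.differentiable (by norm_num)
  have lip : ∀ a b, |deriv f b - deriv f a| ≤ M * |b - a| := fun a b => by
    simpa using Convex.norm_image_sub_le_of_norm_deriv_le (f := deriv f) (s := Set.univ)
      (fun x _ => hdd x) (fun x _ => by simpa using hb x) convex_univ (Set.mem_univ a)
      (Set.mem_univ b)
  have key : ∀ s, 0 ≤ f x + s * deriv f x + M * s ^ 2 := by
    intro s
    have : ∃ ξ, f (x + s) - f x = deriv f ξ * s ∧ |ξ - x| ≤ |s| := by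
      rcases lt_trichotomy s 0 with hs | hs | hs
      · obtain ⟨ξ, hξ, h⟩ := exists_deriv_eq_slope f (a := x + s) (b := x) (by linarith)
          hd.continuous.continuousOn hd.differentiableOn
        refine ⟨ξ, ?_, ?_⟩
        · rw [h]
          have : x - (x + s) ≠ 0 := by intro h'; linarith
          field_simp
          ring
        · rw [abs_of_neg hs, abs_of_nonpos (by linarith [hξ.2])]; linarith [hξ.1]
      · exact ⟨x, by simp [hs], by simp⟩
      · obtain ⟨ξ, hξ, h⟩ := exists_deriv_eq_slope f (a := x) (b := x + s) (by linarith)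
          hd.continuous.continuousOn hd.differentiableOn
        refine ⟨ξ, ?_, ?_⟩
        · rw [h]
          have : x + s - x ≠ 0 := by intro h'; linarith
          field_simp
          ring
        · rw [abs_of_pos hs, abs_of_nonneg (by linarith [hξ.1])]; linarith [hξ.2]
    obtain ⟨ξ, h1, h2⟩ := this
    have h3 : |(deriv f ξ - deriv f x) * s| ≤ M * s ^ 2 := by
      rw [abs_mul, ← sq_abs s, sq, ← mul_assoc]
      gcongr
      exact (lip x ξ).trans (by gcongr)
    have := h0 (x + s)
    nlinarith [(abs_le.mp h3).2]
  -- The minimizer of the quadratic.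
  have := key (-(deriv f x) / (2 * M))
  have h4 : f x + -(deriv f x) / (2 * M) * deriv f x + M * (-(deriv f x) / (2 * M)) ^ 2
      = f x - deriv f x ^ 2 / (4 * M) := by
    field_simp
    ring
  rw [h4, sub_nonneg, div_le_iff₀ (by positivity)] at this
  linarith

/-- The root of f + δ is differentiable, and the discriminant bound controls its derivative by √M
uniformly in δ; then δ → 0. -/
theorem lipschitzWith_sqrt_comp {f : ℝ → ℝ} (hf : ContDiff ℝ 2 f) (h0 : ∀ x, 0 ≤ f x) {M : ℝ}
    (hM : 0 < M) (hb : ∀ x, |deriv (deriv f) x| ≤ M) :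
    LipschitzWith (Real.sqrt M).toNNReal (fun x => Real.sqrt (f x)) := by
  have hd : Differentiable ℝ f := hf.differentiable (by norm_num)
  have main : ∀ δ > 0, ∀ x y, |Real.sqrt (f x + δ) - Real.sqrt (f y + δ)|
      ≤ Real.sqrt M * |x - y| := by
    intro δ hδ x y
    have hpos : ∀ z, 0 < f z + δ := fun z => by linarith [h0 z]
    have hder : ∀ z, HasDerivAt (fun z => Real.sqrt (f z + δ))
        (deriv f z / (2 * Real.sqrt (f z + δ))) z := fun z =>
      ((hd z).hasDerivAt.add_const δ).sqrt (hpos z).ne'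
    have := Convex.norm_image_sub_le_of_norm_deriv_le
      (f := fun z => Real.sqrt (f z + δ)) (s := Set.univ) (C := Real.sqrt M) (x := y) (y := x)
      (fun z _ => (hder z).differentiableAt) (fun z _ => ?_) convex_univ (Set.mem_univ _)
      (Set.mem_univ _)
    · simpa using this
    · rw [(hder z).deriv, Real.norm_eq_abs, abs_div, div_le_iff₀ (by
        have := Real.sqrt_pos.2 (hpos z); positivity)]
      rw [abs_of_pos (a := 2 * √(f z + δ)) (by have := Real.sqrt_pos.2 (hpos z); positivity)]
      refine abs_le_of_sq_le_sq ?_ (by positivity)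
      have h1 := sq_deriv_le_of_nonneg hf h0 hM hb z
      rw [mul_pow, mul_pow, Real.sq_sqrt hM.le, Real.sq_sqrt (hpos z).le]
      nlinarith
  refine LipschitzWith.of_dist_le_mul fun x y => ?_
  rw [Real.dist_eq, Real.dist_eq, Real.coe_toNNReal _ (Real.sqrt_nonneg _)]
  have hlim : Filter.Tendsto (fun δ : ℝ => |Real.sqrt (f x + δ) - Real.sqrt (f y + δ)|)
      (nhdsWithin 0 (Set.Ioi 0)) (nhds |Real.sqrt (f x + 0) - Real.sqrt (f y + 0)|) := by
    refine Filter.Tendsto.mono_left (Continuous.tendsto ?_ 0) nhdsWithin_le_nhds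
    fun_prop
  rw [add_zero, add_zero] at hlim
  exact le_of_tendsto hlim (by filter_upwards [self_mem_nhdsWithin] with δ hδ using main δ hδ x y)

theorem exists_abs_le_of_eq_zero_outside {f : ℝ → ℝ} (hf : Continuous f) {a b : ℝ}
    (h : ∀ x, x < a ∨ b < x → f x = 0) : ∃ C, 0 < C ∧ ∀ x, |f x| ≤ C := by
  obtain ⟨C, hC⟩ := (isCompact_Icc (a := a) (b := b)).exists_bound_of_continuousOn hf.continuousOn
  refine ⟨max C 1, by positivity, fun x => ?_⟩
  by_cases hx : x ∈ Set.Icc a b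
  · exact (hC x hx).trans (le_max_left _ _)
  · have : x < a ∨ b < x := by
      by_contra hcon
      push Not at hcon
      exact hx hcon
    rw [h x this, abs_zero]
    positivity

theorem deriv_eq_zero_outside {f : ℝ → ℝ} {a b : ℝ} (h : ∀ x, x < a ∨ b < x → f x = 0) (x : ℝ)
    (hx : x < a ∨ b < x) : deriv f x = 0 := by
  have hopen : IsOpen (Set.Iio a ∪ Set.Ioi b) := isOpen_Iio.union isOpen_Ioi
  have : f =ᶠ[nhds x] fun _ => 0 := by
    filter_upwards [hopen.mem_nhds hx] with y hy using h y hy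
  rw [this.deriv_eq, deriv_const]

theorem IsSmoothCutoff.deriv_eq_zero_outside (hF : IsSmoothCutoff F ε) (x : ℝ)
    (hx : x < 1 ∨ 1 + ε < x) : deriv F x = 0 := by
  rcases hx with hx | hx
  · exact hF.deriv_eq_zero_of_le hx.le
  · exact hF.deriv_eq_zero_of_ge hx.le

theorem IsSmoothCutoff.exists_lipschitzWith_sqrtDeriv (hF : IsSmoothCutoff F ε) :
    ∃ K, LipschitzWith K (sqrtDeriv F) := by
  have h1 := hF.deriv_eq_zero_outside
  have h3 := TwoBody.deriv_eq_zero_outside (TwoBody.deriv_eq_zero_outside h1)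
  have c1 := (contDiff_infty_iff_deriv.mp hF.contDiff_deriv).2
  have c2 := (contDiff_infty_iff_deriv.mp c1).2
  obtain ⟨M, hM, hb⟩ := exists_abs_le_of_eq_zero_outside c2.continuous h3
  exact ⟨_, lipschitzWith_sqrt_comp (contDiff_infty.1 hF.contDiff_deriv 2)
    hF.deriv_nonneg hM hb⟩

theorem IsSmoothCutoff.sqrtDeriv_sq (hF : IsSmoothCutoff F ε) (l : ℝ) :
    sqrtDeriv F l ^ 2 = deriv F l :=
  Real.sq_sqrt (hF.deriv_nonneg l)

end Cutoff

/-! ### Radial functions at scale `t ^ α` -/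

section Scaled

variable {N : ℕ}

/-- The norm is singular only at the origin, near which the function is constant. -/
theorem contDiff_scaled {G : ℝ → ℝ} (hG : ContDiff ℝ ∞ G) {c : ℝ} (h0 : ∀ l, l ≤ 1 → G l = c)
    (α : ℝ) {t : ℝ} (ht : 0 < t) : ContDiff ℝ ∞ (scaled G α t : Space N → ℝ) := by
  have hT : 0 < t ^ α := Real.rpow_pos_of_pos ht α
  rw [contDiff_iff_contDiffAt]
  intro x
  by_cases hx : x = 0
  · have : (scaled G α t : Space N → ℝ) =ᶠ[nhds x] fun _ => c := by
      filter_upwards [Metric.ball_mem_nhds x hT] with y hy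
      rw [hx, mem_ball_zero_iff] at hy
      exact h0 _ ((div_le_one hT).2 hy.le)
    exact contDiffAt_const.congr_of_eventuallyEq this
  · exact hG.contDiffAt.comp x ((contDiffAt_norm ℝ hx).div_const _)

theorem hasCompactSupport_scaled {G : ℝ → ℝ} {b : ℝ} (h0 : ∀ l, b < l → G l = 0)
    (α : ℝ) {t : ℝ} (ht : 0 < t) : HasCompactSupport (scaled G α t : Space N → ℝ) := by
  have hT : 0 < t ^ α := Real.rpow_pos_of_pos ht α
  refine HasCompactSupport.intro (isCompact_closedBall (0 : Space N) (b * t ^ α)) fun x hx => ?_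
  rw [mem_closedBall_zero_iff, not_le] at hx
  exact h0 _ ((lt_div_iff₀ hT).2 hx)

theorem lipschitzWith_scaled {G : ℝ → ℝ} {K : NNReal} (hG : LipschitzWith K G) (α : ℝ) {t : ℝ}
    (ht : 0 < t) : LipschitzWith (K * (t ^ (-α)).toNNReal) (scaled G α t : Space N → ℝ) := by
  have hT : 0 < t ^ α := Real.rpow_pos_of_pos ht α
  refine hG.comp (LipschitzWith.of_dist_le_mul fun x y => ?_)
  rw [Real.coe_toNNReal _ (Real.rpow_nonneg ht.le _), Real.rpow_neg ht.le, Real.dist_eq,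
    ← sub_div, abs_div, abs_of_pos hT, div_eq_inv_mul, dist_eq_norm]
  gcongr
  exact abs_norm_sub_norm_le x y

theorem cutoffDeriv_div_le {F : ℝ → ℝ} {ε : ℝ} (hF : IsSmoothCutoff F ε) {α : ℝ} (hα : 0 ≤ α)
    {t : ℝ} (ht : 0 < t) (x : Space N) :
    α * scaled (deriv F) α t x / t ≤ scaled (deriv F) α t x * (α * ‖x‖ / t) * t ^ (-α) ∧
    scaled (deriv F) α t x * (α * ‖x‖ / t) * t ^ (-α)
      ≤ (1 + ε) * (α * scaled (deriv F) α t x / t) := by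
  have hT : 0 < t ^ α := Real.rpow_pos_of_pos ht α
  have hrw : scaled (deriv F) α t x * (α * ‖x‖ / t) * t ^ (-α)
      = (‖x‖ / t ^ α) * (α * scaled (deriv F) α t x / t) := by
    rw [Real.rpow_neg ht.le]; field_simp
  rw [hrw]
  have hnn : 0 ≤ α * scaled (deriv F) α t x / t :=
    div_nonneg (mul_nonneg hα (hF.deriv_nonneg _)) ht.le
  rcases le_or_gt (‖x‖ / t ^ α) 1 with h | h
  · have : scaled (deriv F) α t x = 0 := hF.deriv_eq_zero_of_le h
    simp [this]
  rcases le_or_gt (1 + ε) (‖x‖ / t ^ α) with h' | h'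
  · have : scaled (deriv F) α t x = 0 := hF.deriv_eq_zero_of_ge h'
    simp [this]
  · exact ⟨by nlinarith, by gcongr⟩

end Scaled

/-! ### The operator `γ` -/

section Gamma

variable {N : ℕ}

/-- The divergence of a vector field. -/
def divergence (g : Space N → Space N) (x : Space N) : ℝ :=
  ∑ j, fderiv ℝ (fun y => g y j) x (EuclideanSpace.single j 1)

theorem sum_coord_mul_apply_single (v : Space N) (L : Space N →L[ℝ] ℂ) :
    ∑ j, ((v j : ℝ) : ℂ) * L (EuclideanSpace.single j 1) = L v := by
  conv_rhs => rw [← (EuclideanSpace.basisFun (Fin N) ℝ).sum_repr v]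
  simp [map_sum]

theorem fderiv_ofReal_comp {f : Space N → ℝ} {x : Space N} (hf : DifferentiableAt ℝ f x)
    (v : Space N) : fderiv ℝ (fun y => ((f y : ℝ) : ℂ)) x v = ((fderiv ℝ f x v : ℝ) : ℂ) := by
  have : HasFDerivAt (fun y => ((f y : ℝ) : ℂ)) (ofRealCLM.comp (fderiv ℝ f x)) x :=
    ofRealCLM.hasFDerivAt.comp x hf.hasFDerivAt
  rw [this.fderiv]; rfl

theorem fderiv_ofReal_mul {f : Space N → ℝ} {w : Space N → ℂ} {x : Space N}
    (hf : DifferentiableAt ℝ f x) (hw : DifferentiableAt ℝ w x) (v : Space N) :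
    fderiv ℝ (fun y => ((f y : ℝ) : ℂ) * w y) x v
      = (f x : ℂ) * fderiv ℝ w x v + ((fderiv ℝ f x v : ℝ) : ℂ) * w x := by
  have hf' : DifferentiableAt ℝ (fun y => ((f y : ℝ) : ℂ)) x :=
    ofRealCLM.differentiableAt.comp x hf
  rw [fderiv_fun_mul hf' hw]
  simp [fderiv_ofReal_comp hf, mul_comm]

theorem fderiv_conj {w : Space N → ℂ} {x : Space N} (hw : DifferentiableAt ℝ w x) (v : Space N) :
    fderiv ℝ (fun y => conj (w y)) x v = conj (fderiv ℝ w x v) := by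
  have : HasFDerivAt (fun y => conj (w y)) (conjCLE.toContinuousLinearMap.comp (fderiv ℝ w x)) x :=
    conjCLE.toContinuousLinearMap.hasFDerivAt.comp x hw.hasFDerivAt
  rw [this.fderiv]; rfl

theorem differentiableAt_conj {w : Space N → ℂ} {x : Space N} (hw : DifferentiableAt ℝ w x) :
    DifferentiableAt ℝ (fun y => conj (w y)) x :=
  conjCLE.toContinuousLinearMap.differentiableAt.comp x hw

variable {g : Space N → Space N}

theorem gamma_eq {w : Space N → ℂ} {x : Space N} (hg : Differentiable ℝ g)
    (hw : DifferentiableAt ℝ w x) :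
    gamma g w x = -I * (fderiv ℝ w x (g x) + (1 / 2) * (divergence g x : ℂ) * w x) := by
  have hgj : ∀ j, DifferentiableAt ℝ (fun y => g y j) x := fun j =>
    differentiableAt_euclidean.1 (hg x) j
  unfold gamma momentum divergence
  have : ∀ j, ((g x j : ℝ) : ℂ) * (-I * fderiv ℝ w x (EuclideanSpace.single j 1))
      + -I * fderiv ℝ (fun y => ((g y j : ℝ) : ℂ) * w y) x (EuclideanSpace.single j 1)
      = (-2 * I) * (((g x j : ℝ) : ℂ) * fderiv ℝ w x (EuclideanSpace.single j 1))
        + -I * w x * ((fderiv ℝ (fun y => g y j) x (EuclideanSpace.single j 1) : ℝ) : ℂ) := by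
    intro j
    rw [fderiv_ofReal_mul (hgj j) hw]
    ring
  simp_rw [this]
  rw [Finset.sum_add_distrib, ← Finset.mul_sum, ← Finset.mul_sum, sum_coord_mul_apply_single]
  push_cast
  ring

theorem gamma_ofReal_mul {f : Space N → ℝ} {w : Space N → ℂ} {x : Space N}
    (hg : Differentiable ℝ g) (hf : DifferentiableAt ℝ f x) (hw : DifferentiableAt ℝ w x) :
    gamma g (fun y => ((f y : ℝ) : ℂ) * w y) x
      = (f x : ℂ) * gamma g w x - I * ((fderiv ℝ f x (g x) : ℝ) : ℂ) * w x := by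
  have hfw : DifferentiableAt ℝ (fun y => ((f y : ℝ) : ℂ) * w y) x :=
    (ofRealCLM.differentiableAt.comp x hf).mul hw
  rw [gamma_eq hg hfw, gamma_eq hg hw, fderiv_ofReal_mul hf hw]
  ring

theorem contDiff_divergence (hg : ContDiff ℝ ∞ g) : ContDiff ℝ ∞ (divergence g) := by
  unfold divergence
  refine ContDiff.sum fun j _ => ?_
  have := (contDiff_euclidean.1 hg j).fderiv_right (m := ∞) (by simp)
  exact this.clm_apply contDiff_const

theorem contDiff_gamma (hg : ContDiff ℝ ∞ g) {w : Space N → ℂ} (hw : ContDiff ℝ ∞ w) :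
    ContDiff ℝ ∞ (gamma g w) := by
  have : gamma g w = fun x => -I * (fderiv ℝ w x (g x) + (1 / 2) * (divergence g x : ℂ) * w x) := by
    funext x
    exact gamma_eq (hg.differentiable (by simp)) (hw.differentiable (by simp) x)
  rw [this]
  have h1 := (hw.fderiv_right (m := ∞) (by simp)).clm_apply hg
  have h2 : ContDiff ℝ ∞ (fun x => (divergence g x : ℂ)) :=
    ofRealCLM.contDiff.comp (contDiff_divergence hg)
  fun_prop

/-- Needed for functions h·u with h merely Lipschitz. The total derivative `fderiv` is measurable
without any regularity of `w`. -/
theorem measurable_gamma (hg : Measurable g) (w : Space N → ℂ) :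
    Measurable (gamma g w) := by
  unfold gamma momentum
  have h1 : ∀ (w : Space N → ℂ) (v : Space N), Measurable fun x => fderiv ℝ w x v := fun w v =>
    measurable_fderiv_apply_const ℝ w v
  have h2 : ∀ j : Fin N, Measurable fun x => g x j := fun j => by fun_prop
  fun_prop

/-- The integrand is the divergence of φg. This is the only integration by parts behind the
identities for γ. -/
theorem integral_fderiv_add_divergence (hg : ContDiff ℝ ∞ g) {φ : Space N → ℂ}
    (hφ : ContDiff ℝ 1 φ) (hc : HasCompactSupport φ) :
    Integrable (fun x => fderiv ℝ φ x (g x) + (divergence g x : ℂ) * φ x) ∧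
    ∫ x, (fderiv ℝ φ x (g x) + (divergence g x : ℂ) * φ x) = 0 := by
  have hd : Differentiable ℝ φ := hφ.differentiable (by simp)
  have hgc : Continuous g := hg.continuous
  have hgj : ∀ j, ContDiff ℝ ∞ (fun y => g y j) := fun j => contDiff_euclidean.1 hg j
  have hgjd : ∀ j, Differentiable ℝ (fun y => g y j) := fun j => (hgj j).differentiable (by simp)
  have hcf : Continuous (fderiv ℝ φ) := hφ.continuous_fderiv (by simp)
  have cgj : ∀ j, Continuous (fun x => ((g x j : ℝ) : ℂ)) := fun j =>
    continuous_ofReal.comp (hgj j).continuous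
  have cdj : ∀ j, Continuous (fun x =>
      ((fderiv ℝ (fun y => g y j) x (EuclideanSpace.single j 1) : ℝ) : ℂ)) := fun j =>
    continuous_ofReal.comp (((hgj j).continuous_fderiv (by simp)).clm_apply continuous_const)
  have i1 : ∀ j, Integrable (fun x => ((g x j : ℝ) : ℂ) * fderiv ℝ φ x (EuclideanSpace.single j 1))
      := fun j => Continuous.integrable_of_hasCompactSupport
        ((cgj j).mul (hcf.clm_apply continuous_const)) (hc.fderiv_apply ℝ _).mul_left
  have i2 : ∀ j, Integrable (fun x =>
      ((fderiv ℝ (fun y => g y j) x (EuclideanSpace.single j 1) : ℝ) : ℂ) * φ x) := fun j =>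
    Continuous.integrable_of_hasCompactSupport ((cdj j).mul hφ.continuous) hc.mul_left
  have heq : (fun x => fderiv ℝ φ x (g x) + (divergence g x : ℂ) * φ x)
      = fun x => ∑ j, (((g x j : ℝ) : ℂ) * fderiv ℝ φ x (EuclideanSpace.single j 1)
        + ((fderiv ℝ (fun y => g y j) x (EuclideanSpace.single j 1) : ℝ) : ℂ) * φ x) := by
    funext x
    rw [Finset.sum_add_distrib, sum_coord_mul_apply_single, divergence]
    push_cast
    rw [Finset.sum_mul]
  have i12 : ∀ j ∈ Finset.univ, Integrable (fun x =>
      ((g x j : ℝ) : ℂ) * fderiv ℝ φ x (EuclideanSpace.single j 1)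
        + ((fderiv ℝ (fun y => g y j) x (EuclideanSpace.single j 1) : ℝ) : ℂ) * φ x) :=
    fun j _ => (i1 j).add (i2 j)
  rw [heq]
  refine ⟨integrable_finsetSum _ i12, ?_⟩
  rw [integral_finsetSum _ i12]
  refine Finset.sum_eq_zero fun j _ => ?_
  rw [integral_add (i1 j) (i2 j)]
  have := integral_mul_fderiv_eq_neg_fderiv_mul_of_integrable (μ := (volume : Measure (Space N)))
    (f := fun x => ((g x j : ℝ) : ℂ)) (g := φ) (v := EuclideanSpace.single j 1)
    (by simpa only [fderiv_ofReal_comp (hgjd j _)] using i2 j) (i1 j)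
    (Continuous.integrable_of_hasCompactSupport ((cgj j).mul hφ.continuous) hc.mul_left)
    (fun x _ => ofRealCLM.differentiableAt.comp x (hgjd j x)) (fun x _ => hd x)
  rw [this]
  simp only [fderiv_ofReal_comp (hgjd j _)]
  ring

/-- `γ` is symmetric up to a divergence. -/
theorem gamma_mul_conj_sub {a b : Space N → ℂ} {x : Space N} (hg : Differentiable ℝ g)
    (ha : DifferentiableAt ℝ a x) (hb : DifferentiableAt ℝ b x) :
    gamma g a x * conj (b x) = a x * conj (gamma g b x)
      + -I * (fderiv ℝ (fun y => a y * conj (b y)) x (g x)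
        + (divergence g x : ℂ) * (a x * conj (b x))) := by
  rw [gamma_eq hg ha, gamma_eq hg hb, fderiv_fun_mul ha (differentiableAt_conj hb)]
  simp only [map_mul, map_neg, conj_I, map_add, add_apply,
    smul_apply, smul_eq_mul, fderiv_conj hb, conj_ofReal, map_div₀, map_one,
    map_ofNat]
  ring

end Gamma

/-! ### The `L²` norm of Schwartz functions -/

section Norm2

variable {N : ℕ}

theorem norm2_nonneg (ψ : 𝓢(Space N, ℂ)) : 0 ≤ norm2 ψ := norm_nonneg _

theorem integrable_norm_sq (ψ : 𝓢(Space N, ℂ)) : Integrable fun x => ‖ψ x‖ ^ 2 :=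
  (memLp_two_iff_integrable_sq_norm ψ.continuous.aestronglyMeasurable).1 (ψ.memLp 2)

theorem norm2_sq (ψ : 𝓢(Space N, ℂ)) : norm2 ψ ^ 2 = ∫ x, ‖ψ x‖ ^ 2 := by
  have := SchwartzMap.norm_toLp' (f := ψ) (p := 2) (μ := volume) (by simp) (by simp)
  rw [norm2, this]
  simp only [ENNReal.toReal_ofNat, Real.rpow_ofNat]
  rw [← Real.rpow_natCast, ← Real.rpow_mul (integral_nonneg fun x => by positivity)]
  norm_num

theorem integrable_norm_mul_norm (u v : 𝓢(Space N, ℂ)) : Integrable fun x => ‖u x‖ * ‖v x‖ :=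
  MemLp.integrable_mul (u.memLp 2).norm (v.memLp 2).norm

theorem integral_norm_mul_norm_le (u v : 𝓢(Space N, ℂ)) :
    ∫ x, ‖u x‖ * ‖v x‖ ≤ norm2 u * norm2 v := by
  have h2 : Real.HolderConjugate 2 2 := Real.HolderConjugate.two_two
  have := integral_mul_le_Lp_mul_Lq_of_nonneg (μ := (volume : Measure (Space N))) h2
    (f := fun x => ‖u x‖) (g := fun x => ‖v x‖) (by filter_upwards with x; positivity)
    (by filter_upwards with x; positivity) (by simpa using (u.memLp 2).norm)
    (by simpa using (v.memLp 2).norm)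
  refine this.trans (le_of_eq ?_)
  have : ∀ ψ : 𝓢(Space N, ℂ), (∫ x, ‖ψ x‖ ^ (2 : ℝ)) ^ (1 / 2 : ℝ) = norm2 ψ := by
    intro ψ
    simp only [Real.rpow_ofNat]
    rw [← norm2_sq, ← Real.sqrt_eq_rpow, Real.sqrt_sq (norm2_nonneg ψ)]
  rw [this, this]

theorem norm_integral_le_norm2 {φ : Space N → ℂ} {C : ℝ} (u v : 𝓢(Space N, ℂ)) (hC : 0 ≤ C)
    (h : ∀ᵐ x, ‖φ x‖ ≤ C * (‖u x‖ * ‖v x‖)) : ‖∫ x, φ x‖ ≤ C * norm2 u * norm2 v := by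
  refine (norm_integral_le_of_norm_le ((integrable_norm_mul_norm u v).const_mul C) h).trans ?_
  rw [integral_const_mul, mul_assoc]
  gcongr
  exact integral_norm_mul_norm_le u v

end Norm2

/-! ### Symmetrization and control of `γ` -/

section Symmetrization

variable {N : ℕ} {g : Space N → Space N}

theorem fderiv_sq_eq {f h : Space N → ℝ} (hfh : ∀ x, f x = h x ^ 2) {x : Space N}
    (hh : DifferentiableAt ℝ h x) (v : Space N) :
    fderiv ℝ f x v = 2 * h x * fderiv ℝ h x v := by
  have : f = fun x => h x ^ 2 := funext hfh
  rw [this, fderiv_fun_pow 2 hh]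
  simp

theorem measurable_fderiv_apply (hg : Measurable g) (h : Space N → ℝ) :
    Measurable fun x => fderiv ℝ h x (g x) :=
  isBoundedBilinearMap_apply.continuous.measurable.comp ((measurable_fderiv ℝ h).prodMk hg)

theorem abs_fderiv_le_of_lipschitzWith {h : Space N → ℝ} {L : NNReal} (hL : LipschitzWith L h)
    {B : ℝ} {x v : Space N} (hv : ‖v‖ ≤ B) : |fderiv ℝ h x v| ≤ L * B :=
  (ContinuousLinearMap.le_opNorm _ _).trans
    (mul_le_mul (norm_fderiv_le_of_lipschitz ℝ hL) hv (norm_nonneg _) L.2)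

theorem hasCompactSupport_of_sq {f h : Space N → ℝ} (hfh : ∀ x, f x = h x ^ 2)
    (hc : HasCompactSupport f) : HasCompactSupport h :=
  hc.mono fun x hx => by simpa [hfh] using hx

/-- Almost everywhere γ(hu) = hγu - i(g·∇h)u, where the first term is continuous with compact
support and the second is dominated by L B |u|. -/
theorem memLp_gamma_mul {h : Space N → ℝ} {L : NNReal} {B : ℝ} (hg : ContDiff ℝ ∞ g)
    (hB : ∀ x, ‖g x‖ ≤ B) (hL : LipschitzWith L h) (hc : HasCompactSupport h)
    (u : 𝓢(Space N, ℂ)) : MemLp (gamma g (fun y => ((h y : ℝ) : ℂ) * u y)) 2 := by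
  have hγ : Continuous (gamma g u) := (contDiff_gamma hg (u.smooth ⊤)).continuous
  have m1 : MemLp (fun x => ((h x : ℝ) : ℂ) * gamma g u x) 2 :=
    Continuous.memLp_of_hasCompactSupport ((continuous_ofReal.comp hL.continuous).mul hγ)
      ((hc.comp_left (g := fun r : ℝ => (r : ℂ)) (by simp)).mul_right)
  have m2 : MemLp (fun x => (L * B : ℝ) * ‖u x‖) 2 := ((u.memLp 2).norm).const_mul _
  refine (m1.norm.add m2).mono' (measurable_gamma hg.continuous.measurable _).aestronglyMeasurable
    ?_
  filter_upwards [hL.ae_differentiableAt (μ := volume)] with x hx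
  rw [gamma_ofReal_mul (hg.differentiable (by simp)) hx u.differentiableAt]
  refine (norm_sub_le _ _).trans ?_
  simp only [Pi.add_apply]
  gcongr
  rw [norm_mul, norm_mul, norm_I, one_mul, norm_real]
  gcongr
  exact abs_fderiv_le_of_lipschitzWith hL (hB x)

/-- The double commutator identity for `γ² f + f γ² - 2 √f γ² √f`. -/
theorem integral_symmetrization {f h : Space N → ℝ} {L : NNReal} {B : ℝ}
    (hg : ContDiff ℝ ∞ g) (hB : ∀ x, ‖g x‖ ≤ B) (hf : ContDiff ℝ ∞ f) (hc : HasCompactSupport f)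
    (hfh : ∀ x, f x = h x ^ 2) (hL : LipschitzWith L h) (u v : 𝓢(Space N, ℂ)) :
    ∫ x, (gamma g (gamma g (fun y => ((f y : ℝ) : ℂ) * u y)) x
        + ((f x : ℝ) : ℂ) * gamma g (gamma g u) x) * conj (v x)
      = 2 * (∫ x, gamma g (fun y => ((h y : ℝ) : ℂ) * u y) x
          * conj (gamma g (fun y => ((h y : ℝ) : ℂ) * v y) x))
        + ∫ x, -2 * ((fderiv ℝ h x (g x) : ℝ) : ℂ) ^ 2 * u x * conj (v x) := by
  have hgd : Differentiable ℝ g := hg.differentiable (by simp)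
  have hfd : Differentiable ℝ f := hf.differentiable (by simp)
  have hfC : ContDiff ℝ ∞ (fun y => ((f y : ℝ) : ℂ)) := ofRealCLM.contDiff.comp hf
  have hcC : HasCompactSupport (fun y => ((f y : ℝ) : ℂ)) :=
    hc.comp_left (g := fun r : ℝ => (r : ℂ)) (by simp)
  have hu : ContDiff ℝ ∞ u := u.smooth ⊤
  have hv : ContDiff ℝ ∞ v := v.smooth ⊤
  have hfu : ContDiff ℝ ∞ (fun y => ((f y : ℝ) : ℂ) * u y) := hfC.mul hu
  have hfv : ContDiff ℝ ∞ (fun y => ((f y : ℝ) : ℂ) * v y) := hfC.mul hv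
  have hγfu := contDiff_gamma hg hfu
  have hγu := contDiff_gamma hg hu
  have cconj : ∀ {w : Space N → ℂ}, ContDiff ℝ ∞ w → ContDiff ℝ ∞ (fun x => conj (w x)) :=
    fun hw => conjCLE.toContinuousLinearMap.contDiff.comp hw
  -- φ₁ and φ₂ are the densities whose divergences appear when one factor γ is moved to the other
  -- side. They contain the smooth f and never h, so integrating them by parts is legitimate.
  set φ₁ : Space N → ℂ := fun y => gamma g (fun y => ((f y : ℝ) : ℂ) * u y) y * conj (v y)
    with hφ₁
  set φ₂ : Space N → ℂ := fun y => gamma g u y * conj (((f y : ℝ) : ℂ) * v y) with hφ₂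
  have s₁ : ContDiff ℝ ∞ φ₁ := hγfu.mul (cconj hv)
  have s₂ : ContDiff ℝ ∞ φ₂ := hγu.mul (cconj hfv)
  have c₁ : HasCompactSupport φ₁ := by
    refine HasCompactSupport.mul_right ?_
    refine HasCompactSupport.of_support_subset_isCompact hc.isCompact fun x hx => ?_
    by_contra hcon
    apply hx
    have h1 : f =ᶠ[nhds x] 0 := notMem_tsupport_iff_eventuallyEq.1 hcon
    rw [gamma_ofReal_mul hgd (hfd x) u.differentiableAt, h1.fderiv_eq, h1.eq_of_nhds]
    simp
  have c₂ : HasCompactSupport φ₂ := by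
    refine HasCompactSupport.mul_left ?_
    exact (hcC.mul_right (f' := v)).comp_left (g := conj) (by simp)
  obtain ⟨I₁, J₁⟩ := integral_fderiv_add_divergence hg (s₁.of_le (by simp)) c₁
  obtain ⟨I₂, J₂⟩ := integral_fderiv_add_divergence hg (s₂.of_le (by simp)) c₂
  have hch : HasCompactSupport h := hasCompactSupport_of_sq hfh hc
  have iγ : Integrable (fun x => gamma g (fun y => ((h y : ℝ) : ℂ) * u y) x
      * conj (gamma g (fun y => ((h y : ℝ) : ℂ) * v y) x)) :=
    MemLp.integrable_mul (memLp_gamma_mul hg hB hL hch u) (memLp_gamma_mul hg hB hL hch v).star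
  have ik : Integrable (fun x => -2 * ((fderiv ℝ h x (g x) : ℝ) : ℂ) ^ 2 * u x * conj (v x)) := by
    refine ((integrable_norm_mul_norm u v).const_mul (2 * (L * B) ^ 2)).mono' ?_ ?_
    · have m1 := measurable_fderiv_apply hg.continuous.measurable h
      have m2 := u.continuous.measurable
      have m3 := v.continuous.measurable
      exact (by fun_prop : Measurable fun x =>
        -2 * ((fderiv ℝ h x (g x) : ℝ) : ℂ) ^ 2 * u x * conj (v x)).aestronglyMeasurable
    · filter_upwards with x
      simp only [norm_mul, norm_neg, norm_pow, norm_real, RCLike.norm_conj, norm_ofNat]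
      rw [mul_assoc (2 * _)]
      gcongr
      exact abs_fderiv_le_of_lipschitzWith hL (hB x)
  have main : ∀ᵐ x, (gamma g (gamma g (fun y => ((f y : ℝ) : ℂ) * u y)) x
        + ((f x : ℝ) : ℂ) * gamma g (gamma g u) x) * conj (v x)
      = 2 * (gamma g (fun y => ((h y : ℝ) : ℂ) * u y) x
          * conj (gamma g (fun y => ((h y : ℝ) : ℂ) * v y) x))
        + (-2 * ((fderiv ℝ h x (g x) : ℝ) : ℂ) ^ 2 * u x * conj (v x)
        + (-I * (fderiv ℝ φ₁ x (g x) + (divergence g x : ℂ) * φ₁ x)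
        + -I * (fderiv ℝ φ₂ x (g x) + (divergence g x : ℂ) * φ₂ x))) := by
    filter_upwards [hL.ae_differentiableAt (μ := volume)] with x hx
    have e1 : _ = _ + -I * (fderiv ℝ φ₁ x (g x) + (divergence g x : ℂ) * φ₁ x) :=
      gamma_mul_conj_sub (b := v) hgd ((hγfu.differentiable (by simp)) x) v.differentiableAt
    have e2 : _ = _ + -I * (fderiv ℝ φ₂ x (g x) + (divergence g x : ℂ) * φ₂ x) :=
      gamma_mul_conj_sub hgd ((hγu.differentiable (by simp)) x) ((hfv.differentiable (by simp)) x)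
    have e3 := gamma_ofReal_mul hgd hx (u.differentiableAt (x := x))
    have e4 := gamma_ofReal_mul hgd hx (v.differentiableAt (x := x))
    have e5 := gamma_ofReal_mul hgd (hfd x) (u.differentiableAt (x := x))
    have e6 := gamma_ofReal_mul hgd (hfd x) (v.differentiableAt (x := x))
    have e7 := fderiv_sq_eq hfh hx (g x)
    rw [e5, e7, hfh x] at e1
    rw [e6, e7, hfh x] at e2
    rw [e3, e4, hfh x]
    simp only [map_sub, map_mul, conj_I, conj_ofReal, ofReal_mul, ofReal_pow, ofReal_ofNat,
      map_pow, map_ofNat] at e1 e2 ⊢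
    linear_combination e1 + e2 + (2 * (fderiv ℝ h x (g x) : ℂ) ^ 2 * u x * conj (v x)) * I_sq
  have j₁ : Integrable fun x => -I * (fderiv ℝ φ₁ x (g x) + (divergence g x : ℂ) * φ₁ x) :=
    I₁.const_mul _
  have j₂ : Integrable fun x => -I * (fderiv ℝ φ₂ x (g x) + (divergence g x : ℂ) * φ₂ x) :=
    I₂.const_mul _
  rw [integral_congr_ae main, integral_add (iγ.const_mul 2) (by exact ik.add (j₁.add j₂)),
    integral_add ik (by exact j₁.add j₂), integral_add j₁ j₂, integral_const_mul,
    integral_const_mul, integral_const_mul, J₁, J₂]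
  simp

end Symmetrization

/-! ### Estimates for `γ` at scale `t ^ α` -/

section GammaEstimates

variable {N : ℕ} {g : Space N → Space N}

theorem IsRadialField.exists_norm_le (hg : IsRadialField g) : ∃ B, 1 ≤ B ∧ ∀ x, ‖g x‖ ≤ B := by
  obtain ⟨B, hB⟩ := (isCompact_closedBall (0 : Space N) 2).exists_bound_of_continuousOn
    hg.smooth.continuous.continuousOn
  refine ⟨max B 1, le_max_right _ _, fun x => ?_⟩
  rcases le_total ‖x‖ 2 with h | h
  · exact (hB x (mem_closedBall_zero_iff.2 h)).trans (le_max_left _ _)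
  · rw [hg.eq_unit x h, norm_smul, norm_inv, norm_norm, inv_mul_cancel₀ (by linarith)]
    exact le_max_right _ _

variable {F : ℝ → ℝ} {ε : ℝ}

theorem IsSmoothCutoff.scaled_deriv_eq (hF : IsSmoothCutoff F ε) (α t : ℝ) (x : Space N) :
    scaled (deriv F) α t x = scaled (sqrtDeriv F) α t x ^ 2 :=
  (hF.sqrtDeriv_sq _).symm

theorem IsSmoothCutoff.contDiff_scaled_deriv (hF : IsSmoothCutoff F ε) (α : ℝ) {t : ℝ}
    (ht : 0 < t) : ContDiff ℝ ∞ (scaled (deriv F) α t : Space N → ℝ) :=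
  contDiff_scaled hF.contDiff_deriv (fun _ hl => hF.deriv_eq_zero_of_le hl) α ht

theorem IsSmoothCutoff.hasCompactSupport_scaled_deriv (hF : IsSmoothCutoff F ε) (α : ℝ) {t : ℝ}
    (ht : 0 < t) : HasCompactSupport (scaled (deriv F) α t : Space N → ℝ) :=
  hasCompactSupport_scaled (fun _ hl => hF.deriv_eq_zero_of_ge hl.le) α ht

theorem symForm_sub_gammaForm_le (hF : IsSmoothCutoff F ε) (hg : IsRadialField g) (α : ℝ) :
    ∃ C : ℝ, ∀ t : ℝ, 1 ≤ t → ∀ u v : 𝓢(Space N, ℂ),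
      ‖symForm g F α t u v - 2 * gammaForm g F α t u v‖
        ≤ C * t ^ (-(2 * α)) * norm2 u * norm2 v := by
  obtain ⟨B, hB1, hB⟩ := hg.exists_norm_le
  obtain ⟨K, hK⟩ := hF.exists_lipschitzWith_sqrtDeriv
  refine ⟨2 * (K * B) ^ 2, fun t ht u v => ?_⟩
  have ht0 : 0 < t := by linarith
  have hL := lipschitzWith_scaled (N := N) hK α ht0
  have key := integral_symmetrization hg.smooth hB (hF.contDiff_scaled_deriv α ht0)
    (hF.hasCompactSupport_scaled_deriv α ht0) (hF.scaled_deriv_eq α t) hL u v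
  unfold symForm gammaForm
  rw [key, add_sub_cancel_left]
  have hpow : t ^ (-(2 * α)) = (t ^ (-α)) ^ 2 := by
    rw [← Real.rpow_natCast, ← Real.rpow_mul ht0.le]; congr 1; push_cast; ring
  rw [hpow]
  refine norm_integral_le_norm2 u v (by positivity) (Filter.Eventually.of_forall fun x => ?_)
  have := abs_fderiv_le_of_lipschitzWith hL (hB x) (x := x)
  simp only [NNReal.coe_mul, Real.coe_toNNReal _ (Real.rpow_nonneg ht0.le _)] at this
  simp only [norm_mul, norm_neg, norm_pow, norm_real, RCLike.norm_conj, norm_ofNat,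
    Real.norm_eq_abs]
  have h2 : |fderiv ℝ (scaled (sqrtDeriv F) α t) x (g x)| ^ 2 ≤ (K * t ^ (-α) * B) ^ 2 := by
    gcongr
  calc _ = 2 * |fderiv ℝ (scaled (sqrtDeriv F) α t) x (g x)| ^ 2 * (‖u x‖ * ‖v x‖) := by ring
    _ ≤ 2 * (K * t ^ (-α) * B) ^ 2 * (‖u x‖ * ‖v x‖) := by gcongr
    _ = _ := by ring

/-- Commuting one factor h through γ produces a purely imaginary density, so only Re of γ(hψ) times
the conjugate of hψ survives. The product is then split with weights t^{-α} and t^{α-2}. -/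
theorem abs_re_integral_gamma_le (hF : IsSmoothCutoff F ε) (hg : IsRadialField g) (α : ℝ)
    {a : ℝ} (ha : 0 < a) : ∃ C : ℝ, ∀ t : ℝ, 1 ≤ t → ∀ ψ : 𝓢(Space N, ℂ),
      |(∫ x, ((scaled (deriv F) α t x / t : ℝ) : ℂ) * gamma g ψ x * conj (ψ x)).re|
        ≤ a * (t ^ (-α) * (gammaForm g F α t ψ ψ).re)
          + C * (t ^ (-(1 + (1 - α))) * densityForm (deriv F) α t ψ) := by
  obtain ⟨B, hB1, hB⟩ := hg.exists_norm_le
  obtain ⟨K, hK⟩ := hF.exists_lipschitzWith_sqrtDeriv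
  refine ⟨1 / (4 * a), fun t ht ψ => ?_⟩
  have ht0 : 0 < t := by linarith
  have hL := lipschitzWith_scaled (N := N) hK α ht0
  have hfc := hF.hasCompactSupport_scaled_deriv (N := N) α ht0
  have hfs := hF.contDiff_scaled_deriv (N := N) α ht0
  have hch := hasCompactSupport_of_sq (hF.scaled_deriv_eq α t) hfc
  set h : Space N → ℝ := scaled (sqrtDeriv F) α t with hh
  set G : Space N → ℂ := gamma g (fun y => ((h y : ℝ) : ℂ) * ψ y) with hG
  have mG : MemLp G 2 := memLp_gamma_mul hg.smooth hB hL hch ψ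
  have iG : Integrable (fun x => ‖G x‖ ^ 2) := mG.integrable_norm_pow (by simp)
  have hre : (gammaForm g F α t ψ ψ).re = ∫ x, ‖G x‖ ^ 2 := by
    unfold gammaForm
    have : ∀ x, G x * conj (G x) = ((‖G x‖ ^ 2 : ℝ) : ℂ) := fun x => by
      rw [mul_conj, normSq_eq_norm_sq]
    rw [integral_congr_ae (Filter.Eventually.of_forall this), integral_complex_ofReal, ofReal_re]
  have iD : Integrable (fun x => scaled (deriv F) α t x * ‖ψ x‖ ^ 2) :=
    Continuous.integrable_of_hasCompactSupport
      (hfs.continuous.mul (ψ.continuous.norm.pow 2)) hfc.mul_right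
  have iL : Integrable (fun x => ((scaled (deriv F) α t x / t : ℝ) : ℂ) * gamma g ψ x
      * conj (ψ x)) := by
    refine Continuous.integrable_of_hasCompactSupport ?_ ?_
    · have := (contDiff_gamma hg.smooth (ψ.smooth ⊤)).continuous
      have h2 := hfs.continuous
      have h3 := ψ.continuous
      fun_prop
    · refine HasCompactSupport.mul_right (HasCompactSupport.mul_right ?_)
      exact hfc.comp_left (g := fun r : ℝ => ((r / t : ℝ) : ℂ)) (by simp)
  rw [hre, densityForm, ← RCLike.re_eq_complex_re, ← integral_re iL, ← integral_const_mul,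
    ← integral_const_mul, ← integral_const_mul, ← integral_const_mul,
    ← integral_add ((iG.const_mul _).const_mul _) ((iD.const_mul _).const_mul _)]
  refine (Real.norm_eq_abs _).symm.le.trans (norm_integral_le_of_norm_le
    (((iG.const_mul _).const_mul _).add ((iD.const_mul _).const_mul _)) ?_)
  filter_upwards [hL.ae_differentiableAt (μ := volume)] with x hx
  have e := gamma_ofReal_mul (hg.smooth.differentiable (by simp)) hx (ψ.differentiableAt (x := x))
  have e2 : RCLike.re (((scaled (deriv F) α t x / t : ℝ) : ℂ) * gamma g ψ x * conj (ψ x))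
      = (G x * conj ((h x : ℂ) * ψ x)).re / t := by
    rw [hG, e, hF.scaled_deriv_eq]
    have : (h x * gamma g ψ x - I * ((fderiv ℝ h x (g x) : ℝ) : ℂ) * ψ x) * conj (h x * ψ x)
      = (h x : ℂ) ^ 2 * gamma g ψ x * conj (ψ x)
        - ((fderiv ℝ h x (g x) * h x * normSq (ψ x) : ℝ) : ℂ) * I := by
      push_cast
      rw [← mul_conj]
      simp
      ring
    rw [this, sub_re, re_ofReal_mul, I_re, mul_zero, sub_zero, RCLike.re_eq_complex_re]
    rw [show ((h x ^ 2 / t : ℝ) : ℂ) * gamma g ψ x * conj (ψ x)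
      = ((1 / t : ℝ) : ℂ) * ((h x : ℂ) ^ 2 * gamma g ψ x * conj (ψ x)) by push_cast; ring,
      re_ofReal_mul]
    ring
  rw [e2, Real.norm_eq_abs, abs_div, abs_of_pos ht0, hF.scaled_deriv_eq, ← hh]
  have e3 : |(G x * conj ((h x : ℂ) * ψ x)).re| ≤ ‖G x‖ * (|h x| * ‖ψ x‖) := by
    refine (abs_re_le_norm _).trans (le_of_eq ?_)
    simp
  have hT : 0 < t ^ α := Real.rpow_pos_of_pos ht0 α
  have e4 : t ^ (-(1 + (1 - α))) = t ^ α / t ^ 2 := by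
    rw [show -(1 + (1 - α)) = α - 2 by ring, Real.rpow_sub ht0]; norm_num
  rw [e4, Real.rpow_neg ht0.le, div_le_iff₀ ht0]
  refine e3.trans ?_
  have e5 : |h x| ^ 2 = h x ^ 2 := sq_abs _
  rw [← e5]
  -- The completed square whose expansion yields the constant 1/(4a).
  have : 0 ≤ a * (t ^ α)⁻¹ * t * (‖G x‖ - t ^ α / (2 * a * t) * (|h x| * ‖ψ x‖)) ^ 2 := by
    positivity
  have e6 : a * (t ^ α)⁻¹ * t * (‖G x‖ - t ^ α / (2 * a * t) * (|h x| * ‖ψ x‖)) ^ 2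
    = (a * ((t ^ α)⁻¹ * ‖G x‖ ^ 2) + 1 / (4 * a) * (t ^ α / t ^ 2 * (|h x| ^ 2 * ‖ψ x‖ ^ 2))) * t
      - ‖G x‖ * (|h x| * ‖ψ x‖) := by
    field_simp
    ring
  linarith [e6 ▸ this]

end GammaEstimates

/-! ### Comparison of `γ²` with the radial Laplacian -/

section Radial

variable {N : ℕ} {g : Space N → Space N}

theorem hasFDerivAt_norm_of_ne {E : Type*} [NormedAddCommGroup E] [InnerProductSpace ℝ E] {x : E}
    (hx : x ≠ 0) : HasFDerivAt (fun y : E => ‖y‖) (‖x‖⁻¹ • innerSL ℝ x) x := by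
  have h1 := (hasStrictFDerivAt_norm_sq x).hasFDerivAt.sqrt
    (by have := norm_pos_iff.2 hx; positivity)
  have h2 : (fun y : E => Real.sqrt (‖y‖ ^ 2)) = fun y => ‖y‖ := by
    funext y; exact Real.sqrt_sq (norm_nonneg y)
  rw [h2, Real.sqrt_sq (norm_nonneg x)] at h1
  convert h1 using 1
  have := norm_pos_iff.2 hx
  rw [← Nat.cast_smul_eq_nsmul ℝ, smul_smul]
  congr 1
  push_cast
  field_simp

theorem hasFDerivAt_norm_inv {E : Type*} [NormedAddCommGroup E] [InnerProductSpace ℝ E] {x : E}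
    (hx : x ≠ 0) : HasFDerivAt (fun y : E => ‖y‖⁻¹) (-(‖x‖⁻¹ ^ 3) • innerSL ℝ x) x := by
  have h := (hasDerivAt_inv (norm_ne_zero_iff.2 hx)).comp_hasFDerivAt x (hasFDerivAt_norm_of_ne hx)
  have e : -(‖x‖⁻¹ ^ 3) • innerSL ℝ x = -(‖x‖ ^ 2)⁻¹ • ‖x‖⁻¹ • innerSL ℝ x := by
    rw [smul_smul]
    congr 1
    ring
  rw [e]
  exact h

theorem IsRadialField.divergence_eq (hg : IsRadialField g) {x : Space N} (hx : 2 < ‖x‖) :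
    divergence g x = ((N : ℝ) - 1) * ‖x‖⁻¹ := by
  have hx0 : x ≠ 0 := norm_pos_iff.1 (by linarith)
  have hev : ∀ᶠ y in nhds x, 2 < ‖y‖ := continuous_norm.continuousAt.eventually (lt_mem_nhds hx)
  have : ∀ j, fderiv ℝ (fun y => g y j) x (EuclideanSpace.single j 1)
      = ‖x‖⁻¹ - ‖x‖⁻¹ ^ 3 * x j ^ 2 := by
    intro j
    have e : (fun y => g y j) =ᶠ[nhds x] fun y => ‖y‖⁻¹ * y j := by
      filter_upwards [hev] with y hy
      rw [hg.eq_unit y hy.le]; simp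
    have hj : HasFDerivAt (fun y : Space N => y j)
        (EuclideanSpace.proj (𝕜 := ℝ) j : Space N →L[ℝ] ℝ) x :=
      (EuclideanSpace.proj (𝕜 := ℝ) j : Space N →L[ℝ] ℝ).hasFDerivAt
    rw [e.fderiv_eq, ((hasFDerivAt_norm_inv hx0).fun_mul hj).fderiv]
    simp [EuclideanSpace.inner_single_right]
    ring
  simp only [divergence, this]
  rw [Finset.sum_sub_distrib, ← Finset.mul_sum]
  have h2 : ∑ j, x j ^ 2 = ‖x‖ ^ 2 := by
    rw [EuclideanSpace.norm_sq_eq]; simp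
  have := norm_pos_iff.2 hx0
  rw [h2]
  simp
  field_simp

theorem IsRadialField.fderiv_divergence_eq (hg : IsRadialField g) {x : Space N} (hx : 2 < ‖x‖) :
    fderiv ℝ (divergence g) x (g x) = -(((N : ℝ) - 1) * ‖x‖⁻¹ ^ 2) := by
  have hx0 : x ≠ 0 := norm_pos_iff.1 (by linarith)
  have hev : ∀ᶠ y in nhds x, 2 < ‖y‖ := continuous_norm.continuousAt.eventually (lt_mem_nhds hx)
  have e : divergence g =ᶠ[nhds x] fun y => ((N : ℝ) - 1) * ‖y‖⁻¹ := by
    filter_upwards [hev] with y hy using hg.divergence_eq hy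
  rw [e.fderiv_eq, ((hasFDerivAt_norm_inv hx0).const_mul _).fderiv, hg.eq_unit x hx.le]
  have := norm_pos_iff.2 hx0
  simp
  field_simp

/-- On functions supported in `|x| ≥ 2`, `γ²` and `-Δ_r` differ by a potential. -/
theorem integral_gamma_sub_radial {f h : Space N → ℝ} {L : NNReal} {B : ℝ}
    (hg : IsRadialField g) (hB : ∀ x, ‖g x‖ ≤ B) (hf : ContDiff ℝ ∞ f) (hc : HasCompactSupport f)
    (hfh : ∀ x, f x = h x ^ 2) (hL : LipschitzWith L h) (h0 : ∀ x, ‖x‖ < 2 → h x = 0)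
    (u v : 𝓢(Space N, ℂ)) :
    ∫ x, gamma g (fun y => ((h y : ℝ) : ℂ) * u y) x
        * conj (gamma g (fun y => ((h y : ℝ) : ℂ) * v y) x)
      = (∫ x, radialDeriv (fun y => ((h y : ℝ) : ℂ) * u y) x
          * conj (radialDeriv (fun y => ((h y : ℝ) : ℂ) * v y) x))
        + ∫ x, ((f x * (1 / 4 * divergence g x ^ 2 - 1 / 2 * (divergence g x ^ 2
          + fderiv ℝ (divergence g) x (g x))) : ℝ) : ℂ) * (u x * conj (v x)) := by
  have hgd : Differentiable ℝ g := hg.smooth.differentiable (by simp)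
  have hds := contDiff_divergence hg.smooth
  have hdd : Differentiable ℝ (divergence g) := hds.differentiable (by simp)
  have hfd : Differentiable ℝ f := hf.differentiable (by simp)
  have hu : ContDiff ℝ ∞ u := u.smooth ⊤
  have hv : ContDiff ℝ ∞ v := v.smooth ⊤
  have hdf : ContDiff ℝ ∞ (fun y => divergence g y * f y) := hds.mul hf
  have hdfc : HasCompactSupport (fun y => ((divergence g y * f y : ℝ) : ℂ)) :=
    (hc.mul_left (f := divergence g)).comp_left (g := fun r : ℝ => (r : ℂ)) (by simp)
  have huv : ContDiff ℝ ∞ (fun y => u y * conj (v y)) :=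
    hu.mul (conjCLE.toContinuousLinearMap.contDiff.comp hv)
  -- The cross terms between the radial derivative and ½ div g combine, up to a potential, into half
  -- the divergence of φg.
  set φ : Space N → ℂ := fun y => ((divergence g y * f y : ℝ) : ℂ) * (u y * conj (v y)) with hφ
  have s : ContDiff ℝ ∞ φ := (ofRealCLM.contDiff.comp hdf).mul huv
  have c : HasCompactSupport φ := hdfc.mul_right
  obtain ⟨I₁, J₁⟩ := integral_fderiv_add_divergence hg.smooth (s.of_le (by simp)) c
  have hch : HasCompactSupport h := hasCompactSupport_of_sq hfh hc
  have iγ : Integrable (fun x => gamma g (fun y => ((h y : ℝ) : ℂ) * u y) x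
      * conj (gamma g (fun y => ((h y : ℝ) : ℂ) * v y) x)) :=
    MemLp.integrable_mul (memLp_gamma_mul hg.smooth hB hL hch u)
      (memLp_gamma_mul hg.smooth hB hL hch v).star
  have iV : Integrable fun x => ((f x * (1 / 4 * divergence g x ^ 2 - 1 / 2 * (divergence g x ^ 2
      + fderiv ℝ (divergence g) x (g x))) : ℝ) : ℂ) * (u x * conj (v x)) := by
    refine Continuous.integrable_of_hasCompactSupport ?_ ?_
    · have h1 := hf.continuous
      have h2 := hds.continuous
      have h3 : Continuous fun x => fderiv ℝ (divergence g) x (g x) :=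
        (hds.continuous_fderiv (by simp)).clm_apply hg.smooth.continuous
      have h4 := huv.continuous
      fun_prop
    · exact (hc.mul_right.comp_left (g := fun r : ℝ => (r : ℂ)) (by simp)).mul_right
  have main : ∀ᵐ x, radialDeriv (fun y => ((h y : ℝ) : ℂ) * u y) x
        * conj (radialDeriv (fun y => ((h y : ℝ) : ℂ) * v y) x)
      = gamma g (fun y => ((h y : ℝ) : ℂ) * u y) x
        * conj (gamma g (fun y => ((h y : ℝ) : ℂ) * v y) x)
        + ((-(1 / 2) : ℂ) * (fderiv ℝ φ x (g x) + (divergence g x : ℂ) * φ x)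
        + -(((f x * (1 / 4 * divergence g x ^ 2 - 1 / 2 * (divergence g x ^ 2
          + fderiv ℝ (divergence g) x (g x))) : ℝ) : ℂ) * (u x * conj (v x)))) := by
    filter_upwards [hL.ae_differentiableAt (μ := volume)] with x hx
    -- For |x| < 2 the function h vanishes near x, so it does not matter that g is not the radial
    -- unit field there.
    have hrad : ∀ w : 𝓢(Space N, ℂ), radialDeriv (fun y => ((h y : ℝ) : ℂ) * w y) x
        = (h x : ℂ) * fderiv ℝ w x (g x) + ((fderiv ℝ h x (g x) : ℝ) : ℂ) * w x := by
      intro w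
      rw [radialDeriv, fderiv_ofReal_mul hx w.differentiableAt]
      rcases le_or_gt 2 ‖x‖ with h2 | h2
      · rw [hg.eq_unit x h2]
      · have : h =ᶠ[nhds x] fun _ => 0 := by
          filter_upwards [continuous_norm.continuousAt.eventually (gt_mem_nhds h2)] with y hy
            using h0 y hy
        rw [this.fderiv_eq, this.eq_of_nhds]
        simp
    have e3 := gamma_ofReal_mul hgd hx (u.differentiableAt (x := x))
    have e4 := gamma_ofReal_mul hgd hx (v.differentiableAt (x := x))
    have e7 := fderiv_sq_eq hfh hx (g x)
    have e8 : fderiv ℝ (fun y => divergence g y * f y) x (g x)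
        = divergence g x * fderiv ℝ f x (g x) + f x * fderiv ℝ (divergence g) x (g x) := by
      rw [fderiv_fun_mul (hdd x) (hfd x)]; simp
    have e9 : fderiv ℝ (fun y => u y * conj (v y)) x (g x)
        = u x * conj (fderiv ℝ v x (g x)) + conj (v x) * fderiv ℝ u x (g x) := by
      rw [fderiv_fun_mul u.differentiableAt (differentiableAt_conj v.differentiableAt)]
      simp [fderiv_conj v.differentiableAt]
    rw [hrad, hrad, e3, e4, gamma_eq hgd u.differentiableAt, gamma_eq hgd v.differentiableAt, hφ,
      fderiv_ofReal_mul (hdf.differentiable (by simp) x) (huv.differentiable (by simp) x), e8, e9,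
      e7]
    simp only [hfh x]
    simp only [map_sub, map_mul, map_neg, map_add, conj_I, conj_ofReal, map_div₀, map_one,
      map_ofNat]
    push_cast
    ring_nf
    simp only [I_sq]
    ring
  have j₁ : Integrable fun x => (-(1 / 2) : ℂ) * (fderiv ℝ φ x (g x) + (divergence g x : ℂ) * φ x)
    := I₁.const_mul _
  have j₂ := iV.neg
  rw [integral_congr_ae main, integral_add iγ (by exact j₁.add j₂), integral_add j₁ (by exact j₂),
    integral_const_mul, J₁, integral_neg]
  ring

variable {F : ℝ → ℝ} {ε : ℝ}

theorem gammaForm_sub_radialForm_le (hF : IsSmoothCutoff F ε) (hg : IsRadialField g) (α : ℝ) :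
    ∃ C : ℝ, ∀ t : ℝ, 1 ≤ t → 2 ≤ t ^ α → ∀ u v : 𝓢(Space N, ℂ),
      ‖gammaForm g F α t u v - radialForm F α t u v‖
        ≤ C * t ^ (-(2 * α)) * norm2 u * norm2 v := by
  obtain ⟨B, hB1, hB⟩ := hg.exists_norm_le
  obtain ⟨K, hK⟩ := hF.exists_lipschitzWith_sqrtDeriv
  obtain ⟨M, hM, hb⟩ := exists_abs_le_of_eq_zero_outside hF.contDiff_deriv.continuous
    hF.deriv_eq_zero_outside
  -- With d = div g = (N-1)/r and ∂_r d = -(N-1)/r², the potential d²/4 - (d² + ∂_r d)/2 is the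
  -- number inside the absolute value times r⁻². On the support of F₁' one has r ≥ t^α, which gives
  -- t^{-2α}.
  set c : ℝ := |-(1 / 4) * ((N : ℝ) - 1) ^ 2 + 1 / 2 * ((N : ℝ) - 1)| with hc
  refine ⟨M * c, fun t ht ht2 u v => ?_⟩
  have ht0 : 0 < t := by linarith
  have hT : 0 < t ^ α := Real.rpow_pos_of_pos ht0 α
  have hL := lipschitzWith_scaled (N := N) hK α ht0
  have key := integral_gamma_sub_radial hg hB (hF.contDiff_scaled_deriv α ht0)
    (hF.hasCompactSupport_scaled_deriv α ht0) (hF.scaled_deriv_eq α t) hL (fun x hx => by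
      rw [scaled, sqrtDeriv, hF.deriv_eq_zero_of_le ((div_le_one hT).2 (by linarith)),
        Real.sqrt_zero]) u v
  unfold gammaForm radialForm
  rw [key, add_sub_cancel_left]
  have hpow : t ^ (-(2 * α)) = (t ^ α)⁻¹ ^ 2 := by
    rw [← Real.rpow_neg ht0.le, ← Real.rpow_natCast, ← Real.rpow_mul ht0.le]
    congr 1; push_cast; ring
  rw [hpow]
  refine norm_integral_le_norm2 u v (by positivity) (Filter.Eventually.of_forall fun x => ?_)
  rw [norm_mul, norm_mul, RCLike.norm_conj, norm_real, Real.norm_eq_abs]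
  gcongr
  rcases le_or_gt ‖x‖ (t ^ α) with hx | hx
  · have : scaled (deriv F) α t x = 0 := hF.deriv_eq_zero_of_le ((div_le_one hT).2 hx)
    rw [this, zero_mul, abs_zero]
    positivity
  · rw [hg.divergence_eq (by linarith), hg.fderiv_divergence_eq (by linarith),
      show scaled (deriv F) α t x * (1 / 4 * (((N : ℝ) - 1) * ‖x‖⁻¹) ^ 2
        - 1 / 2 * ((((N : ℝ) - 1) * ‖x‖⁻¹) ^ 2 + -(((N : ℝ) - 1) * ‖x‖⁻¹ ^ 2)))
        = scaled (deriv F) α t x * (-(1 / 4) * ((N : ℝ) - 1) ^ 2 + 1 / 2 * ((N : ℝ) - 1))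
          * ‖x‖⁻¹ ^ 2 by ring, abs_mul, abs_mul, abs_of_nonneg (a := ‖x‖⁻¹ ^ 2) (by positivity)]
    gcongr
    exact hb _

theorem symForm_sub_radialForm_le (hF : IsSmoothCutoff F ε) (hg : IsRadialField g) (α : ℝ) :
    ∃ C : ℝ, ∀ t : ℝ, 1 ≤ t → 2 ≤ t ^ α → ∀ u v : 𝓢(Space N, ℂ),
      ‖symForm g F α t u v - 2 * radialForm F α t u v‖
        ≤ C * t ^ (-(2 * α)) * norm2 u * norm2 v := by
  obtain ⟨C₁, h₁⟩ := symForm_sub_gammaForm_le hF hg α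
  obtain ⟨C₂, h₂⟩ := gammaForm_sub_radialForm_le hF hg α
  refine ⟨C₁ + 2 * C₂, fun t ht ht2 u v => ?_⟩
  have e : symForm g F α t u v - 2 * radialForm F α t u v
      = (symForm g F α t u v - 2 * gammaForm g F α t u v)
        + 2 * (gammaForm g F α t u v - radialForm F α t u v) := by ring
  rw [e]
  refine (norm_add_le _ _).trans ?_
  rw [norm_mul, norm_ofNat]
  linarith [h₁ t ht u v, h₂ t ht ht2 u v]

end Radial

/-! ### Quadratic forms in Fourier space -/

section FourierForm

variable {N : ℕ}

theorem continuous_fourier_kernel : Continuous fun p : (Space N × Space N) × Space N =>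
    (Real.fourierChar (-inner ℝ p.2 (p.1.1 - p.1.2)) : ℂ) :=
  Continuous.comp (by fun_prop) (Real.continuous_fourierChar.comp (by fun_prop))

/-- The form `∫ w φ ψ̄` in terms of the Fourier transforms of `φ` and `ψ`. -/
theorem integral_mul_fourierInv_mul_conj {w a b : Space N → ℂ} (hw : Integrable w)
    (ha : Integrable a) (hb : Integrable b) :
    ∫ x, w x * (𝓕⁻ a x * conj (𝓕⁻ b x))
      = ∫ z : Space N × Space N, 𝓕 w (z.1 - z.2) * (conj (b z.1) * a z.2) := by
  have hb' : Integrable (fun x => conj (b x)) :=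
    conjCLE.toContinuousLinearMap.integrable_comp hb
  have hba : Integrable (fun z : Space N × Space N => conj (b z.1) * a z.2) := hb'.mul_prod ha
  have hI : Integrable (Function.uncurry fun (z : Space N × Space N) (x : Space N) =>
      (Real.fourierChar (-inner ℝ x (z.1 - z.2)) : ℂ)
        * ((conj (b z.1) * a z.2) * w x)) ((volume.prod volume).prod volume) :=
    (hba.mul_prod hw).bdd_mul (c := 1) continuous_fourier_kernel.aestronglyMeasurable
      (Filter.Eventually.of_forall fun p => (Circle.norm_coe _).le)
  have e1 : ∀ z : Space N × Space N, 𝓕 w (z.1 - z.2) * (conj (b z.1) * a z.2)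
      = ∫ x, (Real.fourierChar (-inner ℝ x (z.1 - z.2)) : ℂ)
        * ((conj (b z.1) * a z.2) * w x) := by
    intro z
    rw [Real.fourier_eq, ← integral_mul_const]
    refine integral_congr_ae (Filter.Eventually.of_forall fun x => ?_)
    simp only [Circle.smul_def, smul_eq_mul]
    ring
  simp_rw [e1]
  rw [← Measure.volume_eq_prod] at hI
  rw [integral_integral_swap hI]
  refine integral_congr_ae (Filter.Eventually.of_forall fun x => ?_)
  have e2 : ∀ z : Space N × Space N,
      (Real.fourierChar (-inner ℝ x (z.1 - z.2)) : ℂ) * ((conj (b z.1) * a z.2) * w x)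
      = w x * (((Real.fourierChar (-inner ℝ x z.1) : ℂ) * conj (b z.1))
        * ((Real.fourierChar (inner ℝ x z.2) : ℂ) * a z.2)) := by
    intro z
    rw [inner_sub_right, neg_sub, sub_eq_neg_add, AddChar.map_add_eq_mul, Circle.coe_mul]
    ring
  simp_rw [e2]
  rw [integral_const_mul, Measure.volume_eq_prod,
    integral_prod_mul (fun z => (Real.fourierChar (-inner ℝ x z) : ℂ) * conj (b z))
      (fun z => (Real.fourierChar (inner ℝ x z) : ℂ) * a z)]
  rw [mul_comm (𝓕⁻ a x), Real.fourierInv_eq, Real.fourierInv_eq, ← integral_conj]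
  congr 2
  · refine integral_congr_ae (Filter.Eventually.of_forall fun y => ?_)
    simp [Circle.smul_def, AddChar.map_neg_eq_inv, real_inner_comm]
  · refine integral_congr_ae (Filter.Eventually.of_forall fun y => ?_)
    simp [Circle.smul_def, real_inner_comm]

theorem integrable_fourier_sub_mul {w a b : Space N → ℂ} (hw : Integrable w)
    (ha : Integrable a) (hb : Integrable b) :
    Integrable fun z : Space N × Space N => 𝓕 w (z.1 - z.2) * (conj (b z.1) * a z.2) := by
  have hb' : Integrable (fun x => conj (b x)) :=
    conjCLE.toContinuousLinearMap.integrable_comp hb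
  have hba : Integrable (fun z : Space N × Space N => conj (b z.1) * a z.2) := hb'.mul_prod ha
  have hc : Continuous (𝓕 w) := VectorFourier.fourierIntegral_continuous
    Real.continuous_fourierChar (by exact continuous_inner) hw
  refine hba.bdd_mul (c := ∫ x, ‖w x‖) (hc.comp (by fun_prop)).aestronglyMeasurable
    (Filter.Eventually.of_forall fun z => ?_)
  exact VectorFourier.norm_fourierIntegral_le_integral_norm _ _ _ _ _

theorem integrable_sub_mul_snd {K G : Space N → ℝ} (hK : Integrable K) (hG : Integrable G) :
    Integrable (fun z : Space N × Space N => K (z.1 - z.2) * G z.2) ∧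
    ∫ z : Space N × Space N, K (z.1 - z.2) * G z.2 = (∫ x, K x) * ∫ x, G x := by
  have h := hG.convolution_integrand (ContinuousLinearMap.mul ℝ ℝ) hK
  have h' : Integrable (fun z : Space N × Space N => K (z.1 - z.2) * G z.2) := by
    rw [Measure.volume_eq_prod]
    simpa [mul_comm] using h
  refine ⟨h', ?_⟩
  rw [Measure.volume_eq_prod] at h' ⊢
  rw [integral_prod _ h', integral_integral_swap h']
  simp_rw [integral_mul_const]
  have : ∀ y : Space N, ∫ x, K (x - y) = ∫ x, K x := fun y => integral_sub_right_eq_self K y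
  simp_rw [this]
  rw [integral_const_mul]

theorem integrable_sub_mul_fst {K G : Space N → ℝ} (hK : Integrable K) (hG : Integrable G) :
    Integrable (fun z : Space N × Space N => K (z.1 - z.2) * G z.1) ∧
    ∫ z : Space N × Space N, K (z.1 - z.2) * G z.1 = (∫ x, K x) * ∫ x, G x := by
  obtain ⟨h1, h2⟩ := integrable_sub_mul_snd (K := fun x => K (-x)) hK.comp_neg hG
  have e : (fun z : Space N × Space N => K (z.1 - z.2) * G z.1)
      = (fun z : Space N × Space N => K (-(z.1 - z.2)) * G z.2) ∘ Prod.swap := by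
    funext z; simp
  refine ⟨by rw [e]; exact h1.swap, ?_⟩
  rw [e, Measure.volume_eq_prod]
  refine (integral_prod_swap (μ := volume) (ν := volume)
    (fun z : Space N × Space N => K (-(z.1 - z.2)) * G z.2)).trans ?_
  rw [← Measure.volume_eq_prod, h2, integral_neg_eq_self]

/-- Schur bound for a convolution kernel. -/
theorem norm_integral_kernel_le {k : Space N × Space N → ℂ} {K : Space N → ℝ} {f : Space N → ℂ}
    (hK : Integrable K) (hK0 : ∀ x, 0 ≤ K x) (hf : Integrable fun x => ‖f x‖ ^ 2)
    (hk : ∀ z, ‖k z‖ ≤ K (z.1 - z.2) * (‖f z.1‖ * ‖f z.2‖)) :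
    ‖∫ z, k z‖ ≤ (∫ x, K x) * ∫ x, ‖f x‖ ^ 2 := by
  obtain ⟨h1, h2⟩ := integrable_sub_mul_fst hK hf
  obtain ⟨h3, h4⟩ := integrable_sub_mul_snd hK hf
  have : ∫ z : Space N × Space N, (1 / 2 * (K (z.1 - z.2) * ‖f z.1‖ ^ 2)
      + 1 / 2 * (K (z.1 - z.2) * ‖f z.2‖ ^ 2)) = (∫ x, K x) * ∫ x, ‖f x‖ ^ 2 := by
    rw [integral_add (h1.const_mul _) (h3.const_mul _), integral_const_mul, integral_const_mul,
      h2, h4]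
    ring
  rw [← this]
  refine norm_integral_le_of_norm_le ((h1.const_mul _).add (h3.const_mul _))
    (Filter.Eventually.of_forall fun z => (hk z).trans ?_)
  -- Schur's test by 2|f(ξ)||f(ξ')| ≤ |f(ξ)|² + |f(ξ')|²; each square then integrates as a
  -- convolution.
  nlinarith [mul_nonneg (hK0 (z.1 - z.2)) (sq_nonneg (‖f z.1‖ - ‖f z.2‖))]

/-- With p and q the two roots, (p-q)(p+q) = (a-b)(a+b), while p² ≥ a²/2 and q² ≥ b²/2. Subtracting
η/2 and not η keeps the roots away from their branch point, so the Lipschitz constant does not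
depend on η. This is the origin of the factor ½ in the positivity bound. -/
theorem abs_sqrt_sub_sqrt_le {η a b : ℝ} (hη : 0 < η) (ha0 : 0 ≤ a) (hb0 : 0 ≤ b)
    (ha : η ≤ a ^ 2) (hb : η ≤ b ^ 2) :
    (Real.sqrt (a ^ 2 - η / 2) - Real.sqrt (b ^ 2 - η / 2)) ^ 2 ≤ 2 * (a - b) ^ 2 := by
  set p := Real.sqrt (a ^ 2 - η / 2) with hp
  set q := Real.sqrt (b ^ 2 - η / 2) with hq
  have hp2 : p ^ 2 = a ^ 2 - η / 2 := Real.sq_sqrt (by linarith)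
  have hq2 : q ^ 2 = b ^ 2 - η / 2 := Real.sq_sqrt (by linarith)
  have hp0 : 0 ≤ p := Real.sqrt_nonneg _
  have hq0 : 0 ≤ q := Real.sqrt_nonneg _
  have ha1 : 0 < a := by
    rcases ha0.lt_or_eq with h | h
    · exact h
    · rw [← h] at ha; linarith
  have h1 : (p - q) ^ 2 * (p + q) ^ 2 = (a - b) ^ 2 * (a + b) ^ 2 := by
    have : (p - q) * (p + q) = (a - b) * (a + b) := by linear_combination hp2 - hq2
    rw [← mul_pow, this, mul_pow]
  have h2 : (a + b) ^ 2 ≤ 2 * (p + q) ^ 2 := by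
    have h3 : |a * b| ≤ 2 * p * q := by
      refine abs_le_of_sq_le_sq ?_ (by positivity)
      rw [mul_pow, mul_pow, mul_pow, hp2, hq2]
      nlinarith
    nlinarith [le_abs_self (a * b)]
  have h5 : 0 < (p + q) ^ 2 := by
    have : 0 < (a + b) ^ 2 := by positivity
    linarith
  have h6 : (p - q) ^ 2 * (p + q) ^ 2 ≤ 2 * (a - b) ^ 2 * (p + q) ^ 2 := by
    rw [h1]; nlinarith [sq_nonneg (a - b)]
  exact le_of_mul_le_mul_right h6 h5

theorem fderiv_single_eq_fourierInv (φ : 𝓢(Space N, ℂ)) (j : Fin N) (x : Space N) :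
    fderiv ℝ φ x (EuclideanSpace.single j 1)
      = 𝓕⁻ (fun ξ : Space N => (2 * Real.pi * I * ξ j : ℂ) * 𝓕 φ ξ) x := by
  have h := SchwartzMap.lineDeriv_eq_fourierMultiplierCLM (EuclideanSpace.single j (1 : ℝ)) φ
  rw [← SchwartzMap.lineDerivOp_apply_eq_fderiv, h, SchwartzMap.fourierMultiplierCLM_apply,
    ← FourierTransform.fourierInv_smul, SchwartzMap.fourierInv_coe]
  refine congrArg (fun F : Space N → ℂ => 𝓕⁻ F x) (funext fun ξ => ?_)
  rw [smul_apply, SchwartzMap.smulLeftCLM_apply_apply (by fun_prop)]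
  simp [EuclideanSpace.inner_single_right]
  ring

theorem integrable_coord_mul (f : 𝓢(Space N, ℂ)) (j : Fin N) (c : ℂ) :
    Integrable fun ξ : Space N => (c * ξ j : ℂ) * f ξ := by
  refine ((f.integrable_pow_mul volume 1).const_mul ‖c‖).mono' ?_ ?_
  · have := f.continuous
    exact Continuous.aestronglyMeasurable (by fun_prop)
  · filter_upwards with ξ
    rw [norm_mul, norm_mul, norm_real, pow_one, mul_assoc]
    gcongr
    exact PiLp.norm_apply_le ξ j

theorem integral_ofReal_mul_norm_sq (w : Space N → ℝ) (χ : Space N → ℂ) :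
    ((∫ x, w x * ‖χ x‖ ^ 2 : ℝ) : ℂ) = ∫ x, (w x : ℂ) * (χ x * conj (χ x)) := by
  rw [← integral_complex_ofReal]
  congr 1
  funext x
  rw [mul_conj, normSq_eq_norm_sq]
  push_cast
  ring

/-- A localized lower bound on the kinetic energy of functions of high frequency. -/
theorem integral_mul_grad_sq_ge {w : Space N → ℝ} (hw : Continuous w) (hwc : HasCompactSupport w)
    (hw0 : ∀ x, 0 ≤ w x)
    (hK : Integrable fun q : Space N => ‖q‖ ^ 2 * ‖𝓕 (fun x => (w x : ℂ)) q‖)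
    {η : ℝ} (hη : 0 < η) (φ : 𝓢(Space N, ℂ))
    (hφ : ∀ ξ, 4 * Real.pi ^ 2 * ‖ξ‖ ^ 2 < η → 𝓕 φ ξ = 0) :
    η / 2 * (∫ x, w x * ‖φ x‖ ^ 2) - 6 * Real.pi ^ 2
        * (∫ q, ‖q‖ ^ 2 * ‖𝓕 (fun x : Space N => (w x : ℂ)) q‖) * norm2 φ ^ 2
      ≤ ∫ x, w x * ∑ j, ‖fderiv ℝ φ x (EuclideanSpace.single j 1)‖ ^ 2 := by
  set f : 𝓢(Space N, ℂ) := 𝓕 φ with hf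
  set W : Space N → ℂ := 𝓕 (fun x => (w x : ℂ)) with hW
  have iw : Integrable fun x => (w x : ℂ) := (hw.integrable_of_hasCompactSupport hwc).ofReal
  -- The symbol of (-Δ - η/2)^{1/2}. The real square root returns 0 at low frequencies, where 𝓕 φ
  -- vanishes.
  set b : Space N → ℝ := fun ξ => Real.sqrt ((2 * Real.pi * ‖ξ‖) ^ 2 - η / 2) with hb
  have ib : Integrable fun ξ => (b ξ : ℂ) * f ξ := by
    refine ((f.integrable_pow_mul volume 1).const_mul (2 * Real.pi)).mono' ?_ ?_
    · have := f.continuous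
      exact Continuous.aestronglyMeasurable (by fun_prop)
    · filter_upwards with ξ
      rw [norm_mul, norm_real, pow_one, Real.norm_of_nonneg (Real.sqrt_nonneg _), ← mul_assoc]
      gcongr
      exact Real.sqrt_le_iff.2 ⟨by positivity, by linarith⟩
  have ij := fun j => integrable_coord_mul f j (2 * Real.pi * I)
  have hφf : ∀ x, φ x = 𝓕⁻ (f : Space N → ℂ) x := fun x => by
    rw [← SchwartzMap.fourierInv_coe, hf, FourierTransform.fourierInv_fourier_eq]
  have q1 := integral_mul_fourierInv_mul_conj iw f.integrable f.integrable
  have q2 := integral_mul_fourierInv_mul_conj iw ib ib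
  have q3 := fun j => integral_mul_fourierInv_mul_conj iw (ij j) (ij j)
  have r1 := integrable_fourier_sub_mul iw f.integrable f.integrable
  have r2 := integrable_fourier_sub_mul iw ib ib
  have r3 := fun j => integrable_fourier_sub_mul iw (ij j) (ij j)
  have hsum : ∫ x, w x * ∑ j, ‖fderiv ℝ φ x (EuclideanSpace.single j 1)‖ ^ 2
      = ∑ j, ∫ x, w x * ‖fderiv ℝ φ x (EuclideanSpace.single j 1)‖ ^ 2 := by
    simp_rw [Finset.mul_sum]
    refine integral_finsetSum _ fun j _ => Continuous.integrable_of_hasCompactSupport ?_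
      hwc.mul_right
    have := ((φ.smooth ⊤).continuous_fderiv (by simp)).clm_apply
      (continuous_const (y := EuclideanSpace.single j (1 : ℝ)))
    fun_prop
  -- The nonnegative form with kernel ŵ(ξ-ξ')b(ξ)b(ξ'); it is dropped in the final inequality.
  set Qb : ℝ := ∫ x, w x * ‖𝓕⁻ (fun ξ => (b ξ : ℂ) * f ξ) x‖ ^ 2 with hQb
  have hQb0 : 0 ≤ Qb := integral_nonneg fun x => mul_nonneg (hw0 x) (by positivity)
  set k : Space N × Space N → ℂ := fun z =>
    (∑ j, W (z.1 - z.2) * (conj ((2 * Real.pi * I * z.1 j : ℂ) * f z.1)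
        * ((2 * Real.pi * I * z.2 j : ℂ) * f z.2)))
      - (((η / 2 : ℝ) : ℂ) * (W (z.1 - z.2) * (conj (f z.1) * f z.2))
      + W (z.1 - z.2) * (conj ((b z.1 : ℂ) * f z.1) * ((b z.2 : ℂ) * f z.2))) with hk
  have hkint : (((∑ j, ∫ x, w x * ‖fderiv ℝ φ x (EuclideanSpace.single j 1)‖ ^ 2)
      - (η / 2 * (∫ x, w x * ‖φ x‖ ^ 2) + Qb) : ℝ) : ℂ) = ∫ z, k z := by
    have r1' : Integrable fun z : Space N × Space N =>
      ((η / 2 : ℝ) : ℂ) * (W (z.1 - z.2) * (conj (f z.1) * f z.2)) := r1.const_mul _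
    rw [hk, integral_sub (integrable_finsetSum _ fun j _ => r3 j) (by exact r1'.add r2),
      integral_add r1' r2, integral_finsetSum _ fun j _ => r3 j, integral_const_mul, ← q1, ← q2]
    simp_rw [← q3]
    push_cast
    rw [hQb, integral_ofReal_mul_norm_sq, integral_ofReal_mul_norm_sq]
    simp_rw [integral_ofReal_mul_norm_sq, fderiv_single_eq_fourierInv, hφf]
    rfl
  have hkb : ‖∫ z, k z‖ ≤ (∫ q, 6 * Real.pi ^ 2 * (‖q‖ ^ 2 * ‖W q‖)) * ∫ x, ‖f x‖ ^ 2 := by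
    refine norm_integral_kernel_le (hK.const_mul _) (fun x => by positivity)
      (integrable_norm_sq f) fun z => ?_
    have e : k z = ((4 * Real.pi ^ 2 * inner ℝ z.1 z.2 - η / 2 - b z.1 * b z.2 : ℝ) : ℂ)
        * (W (z.1 - z.2) * (conj (f z.1) * f z.2)) := by
      have hin : (inner ℝ z.1 z.2 : ℝ) = ∑ j, z.1 j * z.2 j := by
        simp [PiLp.inner_apply, mul_comm]
      have hj : ∀ j, W (z.1 - z.2) * (conj ((2 * Real.pi * I * z.1 j : ℂ) * f z.1)
          * ((2 * Real.pi * I * z.2 j : ℂ) * f z.2))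
          = ((z.1 j * z.2 j : ℝ) : ℂ)
            * (4 * Real.pi ^ 2 * (W (z.1 - z.2) * (conj (f z.1) * f z.2))) := by
        intro j
        simp only [map_mul, conj_I, conj_ofReal, map_ofNat]
        push_cast
        linear_combination (-4 * Real.pi ^ 2 * (z.1 j) * (z.2 j) * W (z.1 - z.2)
          * conj (f z.1) * f z.2 : ℂ) * I_sq
      rw [hk]
      simp only [hj]
      rw [← Finset.sum_mul, ← ofReal_sum, ← hin]
      simp only [map_mul, conj_ofReal]
      push_cast
      ring
    rw [e, norm_mul, norm_mul, norm_mul, RCLike.norm_conj, norm_real, Real.norm_eq_abs]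
    by_cases h1 : f z.1 = 0
    · simp [h1]
    by_cases h2 : f z.2 = 0
    · simp [h2]
    have p1 : η ≤ (2 * Real.pi * ‖z.1‖) ^ 2 := by
      by_contra hcon
      exact h1 (hφ _ (by nlinarith))
    have p2 : η ≤ (2 * Real.pi * ‖z.2‖) ^ 2 := by
      by_contra hcon
      exact h2 (hφ _ (by nlinarith))
    have hbb := abs_sqrt_sub_sqrt_le hη (by positivity) (by positivity) p1 p2
    have s1 : b z.1 ^ 2 = (2 * Real.pi * ‖z.1‖) ^ 2 - η / 2 := Real.sq_sqrt (by linarith)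
    have s2 : b z.2 ^ 2 = (2 * Real.pi * ‖z.2‖) ^ 2 - η / 2 := Real.sq_sqrt (by linarith)
    have hsub := norm_sub_sq_real z.1 z.2
    have htri : (‖z.1‖ - ‖z.2‖) ^ 2 ≤ ‖z.1 - z.2‖ ^ 2 :=
      sq_le_sq.2 ((abs_norm_sub_norm_le _ _).trans (le_abs_self _))
    -- Polarization: what remains after removing b(ξ)b(ξ') is quadratic in differences, so it can be
    -- charged to |q|²|ŵ(q)|. The constant 6π² used below is not sharp.
    have hE : 4 * Real.pi ^ 2 * inner ℝ z.1 z.2 - η / 2 - b z.1 * b z.2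
        = 1 / 2 * (b z.1 - b z.2) ^ 2 - 2 * Real.pi ^ 2 * ‖z.1 - z.2‖ ^ 2 := by
      rw [hsub]; linear_combination (-1 / 2 : ℝ) * s1 - 1 / 2 * s2
    have hbb' : (b z.1 - b z.2) ^ 2 ≤ 8 * Real.pi ^ 2 * ‖z.1 - z.2‖ ^ 2 := by
      refine hbb.trans ?_
      have : 2 * (2 * Real.pi * ‖z.1‖ - 2 * Real.pi * ‖z.2‖) ^ 2
        = 8 * Real.pi ^ 2 * (‖z.1‖ - ‖z.2‖) ^ 2 := by ring
      rw [this]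
      gcongr
    have hfin : |4 * Real.pi ^ 2 * inner ℝ z.1 z.2 - η / 2 - b z.1 * b z.2|
        ≤ 6 * Real.pi ^ 2 * ‖z.1 - z.2‖ ^ 2 := by
      rw [hE, abs_le]
      constructor <;> nlinarith [sq_nonneg (b z.1 - b z.2),
        mul_nonneg (sq_nonneg Real.pi) (sq_nonneg ‖z.1 - z.2‖)]
    calc _ ≤ 6 * Real.pi ^ 2 * ‖z.1 - z.2‖ ^ 2 * (‖W (z.1 - z.2)‖ * (‖f z.1‖ * ‖f z.2‖)) := by
          gcongr
      _ = _ := by ring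
  rw [← hkint, norm_real, Real.norm_eq_abs, integral_const_mul,
    SchwartzMap.integral_norm_sq_fourier, ← norm2_sq] at hkb
  rw [hsum]
  linarith [(abs_le.1 hkb).1]

end FourierForm

/-! ### Scaling of Fourier transforms; Fourier multipliers -/

section Multipliers

variable {N : ℕ}

theorem fourier_comp_inv_smul (w : Space N → ℂ) {T : ℝ} (hT : 0 < T) (q : Space N) :
    𝓕 (fun x => w (T⁻¹ • x)) q = ((T ^ N : ℝ) : ℂ) * 𝓕 w (T • q) := by
  rw [Real.fourier_eq, Real.fourier_eq]
  have := Measure.integral_comp_inv_smul (volume : Measure (Space N))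
    (fun y => Real.fourierChar (-inner ℝ y (T • q)) • w y) T
  rw [finrank_euclideanSpace_fin, abs_of_pos (pow_pos hT N), real_smul] at this
  rw [← this]
  refine integral_congr_ae (Filter.Eventually.of_forall fun x => ?_)
  simp only
  rw [inner_smul_left, inner_smul_right]
  congr 3
  simp
  field_simp

/-- Dilation preserves the L¹ norm of the Fourier transform and scales its second moment by T⁻².
With the prefactor t^{-α} this produces the error t^{-3α} in the positivity bound. -/
theorem integral_norm_sq_mul_fourier_comp_inv_smul (w : Space N → ℂ) {T : ℝ} (hT : 0 < T) :
    ∫ q, ‖q‖ ^ 2 * ‖𝓕 (fun x => w (T⁻¹ • x)) q‖ = (T⁻¹) ^ 2 * ∫ q, ‖q‖ ^ 2 * ‖𝓕 w q‖ := by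
  have h := Measure.integral_comp_smul (volume : Measure (Space N))
    (fun q => ‖q‖ ^ 2 * ‖𝓕 w q‖) T
  rw [finrank_euclideanSpace_fin, abs_of_pos (by positivity), smul_eq_mul] at h
  have e : ∀ q : Space N, ‖q‖ ^ 2 * ‖𝓕 (fun x => w (T⁻¹ • x)) q‖
      = (T ^ N * (T⁻¹) ^ 2) * (‖T • q‖ ^ 2 * ‖𝓕 w (T • q)‖) := by
    intro q
    rw [fourier_comp_inv_smul w hT, norm_mul, norm_real, norm_smul, Real.norm_of_nonneg hT.le,
      Real.norm_of_nonneg (by positivity)]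
    field_simp
  simp_rw [e]
  rw [integral_const_mul, h]
  field_simp

theorem integrable_norm_sq_mul_fourier {w : Space N → ℂ} (hw : ContDiff ℝ ∞ w)
    (hc : HasCompactSupport w) : Integrable fun q : Space N => ‖q‖ ^ 2 * ‖𝓕 w q‖ :=
  (𝓕 (hc.toSchwartzMap hw)).integrable_pow_mul volume 2

/-- The symbol is 1 minus a smooth compactly supported function. -/
theorem hasTemperateGrowth_cutoff {Φ : ℝ → ℝ} {δ η : ℝ} (hΦ : IsSmoothCutoff Φ δ) (hη : 0 < η) :
    Function.HasTemperateGrowth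
      fun ξ : Space N => ((Φ (4 * Real.pi ^ 2 * ‖ξ‖ ^ 2 / η) : ℝ) : ℂ) := by
  have hs : ContDiff ℝ ∞ fun ξ : Space N => Φ (4 * Real.pi ^ 2 * ‖ξ‖ ^ 2 / η) :=
    hΦ.smooth.comp ((contDiff_const.mul (contDiff_norm_sq ℝ)).div_const _)
  have hc : HasCompactSupport fun ξ : Space N => 1 - Φ (4 * Real.pi ^ 2 * ‖ξ‖ ^ 2 / η) := by
    refine HasCompactSupport.intro
      (isCompact_closedBall (0 : Space N) (Real.sqrt (η * (1 + δ)))) fun ξ hξ => ?_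
    rw [mem_closedBall_zero_iff, not_le] at hξ
    have h1 : η * (1 + δ) < ‖ξ‖ ^ 2 := (Real.sqrt_lt' (by
      have := Real.sqrt_nonneg (η * (1 + δ)); linarith)).1 hξ
    rw [hΦ.one _ ?_, sub_self]
    rw [le_div_iff₀ hη]
    have : (1 : ℝ) ≤ 4 * Real.pi ^ 2 := by nlinarith [Real.pi_gt_three]
    nlinarith [sq_nonneg ‖ξ‖]
  have h1 := (hc.hasTemperateGrowth (contDiff_const.sub hs))
  have h2 : (fun ξ : Space N => ((Φ (4 * Real.pi ^ 2 * ‖ξ‖ ^ 2 / η) : ℝ) : ℂ))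
      = ofReal ∘ ((fun _ => (1 : ℝ)) - fun ξ : Space N => 1 - Φ (4 * Real.pi ^ 2 * ‖ξ‖ ^ 2 / η)) := by
    funext ξ; simp
  rw [h2]
  exact Function.Complex.hasTemperateGrowth_ofReal.comp ((Function.HasTemperateGrowth.const 1).sub h1)

theorem fourier_freeFun {f : ℝ → ℝ} (hf : Function.HasTemperateGrowth
      fun ξ : Space N => ((f (4 * Real.pi ^ 2 * ‖ξ‖ ^ 2) : ℝ) : ℂ)) (ψ : 𝓢(Space N, ℂ))
    (ξ : Space N) :
    𝓕 (freeFun f ψ) ξ = ((f (4 * Real.pi ^ 2 * ‖ξ‖ ^ 2) : ℝ) : ℂ) * 𝓕 ψ ξ := by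
  rw [freeFun, SchwartzMap.fourierMultiplierCLM_apply, FourierTransform.fourier_fourierInv_eq,
    SchwartzMap.smulLeftCLM_apply_apply hf, smul_eq_mul]

theorem norm2_fourier (ψ : 𝓢(Space N, ℂ)) : norm2 (𝓕 ψ) = norm2 ψ :=
  SchwartzMap.norm_fourier_toL2_eq ψ

theorem norm2_le_of_norm_le {φ ψ : 𝓢(Space N, ℂ)} (h : ∀ x, ‖φ x‖ ≤ ‖ψ x‖) :
    norm2 φ ≤ norm2 ψ := by
  refine le_of_sq_le_sq ?_ (norm2_nonneg ψ)
  rw [norm2_sq, norm2_sq]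
  exact integral_mono (integrable_norm_sq φ) (integrable_norm_sq ψ) fun x => by
    have := h x
    gcongr

theorem norm2_freeFun_le {f : ℝ → ℝ} (hf : Function.HasTemperateGrowth
      fun ξ : Space N => ((f (4 * Real.pi ^ 2 * ‖ξ‖ ^ 2) : ℝ) : ℂ)) (hb : ∀ l, |f l| ≤ 1)
    (ψ : 𝓢(Space N, ℂ)) : norm2 (freeFun f ψ) ≤ norm2 ψ := by
  rw [← norm2_fourier, ← norm2_fourier ψ]
  refine norm2_le_of_norm_le fun ξ => ?_
  rw [fourier_freeFun hf, norm_mul, norm_real]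
  exact mul_le_of_le_one_left (norm_nonneg _) (hb _)

end Multipliers

/-! ### Radial and angular parts of the gradient -/

section Positivity

variable {N : ℕ}

/-- Lagrange's identity. The summand is symmetric and vanishes on the diagonal, so the sum over j <
k is half of the full double sum, which expands directly. -/
theorem sum_mul_sq_add_sum_sub_sq (x : Fin N → ℝ) (a : Fin N → ℂ) :
    ‖∑ j, (x j : ℂ) * a j‖ ^ 2
      + ∑ j, ∑ k ∈ Finset.Ioi j, ‖(x j : ℂ) * a k - (x k : ℂ) * a j‖ ^ 2
      = (∑ j, x j ^ 2) * ∑ j, ‖a j‖ ^ 2 := by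
  set c : Fin N → Fin N → ℂ := fun j k => (x j : ℂ) * a k with hc
  set s : Fin N → Fin N → ℝ := fun j k => ‖c j k - c k j‖ ^ 2 with hs
  have hsym : ∀ j k, s j k = s k j := fun j k => by simp only [hs]; rw [norm_sub_rev]
  have h1 : ∑ j, ∑ k ∈ Finset.Ioi j, s j k = 1 / 2 * ∑ j, ∑ k, s j k := by
    have h2 := Finset.sum_sum_Ioi_add_eq_sum_sum_off_diag s
    have h3 : ∀ j, ∑ k ∈ ({j}ᶜ : Finset (Fin N)), s k j = ∑ k, s j k := by
      intro j
      rw [← Finset.sum_compl_add_sum {j}, Finset.sum_singleton]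
      simp only [hsym _ j]
      simp [hs]
    simp only [h3] at h2
    rw [← h2, Finset.mul_sum]
    refine Finset.sum_congr rfl fun j _ => ?_
    rw [Finset.mul_sum]
    refine Finset.sum_congr rfl fun k _ => ?_
    rw [hsym k j]; ring
  have h4 : ∀ j k, s j k = x j ^ 2 * ‖a k‖ ^ 2 + x k ^ 2 * ‖a j‖ ^ 2
      - 2 * (((x j : ℂ) * a j) * conj ((x k : ℂ) * a k)).re := by
    intro j k
    simp only [hs, hc, ← normSq_eq_norm_sq]
    simp [normSq_apply]
    ring
  have h5 : ‖∑ j, (x j : ℂ) * a j‖ ^ 2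
      = ∑ j, ∑ k, (((x j : ℂ) * a j) * conj ((x k : ℂ) * a k)).re := by
    rw [← normSq_eq_norm_sq]
    have : ((normSq (∑ j, (x j : ℂ) * a j) : ℝ) : ℂ)
        = ∑ j, ∑ k, ((x j : ℂ) * a j) * conj ((x k : ℂ) * a k) := by
      rw [← mul_conj, map_sum, Finset.sum_mul_sum]
    rw [← ofReal_re (normSq _), this, re_sum]
    simp_rw [re_sum]
  rw [h1, h5]
  simp only [h4]
  simp only [Finset.sum_sub_distrib, Finset.sum_add_distrib, ← Finset.mul_sum, ← Finset.sum_mul]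
  ring

theorem norm_grad_sq_eq {φ : Space N → ℂ} {x : Space N} (hx : x ≠ 0) :
    ∑ j, ‖fderiv ℝ φ x (EuclideanSpace.single j 1)‖ ^ 2
      = ‖radialDeriv φ x‖ ^ 2
        + ‖x‖⁻¹ ^ 2 * ∑ j, ∑ k ∈ Finset.Ioi j, ‖angMom j k φ x‖ ^ 2 := by
  have hx0 := norm_pos_iff.2 hx
  have h := sum_mul_sq_add_sum_sub_sq (fun j => x j)
    (fun j => fderiv ℝ φ x (EuclideanSpace.single j 1))
  rw [sum_coord_mul_apply_single] at h
  have h1 : ∑ j, x j ^ 2 = ‖x‖ ^ 2 := by rw [EuclideanSpace.norm_sq_eq]; simp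
  have h2 : ∀ j k, ‖angMom j k φ x‖
      = ‖(x j : ℂ) * fderiv ℝ φ x (EuclideanSpace.single k 1)
        - (x k : ℂ) * fderiv ℝ φ x (EuclideanSpace.single j 1)‖ := by
    intro j k
    have : angMom j k φ x = -I * ((x j : ℂ) * fderiv ℝ φ x (EuclideanSpace.single k 1)
        - (x k : ℂ) * fderiv ℝ φ x (EuclideanSpace.single j 1)) := by
      rw [angMom, momentum, momentum]; ring
    rw [this, norm_mul]; simp
  rw [h1] at h
  simp_rw [h2]
  rw [radialDeriv, map_smul, norm_smul, mul_pow, Real.norm_of_nonneg (by positivity), ← mul_add, h]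
  field_simp

end Positivity

/-! ### Positivity of the commutator form -/

section PositivityEstimate

variable {N : ℕ} {F : ℝ → ℝ} {ε : ℝ}

theorem integrable_norm_sq_fderiv_single (φ : 𝓢(Space N, ℂ)) (j : Fin N) :
    Integrable fun x => ‖fderiv ℝ φ x (EuclideanSpace.single j 1)‖ ^ 2 :=
  integrable_norm_sq (LineDeriv.lineDerivOp (EuclideanSpace.single j (1 : ℝ)) φ)

theorem norm_angMom_sq_le (φ : Space N → ℂ) (x : Space N) (j k : Fin N) :
    ‖angMom j k φ x‖ ^ 2 ≤ 2 * ‖x‖ ^ 2 * (‖fderiv ℝ φ x (EuclideanSpace.single k 1)‖ ^ 2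
      + ‖fderiv ℝ φ x (EuclideanSpace.single j 1)‖ ^ 2) := by
  have h : ‖angMom j k φ x‖ ≤ ‖x‖ * ‖fderiv ℝ φ x (EuclideanSpace.single k 1)‖
      + ‖x‖ * ‖fderiv ℝ φ x (EuclideanSpace.single j 1)‖ := by
    refine (norm_sub_le _ _).trans ?_
    simp only [momentum, norm_mul, norm_neg, norm_I, one_mul, norm_real]
    gcongr
    · exact PiLp.norm_apply_le x j
    · exact PiLp.norm_apply_le x k
  refine (pow_le_pow_left₀ (norm_nonneg _) h 2).trans ?_
  nlinarith [mul_nonneg (sq_nonneg ‖x‖)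
    (sq_nonneg (‖fderiv ℝ φ x (EuclideanSpace.single k 1)‖
      - ‖fderiv ℝ φ x (EuclideanSpace.single j 1)‖))]

theorem continuous_angMom (φ : 𝓢(Space N, ℂ)) (j k : Fin N) : Continuous (angMom j k φ) := by
  have h : ∀ v : Space N, Continuous fun x => fderiv ℝ φ x v := fun v =>
    ((φ.smooth ⊤).continuous_fderiv (by simp)).clm_apply continuous_const
  unfold angMom momentum
  fun_prop

/-- `F` vanishes for |x| ≤ t^α and t^α ≥ 1, so the factor r⁻³ never meets the origin and absorbs the
r² in the bound of the angular momentum by the gradient. -/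
theorem IsSmoothCutoff.integrable_angular (hF : IsSmoothCutoff F ε) (α : ℝ) {t : ℝ}
    (hT : 1 ≤ t ^ α) (φ : 𝓢(Space N, ℂ)) (j k : Fin N) :
    Integrable fun x => scaled F α t x / ‖x‖ ^ 3 * ‖angMom j k φ x‖ ^ 2 := by
  refine (((integrable_norm_sq_fderiv_single φ k).add
    (integrable_norm_sq_fderiv_single φ j)).const_mul 2).mono' ?_ ?_
  · have h1 : Measurable (scaled F α t : Space N → ℝ) :=
      (hF.smooth.continuous.comp (by fun_prop : Continuous fun x : Space N =>
        ‖x‖ / t ^ α)).measurable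
    have h2 := (continuous_angMom φ j k).measurable
    exact Measurable.aestronglyMeasurable (by fun_prop)
  · filter_upwards with x
    have hF0 : 0 ≤ scaled F α t x := hF.nonneg _
    rw [Real.norm_of_nonneg (by positivity)]
    simp only [Pi.add_apply]
    rcases le_or_gt ‖x‖ (t ^ α) with hx | hx
    · have : scaled F α t x = 0 := hF.zero _ ((div_le_one (by linarith)).2 hx)
      rw [this]; simp; positivity
    · have hx1 : 1 < ‖x‖ := by linarith
      calc _ ≤ 1 / ‖x‖ ^ 3 * (2 * ‖x‖ ^ 2 * (‖fderiv ℝ φ x (EuclideanSpace.single k 1)‖ ^ 2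
            + ‖fderiv ℝ φ x (EuclideanSpace.single j 1)‖ ^ 2)) := by
            gcongr
            · exact hF.le_one _
            · exact norm_angMom_sq_le φ x j k
        _ = ‖x‖⁻¹ * (2 * (‖fderiv ℝ φ x (EuclideanSpace.single k 1)‖ ^ 2
            + ‖fderiv ℝ φ x (EuclideanSpace.single j 1)‖ ^ 2)) := by field_simp
        _ ≤ _ := mul_le_of_le_one_left (by positivity) (inv_le_one_of_one_le₀ hx1.le)

theorem half_sq_sub_sq_le (a b : ℂ) : 1 / 2 * ‖a‖ ^ 2 - ‖b‖ ^ 2 ≤ ‖a + b‖ ^ 2 := by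
  have h : ‖a‖ ≤ ‖a + b‖ + ‖b‖ := by simpa using norm_sub_le (a + b) b
  nlinarith [norm_nonneg a, norm_nonneg b, norm_nonneg (a + b), sq_nonneg (‖a + b‖ - ‖b‖)]

theorem norm_unit_le (x : Space N) : ‖‖x‖⁻¹ • x‖ ≤ 1 := by
  rw [norm_smul, norm_inv, norm_norm]
  exact inv_mul_le_one

/-- Almost everywhere ∂_r(hφ) = h∂_rφ + (∂_r h)φ, and |a+b|² ≥ ½|a|² - |b|². This avoids integrating
by parts, at the price of half the radial energy. -/
theorem IsSmoothCutoff.radialForm_ge (hF : IsSmoothCutoff F ε) {K : NNReal}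
    (hK : LipschitzWith K (sqrtDeriv F)) (α : ℝ) {t : ℝ} (ht : 0 < t) (φ : 𝓢(Space N, ℂ)) :
    Integrable (fun x => scaled (deriv F) α t x * ‖radialDeriv φ x‖ ^ 2) ∧
    1 / 2 * (∫ x, scaled (deriv F) α t x * ‖radialDeriv φ x‖ ^ 2)
        - (K * t ^ (-α)) ^ 2 * norm2 φ ^ 2
      ≤ (radialForm F α t φ φ).re := by
  have hL := lipschitzWith_scaled (N := N) hK α ht
  have hfc := hF.hasCompactSupport_scaled_deriv (N := N) α ht
  have hfs := hF.contDiff_scaled_deriv (N := N) α ht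
  have hch := hasCompactSupport_of_sq (hF.scaled_deriv_eq α t) hfc
  set h : Space N → ℝ := scaled (sqrtDeriv F) α t with hh
  have hfd : Continuous (fderiv ℝ φ) := (φ.smooth ⊤).continuous_fderiv (by simp)
  have munit : Measurable fun x : Space N => ‖x‖⁻¹ • x := by fun_prop
  have mrad : ∀ w : Space N → ℂ, Measurable (radialDeriv w) := fun w =>
    isBoundedBilinearMap_apply.continuous.measurable.comp ((measurable_fderiv ℝ w).prodMk munit)
  have i1 : Integrable (fun x => scaled (deriv F) α t x * ‖radialDeriv φ x‖ ^ 2) := by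
    have : Integrable fun x => scaled (deriv F) α t x * ‖fderiv ℝ φ x‖ ^ 2 :=
      Continuous.integrable_of_hasCompactSupport (by have := hfs.continuous; fun_prop)
        hfc.mul_right
    refine this.mono' ?_ ?_
    · have h1 := hfs.continuous.measurable
      have h2 := mrad φ
      exact Measurable.aestronglyMeasurable (by fun_prop)
    · filter_upwards with x
      have : 0 ≤ scaled (deriv F) α t x := hF.deriv_nonneg _
      rw [Real.norm_of_nonneg (by positivity)]
      gcongr
      exact (ContinuousLinearMap.le_opNorm _ _).trans
        (mul_le_of_le_one_right (norm_nonneg _) (norm_unit_le x))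
  refine ⟨i1, ?_⟩
  have hbound : ∀ x, ‖((fderiv ℝ h x (‖x‖⁻¹ • x) : ℝ) : ℂ) * φ x‖ ^ 2
      ≤ (K * t ^ (-α)) ^ 2 * ‖φ x‖ ^ 2 := by
    intro x
    have := abs_fderiv_le_of_lipschitzWith hL (norm_unit_le x) (x := x)
    simp only [NNReal.coe_mul, Real.coe_toNNReal _ (Real.rpow_nonneg ht.le _), mul_one] at this
    rw [norm_mul, mul_pow, norm_real, Real.norm_eq_abs]
    gcongr
  have hae : ∀ᵐ x, radialDeriv (fun y => ((h y : ℝ) : ℂ) * φ y) x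
      = (h x : ℂ) * radialDeriv φ x + ((fderiv ℝ h x (‖x‖⁻¹ • x) : ℝ) : ℂ) * φ x := by
    filter_upwards [hL.ae_differentiableAt (μ := volume)] with x hx
    rw [radialDeriv, fderiv_ofReal_mul hx φ.differentiableAt]
    rfl
  have hsq : ∀ x, ‖(h x : ℂ) * radialDeriv φ x‖ ^ 2
      = scaled (deriv F) α t x * ‖radialDeriv φ x‖ ^ 2 := by
    intro x
    rw [norm_mul, mul_pow, norm_real, hF.scaled_deriv_eq, Real.norm_eq_abs, sq_abs]
  have hre : (radialForm F α t φ φ).re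
      = ∫ x, ‖radialDeriv (fun y => ((h y : ℝ) : ℂ) * φ y) x‖ ^ 2 := by
    unfold radialForm
    have : ∀ x, radialDeriv (fun y => ((h y : ℝ) : ℂ) * φ y) x
        * conj (radialDeriv (fun y => ((h y : ℝ) : ℂ) * φ y) x)
        = ((‖radialDeriv (fun y => ((h y : ℝ) : ℂ) * φ y) x‖ ^ 2 : ℝ) : ℂ) := fun x => by
      rw [mul_conj, normSq_eq_norm_sq]
    rw [integral_congr_ae (Filter.Eventually.of_forall this), integral_complex_ofReal, ofReal_re]
  have i2 := (integrable_norm_sq φ).const_mul ((K * t ^ (-α)) ^ 2)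
  have i3 : Integrable fun x => ‖radialDeriv (fun y => ((h y : ℝ) : ℂ) * φ y) x‖ ^ 2 := by
    refine ((i1.const_mul 2).add (i2.const_mul 2)).mono'
      ((mrad _).norm.pow_const 2).aestronglyMeasurable ?_
    filter_upwards [hae] with x hx
    rw [hx, Real.norm_of_nonneg (by positivity), Pi.add_apply, ← hsq]
    refine (pow_le_pow_left₀ (norm_nonneg _) (norm_add_le _ _) 2).trans ?_
    nlinarith [hbound x, sq_nonneg (‖(h x : ℂ) * radialDeriv φ x‖
      - ‖((fderiv ℝ h x (‖x‖⁻¹ • x) : ℝ) : ℂ) * φ x‖)]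
  rw [hre, norm2_sq, ← integral_const_mul, ← integral_const_mul, ← integral_sub
    (i1.const_mul _) i2]
  refine integral_mono_ae ((i1.const_mul _).sub i2) i3 ?_
  filter_upwards [hae] with x hx
  rw [hx, ← hsq]
  linarith [hbound x, half_sq_sub_sq_le ((h x : ℂ) * radialDeriv φ x)
    (((fderiv ℝ h x (‖x‖⁻¹ • x) : ℝ) : ℂ) * φ x)]

theorem IsSmoothCutoff.exists_positivity (hF : IsSmoothCutoff F ε) {α : ℝ} (hα : 0 ≤ α)
    {Φ : ℝ → ℝ} {δ : ℝ} (hΦ : IsSmoothCutoff Φ δ) :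
    ∃ (Ft : ℝ → ℝ) (c₁ c₂ C : ℝ), ContDiff ℝ ∞ Ft ∧ 0 < c₁ ∧ 0 < c₂ ∧
      (∀ l, c₁ * (F l * deriv F l) ≤ Ft l ∧ Ft l ≤ c₂ * (F l * deriv F l)) ∧
      ∀ η : ℝ, 0 < η → ∀ t : ℝ, 1 ≤ t → ∀ ψ φ : 𝓢(Space N, ℂ),
        φ = freeFun (fun l => Φ (l / η)) ψ →
        1 / 2 * η * (t ^ (-α) * densityForm Ft α t φ) - C * t ^ (-(3 * α)) * norm2 ψ ^ 2
          ≤ t ^ (-α) * (radialForm F α t φ φ).re + angularForm F α t φ := by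
  obtain ⟨K, hK⟩ := hF.exists_lipschitzWith_sqrtDeriv
  obtain ⟨M, hM, hMb⟩ := exists_abs_le_of_eq_zero_outside hF.contDiff_deriv.continuous
    hF.deriv_eq_zero_outside
  have hε := hF.pos
  -- The value 1/2 pays for the loss in the radial form. The value 1/(M(1+ε)) ensures c t^{-α} F₁' r
  -- ≤ 1 for r < (1+ε)t^α, so that the weight r⁻³ on L² dominates c t^{-α} F₁' r⁻².
  set c : ℝ := min (1 / 2) (1 / (M * (1 + ε))) with hc
  have hc0 : 0 < c := by positivity
  have hc1 : c ≤ 1 / 2 := min_le_left _ _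
  have hc2 : c ≤ 1 / (M * (1 + ε)) := min_le_right _ _
  set G : ℝ → ℝ := fun l => F l * deriv F l with hG
  have hGs : ContDiff ℝ ∞ G := hF.smooth.mul hF.contDiff_deriv
  have hG0 : ∀ l, 0 ≤ G l := fun l => mul_nonneg (hF.nonneg l) (hF.deriv_nonneg l)
  set J : ℝ := ∫ q : Space N, ‖q‖ ^ 2 * ‖𝓕 (fun x : Space N => ((G ‖x‖ : ℝ) : ℂ)) q‖ with hJ
  have hJ0 : 0 ≤ J := integral_nonneg fun q => by positivity
  -- Since F̃ is a multiple of FF', both comparison constants are c. In the error, K² comes from ∂_r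
  -- h and the term with J from the localized kinetic energy bound.
  refine ⟨fun l => c * G l, c, c, K ^ 2 + c * (6 * Real.pi ^ 2 * J), contDiff_const.mul hGs, hc0,
    hc0, fun l => ⟨le_rfl, le_rfl⟩, fun η hη t ht ψ φ hφ => ?_⟩
  have ht0 : 0 < t := by linarith
  have hT : 0 < t ^ α := Real.rpow_pos_of_pos ht0 α
  have hT1 : 1 ≤ t ^ α := Real.one_le_rpow ht hα
  set w : Space N → ℝ := scaled G α t with hw
  have hws : ContDiff ℝ ∞ w := contDiff_scaled hGs (c := 0) (fun l hl => by
    simp only [hG]; rw [hF.zero l hl, zero_mul]) α ht0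
  have hwc : HasCompactSupport w := hasCompactSupport_scaled (b := 1 + ε) (fun l hl => by
    simp only [hG]; rw [hF.deriv_eq_zero_of_ge hl.le, mul_zero]) α ht0
  have hw0 : ∀ x, 0 ≤ w x := fun x => hG0 _
  have hwC : (fun x => (w x : ℂ)) = fun x => (fun y : Space N => ((G ‖y‖ : ℝ) : ℂ)) ((t ^ α)⁻¹ • x)
      := by
    funext x
    simp only [hw, scaled]
    rw [norm_smul, norm_inv, Real.norm_of_nonneg hT.le, div_eq_inv_mul]
  have hJt := integral_norm_sq_mul_fourier_comp_inv_smul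
    (fun y : Space N => ((G ‖y‖ : ℝ) : ℂ)) hT
  rw [← hwC] at hJt
  have hKw := integrable_norm_sq_mul_fourier (ofRealCLM.contDiff.comp hws)
    (hwc.comp_left (g := fun r : ℝ => (r : ℂ)) (by simp))
  have hsupp : ∀ ξ, 4 * Real.pi ^ 2 * ‖ξ‖ ^ 2 < η → 𝓕 φ ξ = 0 := by
    intro ξ hξ
    rw [hφ, fourier_freeFun (hasTemperateGrowth_cutoff hΦ hη), hΦ.zero _ ((div_le_one hη).2 hξ.le)]
    simp
  have key := integral_mul_grad_sq_ge hws.continuous hwc hw0 hKw hη φ hsupp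
  have hφψ : norm2 φ ≤ norm2 ψ := by
    rw [hφ]
    refine norm2_freeFun_le (hasTemperateGrowth_cutoff hΦ hη) (fun l => ?_) ψ
    rw [abs_of_nonneg (hΦ.nonneg _)]
    exact hΦ.le_one _
  obtain ⟨irad, hrad⟩ := hF.radialForm_ge hK α ht0 φ
  have iang := fun j k => hF.integrable_angular α hT1 φ j k
  have hang : angularForm F α t φ
      = ∫ x, ∑ j, ∑ k ∈ Finset.Ioi j, scaled F α t x / ‖x‖ ^ 3 * ‖angMom j k φ x‖ ^ 2 := by
    rw [angularForm, integral_finsetSum _ fun j _ => integrable_finsetSum _ fun k _ => iang j k]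
    refine Finset.sum_congr rfl fun j _ => ?_
    rw [integral_finsetSum _ fun k _ => iang j k]
  have ilow : Integrable fun x => w x * ∑ j, ‖fderiv ℝ φ x (EuclideanSpace.single j 1)‖ ^ 2 := by
    refine Continuous.integrable_of_hasCompactSupport ?_ hwc.mul_right
    have h : ∀ v : Space N, Continuous fun x => fderiv ℝ φ x v := fun v =>
      ((φ.smooth ⊤).continuous_fderiv (by simp)).clm_apply continuous_const
    have := hws.continuous
    fun_prop
  have iangs : Integrable fun x =>
      ∑ j, ∑ k ∈ Finset.Ioi j, scaled F α t x / ‖x‖ ^ 3 * ‖angMom j k φ x‖ ^ 2 :=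
    integrable_finsetSum _ fun j _ => integrable_finsetSum _ fun k _ => iang j k
  have hpt : c * (t ^ α)⁻¹ * (∫ x, w x * ∑ j, ‖fderiv ℝ φ x (EuclideanSpace.single j 1)‖ ^ 2)
      ≤ (t ^ α)⁻¹ * (1 / 2 * ∫ x, scaled (deriv F) α t x * ‖radialDeriv φ x‖ ^ 2)
        + angularForm F α t φ := by
    rw [hang, ← integral_const_mul, ← integral_const_mul, ← integral_const_mul,
      ← integral_add ((irad.const_mul _).const_mul _) iangs]
    refine integral_mono (ilow.const_mul _) (((irad.const_mul _).const_mul _).add iangs)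
      fun x => ?_
    simp only [← Finset.mul_sum]
    have hF0 : 0 ≤ scaled F α t x := hF.nonneg _
    have hF1 : scaled F α t x ≤ 1 := hF.le_one _
    have hD0 : 0 ≤ scaled (deriv F) α t x := hF.deriv_nonneg _
    have hDM : scaled (deriv F) α t x ≤ M := (le_abs_self _).trans (hMb _)
    have hwx : w x = scaled F α t x * scaled (deriv F) α t x := rfl
    set S : ℝ := ∑ j, ∑ k ∈ Finset.Ioi j, ‖angMom j k φ x‖ ^ 2 with hS
    have hS0 : 0 ≤ S := Finset.sum_nonneg fun j _ => Finset.sum_nonneg fun k _ => by positivity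
    by_cases h0 : w x = 0
    · rw [h0]
      simp only [zero_mul, mul_zero]
      positivity
    · have hx1 : t ^ α < ‖x‖ := by
        by_contra hcon
        apply h0
        rw [hwx, scaled, hF.zero _ ((div_le_one hT).2 (not_lt.1 hcon)), zero_mul]
      have hx2 : ‖x‖ < (1 + ε) * t ^ α := by
        by_contra hcon
        apply h0
        rw [hwx, show scaled (deriv F) α t x = 0 from
          hF.deriv_eq_zero_of_ge ((le_div_iff₀ hT).2 (not_lt.1 hcon)), mul_zero]
      have hxpos : 0 < ‖x‖ := by linarith
      rw [norm_grad_sq_eq (norm_pos_iff.1 hxpos), mul_add, mul_add]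
      refine add_le_add ?_ ?_
      · calc c * (t ^ α)⁻¹ * (w x * ‖radialDeriv φ x‖ ^ 2)
            = (t ^ α)⁻¹ * (c * (w x * ‖radialDeriv φ x‖ ^ 2)) := by ring
          _ ≤ _ := by
            rw [hwx]
            gcongr
            exact mul_le_of_le_one_left hD0 hF1
      · rw [hwx]
        have h3 : c * (t ^ α)⁻¹ * scaled (deriv F) α t x * ‖x‖ ≤ 1 := by
          calc c * (t ^ α)⁻¹ * scaled (deriv F) α t x * ‖x‖
              ≤ 1 / (M * (1 + ε)) * (t ^ α)⁻¹ * M * ((1 + ε) * t ^ α) := by gcongr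
            _ = 1 := by field_simp
        calc c * (t ^ α)⁻¹ * (scaled F α t x * scaled (deriv F) α t x * (‖x‖⁻¹ ^ 2 * S))
            = (c * (t ^ α)⁻¹ * scaled (deriv F) α t x * ‖x‖) * (scaled F α t x / ‖x‖ ^ 3 * S) := by
              field_simp
          _ ≤ scaled F α t x / ‖x‖ ^ 3 * S := mul_le_of_le_one_left (by positivity) h3
  have hdens : densityForm (fun l => c * G l) α t φ = c * ∫ x, w x * ‖φ x‖ ^ 2 := by
    rw [densityForm, ← integral_const_mul]
    congr 1
    funext x
    simp only [scaled, hw]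
    ring
  have hpow : t ^ (-(3 * α)) = (t ^ α)⁻¹ ^ 3 := by
    rw [← Real.rpow_neg ht0.le, ← Real.rpow_natCast, ← Real.rpow_mul ht0.le]
    congr 1; push_cast; ring
  rw [Real.rpow_neg ht0.le] at hrad ⊢
  rw [hdens, hpow]
  rw [hJt] at key
  have hn : norm2 φ ^ 2 ≤ norm2 ψ ^ 2 := pow_le_pow_left₀ (norm2_nonneg φ) hφψ 2
  have hTi : 0 < (t ^ α)⁻¹ := inv_pos.2 hT
  have k1 := mul_le_mul_of_nonneg_left key (mul_nonneg hc0.le hTi.le)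
  have k2 := mul_le_mul_of_nonneg_left hrad hTi.le
  have k3 : (t ^ α)⁻¹ ^ 3 * (K ^ 2 + c * (6 * Real.pi ^ 2 * J)) * norm2 φ ^ 2
      ≤ (t ^ α)⁻¹ ^ 3 * (K ^ 2 + c * (6 * Real.pi ^ 2 * J)) * norm2 ψ ^ 2 := by gcongr
  rw [← hJ] at k1
  linarith

end PositivityEstimate

/-! ### Multiplication operators on `L²` -/

section MulOp

variable {N : ℕ} {b c : Space N → ℂ}

open Classical in
/-- Multiplication by a bounded measurable function, as an operator on `L²`. -/
def mulOp (b : Space N → ℂ) : L2 N →L[ℂ] L2 N :=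
  if hb : MemLp b ∞ volume then
    (ContinuousLinearMap.mul ℂ ℂ).holderL volume ∞ 2 2 (hb.toLp b) else 0

theorem mulOp_ae (hb : MemLp b ∞ volume) (f : L2 N) :
    ∀ᵐ x, mulOp b f x = b x * f x := by
  rw [mulOp, dif_pos hb]
  filter_upwards [(ContinuousLinearMap.mul ℂ ℂ).coeFn_holder (r := 2) (hb.toLp b) f,
    hb.coeFn_toLp] with x h1 h2
  rw [← h2]
  exact h1

theorem mulOp_apply_eq (hb : MemLp b ∞ volume) {f g : L2 N}
    (h : ∀ᵐ x, g x = b x * f x) : mulOp b f = g := by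
  refine Lp.ext ?_
  filter_upwards [h, mulOp_ae hb f] with x h1 h2
  rw [h1, h2]

theorem norm_mulOp_le {C : ℝ} (hC : 0 ≤ C) (h : ∀ x, ‖b x‖ ≤ C) : ‖mulOp b‖ ≤ C := by
  by_cases hb : MemLp b ∞ volume
  · refine ContinuousLinearMap.opNorm_le_bound _ hC fun f => ?_
    refine Lp.norm_le_mul_norm_of_ae_le_mul ?_
    filter_upwards [mulOp_ae hb f] with x hx
    rw [hx, norm_mul]
    gcongr
    exact h x
  · rw [mulOp, dif_neg hb, norm_zero]
    exact hC

theorem mulOp_mul (hb : MemLp b ∞ volume) (hc : MemLp c ∞ volume) :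
    mulOp b * mulOp c = mulOp (fun x => b x * c x) := by
  refine ContinuousLinearMap.ext fun f => (mulOp_apply_eq (hc.mul hb) ?_).symm
  filter_upwards [mulOp_ae hb (mulOp c f), mulOp_ae hc f] with x h1 h2
  rw [mul_apply_eq_comp, h1, h2, Pi.mul_apply, mul_assoc]

theorem mulOp_add (hb : MemLp b ∞ volume) (hc : MemLp c ∞ volume) :
    mulOp (fun x => b x + c x) = mulOp b + mulOp c := by
  refine ContinuousLinearMap.ext fun f => mulOp_apply_eq (hb.add hc) ?_
  filter_upwards [mulOp_ae hb f, mulOp_ae hc f, Lp.coeFn_add (mulOp b f) (mulOp c f)] with x h1 h2 h3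
  rw [add_apply, h3, Pi.add_apply, Pi.add_apply, h1, h2, add_mul]

theorem mulOp_const (a : ℂ) : mulOp (fun _ : Space N => a) = a • 1 := by
  refine ContinuousLinearMap.ext fun f => mulOp_apply_eq (memLp_top_const a) ?_
  filter_upwards [Lp.coeFn_smul a f] with x h1
  rw [smul_apply, one_apply_eq_self, h1, Pi.smul_apply, smul_eq_mul]

theorem adjoint_mulOp (hb : MemLp b ∞ volume) :
    ContinuousLinearMap.adjoint (mulOp b) = mulOp fun x => conj (b x) := by
  symm
  rw [ContinuousLinearMap.eq_adjoint_iff]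
  intro f g
  rw [L2.inner_def, L2.inner_def]
  refine integral_congr_ae ?_
  have hc : MemLp (fun x => conj (b x)) ∞ volume := hb.star
  filter_upwards [mulOp_ae hb g, mulOp_ae hc f] with x h1 h2
  simp only [h1, h2, RCLike.inner_apply, map_mul, Complex.conj_conj]
  ring

theorem memLp_top_of_continuous {C : ℝ} (hb : Continuous b) (h : ∀ x, ‖b x‖ ≤ C) :
    MemLp b ∞ volume :=
  memLp_top_of_bound hb.aestronglyMeasurable C (Filter.Eventually.of_forall h)

theorem mulOp_toLp (hb : MemLp b ∞ volume) {φ ψ : 𝓢(Space N, ℂ)} (h : ∀ x, φ x = b x * ψ x) :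
    mulOp b (ψ.toLp 2 volume) = φ.toLp 2 volume := by
  refine mulOp_apply_eq hb ?_
  filter_upwards [φ.coeFn_toLp 2 volume, ψ.coeFn_toLp 2 volume] with x h1 h2
  rw [h1, h2, h]

end MulOp

/-! ### Fourier multipliers on `L²` -/

section FourierOp

open scoped BoundedContinuousFunction

variable {N : ℕ}

theorem BCF.memLp (b : Space N →ᵇ ℂ) : MemLp b ∞ volume :=
  memLp_top_of_continuous b.continuous b.norm_coe_le_norm

/-- The Fourier transform on `L²`. -/
def fourierL2 (N : ℕ) : L2 N ≃ₗᵢ[ℂ] L2 N := Lp.fourierTransformₗᵢ (Space N) ℂ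

/-- The bounded operator with Fourier symbol `b`. -/
def fourierOp (b : Space N →ᵇ ℂ) : L2 N →L[ℂ] L2 N :=
  ((fourierL2 N).symm : L2 N →L[ℂ] L2 N) * mulOp b * (fourierL2 N : L2 N →L[ℂ] L2 N)

theorem fourierOp_apply (b : Space N →ᵇ ℂ) (f : L2 N) :
    fourierOp b f = (fourierL2 N).symm (mulOp b (fourierL2 N f)) := rfl

theorem norm_fourierOp_le (b : Space N →ᵇ ℂ) : ‖fourierOp b‖ ≤ ‖b‖ := by
  refine ContinuousLinearMap.opNorm_le_bound _ (norm_nonneg b) fun f => ?_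
  rw [fourierOp_apply, LinearIsometryEquiv.norm_map]
  refine (ContinuousLinearMap.le_opNorm _ _).trans ?_
  rw [LinearIsometryEquiv.norm_map]
  gcongr
  exact norm_mulOp_le (norm_nonneg b) b.norm_coe_le_norm

theorem adjoint_fourierOp (b : Space N →ᵇ ℂ) :
    ContinuousLinearMap.adjoint (fourierOp b) = fourierOp (star b) := by
  symm
  rw [ContinuousLinearMap.eq_adjoint_iff]
  intro f g
  rw [fourierOp_apply, fourierOp_apply, ← (fourierL2 N).inner_map_map,
    ← (fourierL2 N).inner_map_map f, LinearIsometryEquiv.apply_symm_apply,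
    LinearIsometryEquiv.apply_symm_apply, ← ContinuousLinearMap.adjoint_inner_left,
    adjoint_mulOp (BCF.memLp b)]
  rfl

/-- The star homomorphism from Fourier symbols to operators. -/
def fourierOpHom (N : ℕ) : (Space N →ᵇ ℂ) →⋆ₐ[ℂ] (L2 N →L[ℂ] L2 N) where
  toFun := fourierOp
  map_one' := ContinuousLinearMap.ext fun f => by
    rw [fourierOp_apply]
    have : mulOp (⇑(1 : Space N →ᵇ ℂ)) = 1 := (mulOp_const 1).trans (one_smul ℂ _)
    rw [this]
    simp
  map_mul' b c := ContinuousLinearMap.ext fun f => by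
    have : mulOp (⇑(b * c)) = mulOp b * mulOp c :=
      (mulOp_mul (BCF.memLp b) (BCF.memLp c)).symm
    rw [mul_apply_eq_comp, fourierOp_apply, this, fourierOp_apply, fourierOp_apply]
    simp
  map_zero' := ContinuousLinearMap.ext fun f => by
    rw [fourierOp_apply]
    have : mulOp (⇑(0 : Space N →ᵇ ℂ)) = 0 := (mulOp_const 0).trans (zero_smul ℂ _)
    rw [this]
    simp
  map_add' b c := ContinuousLinearMap.ext fun f => by
    have : mulOp (⇑(b + c)) = mulOp b + mulOp c := mulOp_add (BCF.memLp b) (BCF.memLp c)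
    rw [add_apply, fourierOp_apply, this, fourierOp_apply, fourierOp_apply]
    simp
  commutes' a := ContinuousLinearMap.ext fun f => by
    have : mulOp (⇑(algebraMap ℂ (Space N →ᵇ ℂ) a)) = a • 1 := by
      rw [← mulOp_const]
      congr 1
    change fourierOp _ f = _
    rw [fourierOp_apply, this]
    simp [Algebra.algebraMap_eq_smul_one]
  map_star' b := (adjoint_fourierOp b).symm

theorem fourierOp_toLp (b : Space N →ᵇ ℂ) {φ ψ : 𝓢(Space N, ℂ)}
    (h : ∀ ξ, 𝓕 φ ξ = b ξ * 𝓕 ψ ξ) :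
    fourierOp b (ψ.toLp 2 volume) = φ.toLp 2 volume := by
  have h1 (χ : 𝓢(Space N, ℂ)) : fourierL2 N (χ.toLp 2 volume) = (𝓕 χ).toLp 2 volume :=
    SchwartzMap.toLp_fourier_eq χ
  rw [fourierOp_apply, h1, mulOp_toLp (BCF.memLp b) h, ← h1, LinearIsometryEquiv.symm_apply_apply]

end FourierOp

/-! ### Functional calculus under star homomorphisms -/

section Calculus

variable {X : Type*} [NormedAddCommGroup X] [InnerProductSpace ℂ X] [CompleteSpace X]

/-- Star homomorphisms commute with the continuous functional calculus. Here Ψ sends symbols to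
Fourier multipliers, and the characters χ will be evaluations at frequencies, which identify the
symbol b pointwise. -/
theorem boundedFun_map {A : Type*} [CStarAlgebra A] (Ψ : A →⋆ₐ[ℂ] (X →L[ℂ] X)) {a : A}
    (ha : IsSelfAdjoint a) {f : ℝ → ℝ} (hf : Continuous f) :
    ∃ b : A, boundedFun f (Ψ a) = Ψ b ∧ ∀ χ : A →⋆ₐ[ℂ] ℂ, χ b = f (χ a).re := by
  refine ⟨cfc (p := IsSelfAdjoint) f a, ?_, fun χ => ?_⟩
  · rw [boundedFun]
    refine (StarAlgHom.map_cfc (S := ℂ) Ψ f a hf.continuousOn ?_ ha (ha.map Ψ)).symm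
    exact AddMonoidHomClass.continuous_of_bound Ψ 1 fun x => by
      rw [one_mul]
      exact NonUnitalStarAlgHom.norm_apply_le Ψ x
  · have h1 : IsSelfAdjoint (χ a) := ha.map χ
    rw [StarAlgHom.map_cfc (S := ℂ) χ f a hf.continuousOn (map_continuous χ) ha h1]
    have h2 : χ a = algebraMap ℝ ℂ (χ a).re := (Complex.conj_eq_iff_re.1 h1).symm
    rw [h2, cfc_algebraMap]
    simp

end Calculus

/-! ### Bounded perturbations of a positive resolvent -/

section Perturbation

variable {X : Type*} [NormedAddCommGroup X] [InnerProductSpace ℂ X] [CompleteSpace X]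

/-- Since ‖BA‖ ≤ 1 - κ⁻¹ < 1, Y = (1+BA)⁻¹ exists, and AY is the perturbed resolvent. It is
self-adjoint because (1+AB)A = A(1+BA). The fixed-point equation Y = 1 - BAY gives ‖Y‖ ≤ κ, whence
‖AY‖ ≤ 1. -/
theorem exists_perturbed_resolvent {A B : X →L[ℂ] X} (hA : IsSelfAdjoint A)
    (hB : IsSelfAdjoint B) {κ : ℝ} (hκ : 1 ≤ κ) (hAn : ‖A‖ ≤ κ⁻¹) (hBn : ‖B‖ ≤ κ - 1) :
    ∃ Y : X →L[ℂ] X, (1 + B * A) * Y = 1 ∧ Y * (1 + B * A) = 1 ∧ IsSelfAdjoint (A * Y) ∧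
      ‖A * Y‖ ≤ 1 ∧ A - A * Y = A * B * (A * Y) := by
  have hκ0 : 0 < κ := by linarith
  have hq : ‖B * A‖ ≤ 1 - κ⁻¹ := by
    refine (norm_mul_le _ _).trans ?_
    calc ‖B‖ * ‖A‖ ≤ (κ - 1) * κ⁻¹ :=
          mul_le_mul hBn hAn (norm_nonneg _) (by linarith)
      _ = 1 - κ⁻¹ := by field_simp
  have hκi : 0 < κ⁻¹ := inv_pos.2 hκ0
  have hu : IsUnit (1 + B * A) := by
    have h := isUnit_one_sub_of_norm_lt_one (x := -(B * A)) (by rw [norm_neg]; linarith)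
    rwa [sub_neg_eq_add] at h
  obtain ⟨u, hu⟩ := hu
  set Y : X →L[ℂ] X := ↑u⁻¹ with hY
  have h1 : (1 + B * A) * Y = 1 := by rw [← hu]; exact u.mul_inv
  have h2 : Y * (1 + B * A) = 1 := by rw [← hu]; exact u.inv_mul
  have h3 : (1 + A * B) * A = A * (1 + B * A) := by noncomm_ring
  have h4 : star Y * (1 + A * B) = 1 := by
    have h := congrArg star h1
    rwa [star_mul, star_one, star_add, star_one, star_mul, hA.star_eq, hB.star_eq] at h
  have hsa : IsSelfAdjoint (A * Y) := by
    rw [IsSelfAdjoint, star_mul, hA.star_eq]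
    calc star Y * A = star Y * (A * ((1 + B * A) * Y)) := by rw [h1, mul_one]
      _ = star Y * ((A * (1 + B * A)) * Y) := by rw [mul_assoc A]
      _ = (star Y * (1 + A * B)) * A * Y := by rw [← h3]; noncomm_ring
      _ = A * Y := by rw [h4, one_mul]
  have hYn : ‖Y‖ ≤ κ := by
    refine ContinuousLinearMap.opNorm_le_bound _ hκ0.le fun x => ?_
    have h5 : Y x = x - (B * A) (Y x) := by
      have h := congrArg (fun Z : X →L[ℂ] X => Z x) h1
      simp only [mul_apply_eq_comp, add_apply, one_apply_eq_self] at h ⊢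
      exact eq_sub_of_add_eq h
    have h6 : ‖Y x‖ ≤ ‖x‖ + (1 - κ⁻¹) * ‖Y x‖ := by
      calc ‖Y x‖ = ‖x - (B * A) (Y x)‖ := congrArg _ h5
        _ ≤ ‖x‖ + ‖(B * A) (Y x)‖ := norm_sub_le _ _
        _ ≤ _ := by
          gcongr
          exact ((B * A).le_opNorm _).trans (by gcongr)
    have h7 : κ⁻¹ * ‖Y x‖ ≤ ‖x‖ := by linarith
    rwa [inv_mul_le_iff₀ hκ0] at h7
  refine ⟨Y, h1, h2, hsa, ?_, ?_⟩
  · calc ‖A * Y‖ ≤ κ⁻¹ * κ := (norm_mul_le _ _).trans (by gcongr)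
      _ = 1 := by field_simp
  · have h5 : A = A * ((1 + B * A) * Y) := by rw [h1, mul_one]
    nth_rewrite 1 [h5]
    noncomm_ring

end Perturbation

/-! ### The free resolvent -/

section FreeResolvent

variable {N : ℕ} {κ : ℝ}

theorem hasTemperateGrowth_one_add_norm_smul_sq_rpow (c r : ℝ) :
    Function.HasTemperateGrowth fun ξ : Space N => (1 + ‖c • ξ‖ ^ 2) ^ r :=
  (Function.hasTemperateGrowth_one_add_norm_sq_rpow (Space N) r).comp
    (by fun_prop : Function.HasTemperateGrowth fun ξ : Space N => c • ξ)

theorem hasTemperateGrowth_one_add_rpow (r : ℝ) :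
    Function.HasTemperateGrowth
      fun ξ : Space N => (((1 + 4 * Real.pi ^ 2 * ‖ξ‖ ^ 2) ^ r : ℝ) : ℂ) := by
  refine Function.Complex.hasTemperateGrowth_ofReal.comp ?_
  refine Eq.mp (congrArg _ (funext fun ξ => ?_))
    (hasTemperateGrowth_one_add_norm_smul_sq_rpow (N := N) (2 * Real.pi) r)
  rw [norm_smul, mul_pow, Real.norm_eq_abs, sq_abs, mul_pow]
  norm_num

theorem hasTemperateGrowth_resolvent (hκ : 1 ≤ κ) :
    Function.HasTemperateGrowth
      fun ξ : Space N => (((4 * Real.pi ^ 2 * ‖ξ‖ ^ 2 + κ)⁻¹ : ℝ) : ℂ) := by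
  refine Function.Complex.hasTemperateGrowth_ofReal.comp ?_
  have h := (Function.HasTemperateGrowth.const κ⁻¹).mul
    (hasTemperateGrowth_one_add_norm_smul_sq_rpow (N := N) (2 * Real.pi / Real.sqrt κ) (-1))
  refine Eq.mp (congrArg _ (funext fun ξ => ?_)) h
  change κ⁻¹ * (1 + ‖(2 * Real.pi / Real.sqrt κ) • ξ‖ ^ 2) ^ (-1 : ℝ) = _
  rw [norm_smul, mul_pow, Real.norm_eq_abs, sq_abs, div_pow, Real.sq_sqrt (by linarith),
    Real.rpow_neg_one, ← mul_inv]
  congr 1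
  have : κ ≠ 0 := by linarith
  field_simp
  ring

/-- The symbol of `(-Δ + κ)⁻¹`. -/
def freeSymbol (N : ℕ) (hκ : 1 ≤ κ) : BoundedContinuousFunction (Space N) ℂ :=
  BoundedContinuousFunction.ofNormedAddCommGroup
    (fun ξ : Space N => (((4 * Real.pi ^ 2 * ‖ξ‖ ^ 2 + κ)⁻¹ : ℝ) : ℂ))
    (hasTemperateGrowth_resolvent hκ).1.continuous κ⁻¹ fun ξ => by
      rw [norm_real, Real.norm_of_nonneg (by positivity)]
      gcongr
      exact le_add_of_nonneg_left (by positivity)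

theorem freeSymbol_apply (hκ : 1 ≤ κ) (ξ : Space N) :
    freeSymbol N hκ ξ = (((4 * Real.pi ^ 2 * ‖ξ‖ ^ 2 + κ)⁻¹ : ℝ) : ℂ) := rfl

theorem isSelfAdjoint_freeSymbol (hκ : 1 ≤ κ) : IsSelfAdjoint (freeSymbol N hκ) := by
  ext ξ
  exact Complex.conj_ofReal _

/-- The operator `(-Δ + κ)⁻¹`. -/
def freeResolvent (N : ℕ) (hκ : 1 ≤ κ) : L2 N →L[ℂ] L2 N := fourierOpHom N (freeSymbol N hκ)

theorem isSelfAdjoint_freeResolvent (hκ : 1 ≤ κ) : IsSelfAdjoint (freeResolvent N hκ) :=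
  (isSelfAdjoint_freeSymbol hκ).map (fourierOpHom N)

theorem norm_freeResolvent_le (hκ : 1 ≤ κ) : ‖freeResolvent N hκ‖ ≤ κ⁻¹ :=
  (norm_fourierOp_le _).trans
    (BoundedContinuousFunction.norm_ofNormedAddCommGroup_le _ (by positivity) _)

/-- The Schwartz function `(κ - Δ) u`. -/
def helmholtz (κ : ℝ) (u : 𝓢(Space N, ℂ)) : 𝓢(Space N, ℂ) := (κ : ℂ) • u - Δ u

theorem helmholtz_apply (κ : ℝ) (u : 𝓢(Space N, ℂ)) (x : Space N) :
    helmholtz κ u x = κ * u x - (Δ u) x := rfl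

theorem fourier_helmholtz (κ : ℝ) (u : 𝓢(Space N, ℂ)) (ξ : Space N) :
    𝓕 (helmholtz κ u) ξ = ((4 * Real.pi ^ 2 * ‖ξ‖ ^ 2 + κ : ℝ) : ℂ) * 𝓕 u ξ := by
  rw [helmholtz, sub_eq_add_neg, FourierTransform.fourier_add, FourierTransform.fourier_smul,
    SchwartzMap.laplacian_eq_fourierMultiplierCLM, ← neg_smul, neg_neg,
    FourierTransform.fourier_smul, SchwartzMap.fourierMultiplierCLM_apply,
    FourierTransform.fourier_fourierInv_eq, add_apply, smul_apply, smul_apply,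
    SchwartzMap.smulLeftCLM_apply_apply (by fun_prop)]
  simp
  ring

theorem freeResolvent_helmholtz (hκ : 1 ≤ κ) (u : 𝓢(Space N, ℂ)) :
    freeResolvent N hκ ((helmholtz κ u).toLp 2 volume) = u.toLp 2 volume := by
  refine fourierOp_toLp _ fun ξ => ?_
  rw [freeSymbol_apply, fourier_helmholtz, ← mul_assoc, ← ofReal_mul, inv_mul_cancel₀, ofReal_one,
    one_mul]
  positivity

theorem exists_helmholtz_eq (hκ : 1 ≤ κ) (f : 𝓢(Space N, ℂ)) :
    ∃ u : 𝓢(Space N, ℂ), helmholtz κ u = f := by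
  refine ⟨freeFun (fun l => (l + κ)⁻¹) f, ?_⟩
  refine (FourierTransform.fourierEquiv ℂ 𝓢(Space N, ℂ)).injective ?_
  ext ξ
  change 𝓕 (helmholtz κ _) ξ = 𝓕 f ξ
  rw [fourier_helmholtz, fourier_freeFun (hasTemperateGrowth_resolvent hκ), ← mul_assoc,
    ← ofReal_mul, mul_inv_cancel₀, ofReal_one, one_mul]
  positivity

theorem integral_mul_helmholtz (κ : ℝ) (u φ : 𝓢(Space N, ℂ)) :
    ∫ x, u x * helmholtz κ φ x = ∫ x, helmholtz κ u x * φ x := by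
  have hi (f g : 𝓢(Space N, ℂ)) : Integrable fun x => f x * g x :=
    (f.memLp 2 volume).integrable_mul (g.memLp 2 volume)
  have h := SchwartzMap.integral_mul_laplacian_right_eq_left (μ := volume) u φ
  have h1 (x) : u x * helmholtz κ φ x = κ * (u x * φ x) - u x * (Δ φ) x := by
    rw [helmholtz_apply]; ring
  have h2 (x) : helmholtz κ u x * φ x = κ * (u x * φ x) - (Δ u) x * φ x := by
    rw [helmholtz_apply]; ring
  simp_rw [h1, h2]
  rw [integral_sub ((hi u φ).const_mul _) (hi u (Δ φ)),
    integral_sub ((hi u φ).const_mul _) (hi (Δ u) φ), h]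

/-- The bilinear pairing of an `L²` function with a Schwartz function. -/
def pairing (φ : 𝓢(Space N, ℂ)) : L2 N →L[ℂ] ℂ :=
  ((ContinuousLinearMap.mul ℂ ℂ).lpPairing volume 2 2).flip (φ.toLp 2 volume)

theorem pairing_apply (φ : 𝓢(Space N, ℂ)) (y : L2 N) : pairing φ y = ∫ x, y x * φ x := by
  rw [pairing, ContinuousLinearMap.flip_apply, ContinuousLinearMap.lpPairing_eq_integral]
  refine integral_congr_ae ?_
  filter_upwards [φ.coeFn_toLp 2 volume] with x hx
  rw [hx]
  rfl

/-- For y = (κ-Δ)u this is the symmetry of the Laplacian. Such y exhaust the Schwartz space, which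
is dense, and both sides are continuous in y. -/
theorem integral_freeResolvent_mul_helmholtz (hκ : 1 ≤ κ) (y : L2 N) (φ : 𝓢(Space N, ℂ)) :
    ∫ x, freeResolvent N hκ y x * helmholtz κ φ x = ∫ x, y x * φ x := by
  rw [← pairing_apply, ← pairing_apply]
  have h : ⇑((pairing (helmholtz κ φ)).comp (freeResolvent N hκ)) = ⇑(pairing φ) := by
    refine (SchwartzMap.denseRange_toLpCLM (E := Space N) (F := ℂ) (μ := volume) (p := 2)
      ENNReal.ofNat_ne_top).equalizer (ContinuousLinearMap.continuous _)
      (ContinuousLinearMap.continuous _) (funext fun f => ?_)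
    obtain ⟨u, rfl⟩ := exists_helmholtz_eq hκ f
    change pairing (helmholtz κ φ) (freeResolvent N hκ ((helmholtz κ u).toLp 2 volume))
      = pairing φ ((helmholtz κ u).toLp 2 volume)
    rw [freeResolvent_helmholtz, pairing_apply, pairing_apply]
    have h1 (a b : 𝓢(Space N, ℂ)) :
        ∫ x, (a.toLp 2 volume : L2 N) x * b x = ∫ x, a x * b x := by
      refine integral_congr_ae ?_
      filter_upwards [a.coeFn_toLp 2 volume] with x hx
      rw [hx]
    rw [h1, h1, integral_mul_helmholtz]
  exact congrFun h y

theorem L2.eq_of_pairing {u v : L2 N} (h : ∀ φ : 𝓢(Space N, ℂ), pairing φ u = pairing φ v) :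
    u = v := by
  rw [← sub_eq_zero]
  refine Lp.ext ?_
  have h0 : ∀ φ : 𝓢(Space N, ℂ), ∫ x, (u - v : L2 N) x * φ x = 0 := fun φ => by
    rw [← pairing_apply, map_sub, h, sub_self]
  refine Filter.EventuallyEq.trans ?_ (Lp.coeFn_zero ℂ 2 volume).symm
  refine ae_eq_zero_of_integral_contDiff_smul_eq_zero
    ((Lp.memLp (u - v)).locallyIntegrable (by norm_num)) fun g hg hc => ?_
  have hc' : HasCompactSupport fun x => (g x : ℂ) := hc.comp_left (g := ofReal) rfl
  have hg' : ContDiff ℝ ∞ fun x => (g x : ℂ) := ofRealCLM.contDiff.comp hg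
  rw [← h0 (hc'.toSchwartzMap hg')]
  refine integral_congr_ae (Filter.Eventually.of_forall fun x => ?_)
  change g x • (u - v : L2 N) x = (u - v : L2 N) x * (g x : ℂ)
  rw [real_smul, mul_comm]

end FreeResolvent

/-! ### The resolvent of the Hamiltonian -/

section Resolvent

variable {N : ℕ} {V : Space N → ℝ}

theorem abs_le_shift_sub_one (hb : ∃ K, ∀ x, |V x| ≤ K) (x : Space N) : |V x| ≤ shift V - 1 := by
  obtain ⟨K, hK⟩ := hb
  rw [shift, add_sub_cancel_left]
  exact le_ciSup (f := fun x => |V x|) ⟨K, by rintro _ ⟨x, rfl⟩; exact hK x⟩ x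

theorem one_le_shift (V : Space N → ℝ) : 1 ≤ shift V :=
  le_add_of_nonneg_right (Real.iSup_nonneg fun _ => abs_nonneg _)

theorem memLp_potential (hV : Measurable V) (hb : ∃ K, ∀ x, |V x| ≤ K) :
    MemLp (fun x => (V x : ℂ)) ∞ volume := by
  obtain ⟨K, hK⟩ := hb
  refine memLp_top_of_bound (measurable_ofReal.comp hV).aestronglyMeasurable K
    (Filter.Eventually.of_forall fun x => ?_)
  rw [norm_real]
  exact hK x

/-- The weak form of (κ-Δ)u = w - Vu, with V regarded as a bounded operator and no longer as part of
the test function. -/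
theorem hamiltonianEq_iff (hV : Measurable V) (hb : ∃ K, ∀ x, |V x| ≤ K) (κ : ℝ) (u w : L2 N) :
    HamiltonianEq V u (w - (κ : ℂ) • u) ↔
      ∀ φ : 𝓢(Space N, ℂ),
        pairing (helmholtz κ φ) u = pairing φ (w - mulOp (fun x => (V x : ℂ)) u) := by
  refine forall_congr' fun φ => ?_
  have hi (y : L2 N) (f : 𝓢(Space N, ℂ)) : Integrable fun x => y x * f x :=
    (Lp.memLp y).integrable_mul (f.memLp 2 volume)
  have h1 : ∫ x, u x * (-(Δ φ) x + ((V x : ℝ) : ℂ) * φ x)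
      = pairing (helmholtz κ φ) u - κ * pairing φ u
        + pairing φ (mulOp (fun x => (V x : ℂ)) u) := by
    have h2 : Integrable fun x => u x * helmholtz κ φ x - κ * (u x * φ x) :=
      (hi u _).sub ((hi u φ).const_mul _)
    rw [pairing_apply, pairing_apply, pairing_apply, ← integral_const_mul,
      ← integral_sub (hi u _) ((hi u φ).const_mul _), ← integral_add h2 (hi _ φ)]
    refine integral_congr_ae ?_
    filter_upwards [mulOp_ae (memLp_potential hV hb) u] with x hx
    rw [hx, helmholtz_apply]
    ring
  rw [h1, ← pairing_apply, map_sub, map_sub, map_smul, smul_eq_mul]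
  constructor <;> intro h <;> linear_combination h

/-- The equation (H+κ)u = w is equivalent to u = A(w - Vu), because κ-Δ maps the Schwartz space onto
itself and testing against (κ-Δ)φ therefore determines u. The choice of κ gives ‖V‖ ≤ κ - 1, so the
Neumann series applies. -/
theorem exists_resolventOp_eq (hV : Measurable V) (hb : ∃ K, ∀ x, |V x| ≤ K) :
    IsSelfAdjoint (resolventOp V) ∧ ‖resolventOp V‖ ≤ 1 ∧
      freeResolvent N (one_le_shift V) - resolventOp V
        = freeResolvent N (one_le_shift V) * mulOp (fun x => (V x : ℂ)) * resolventOp V := by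
  set κ := shift V with hκ
  set A := freeResolvent N (one_le_shift V) with hA
  set B : L2 N →L[ℂ] L2 N := mulOp fun x => (V x : ℂ) with hB
  have hBsa : IsSelfAdjoint B := by
    rw [IsSelfAdjoint, ContinuousLinearMap.star_eq_adjoint, hB,
      adjoint_mulOp (memLp_potential hV hb)]
    simp
  have hBn : ‖B‖ ≤ κ - 1 := by
    refine norm_mulOp_le (by linarith [one_le_shift V]) fun x => ?_
    rw [norm_real]
    exact abs_le_shift_sub_one hb x
  obtain ⟨Y, hY1, hY2, hsa, hn, heq⟩ := exists_perturbed_resolvent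
    (isSelfAdjoint_freeResolvent (one_le_shift V)) hBsa (one_le_shift V)
    (norm_freeResolvent_le (one_le_shift V)) hBn
  have hap {Z W : L2 N →L[ℂ] L2 N} (h : Z = W) (x : L2 N) : Z x = W x := by rw [h]
  have hres : IsResolvent V κ (A * Y) := by
    intro w u
    rw [hamiltonianEq_iff hV hb]
    constructor
    · rintro rfl φ
      have h1 : w - B (A (Y w)) = Y w := by
        have h := hap hY1 w
        simp only [mul_apply_eq_comp, add_apply, one_apply_eq_self] at h
        exact sub_eq_of_eq_add h.symm
      rw [mul_apply_eq_comp, h1, pairing_apply, pairing_apply]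
      exact integral_freeResolvent_mul_helmholtz _ _ _
    · intro h
      have h1 : u = A (w - B u) := by
        refine L2.eq_of_pairing fun f => ?_
        obtain ⟨φ, rfl⟩ := exists_helmholtz_eq (one_le_shift V) f
        rw [h φ, pairing_apply, pairing_apply]
        exact (integral_freeResolvent_mul_helmholtz _ _ _).symm
      have h2 : w = (1 + B * A) (w - B u) := by
        rw [add_apply, one_apply_eq_self, mul_apply_eq_comp, ← h1, sub_add_cancel]
      have h3 := hap hY2 (w - B u)
      rw [mul_apply_eq_comp, ← h2, one_apply_eq_self] at h3
      rw [mul_apply_eq_comp, h3, ← h1]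
  have hR : resolventOp V = A * Y := by
    have hex : ∃ R, IsResolvent V (shift V) R := ⟨_, hres⟩
    rw [resolventOp, dif_pos hex]
    refine ContinuousLinearMap.ext fun w => ?_
    exact (hex.choose_spec w _).2 ((hres w _).1 rfl)
  rw [hR]
  exact ⟨hsa, hn, heq⟩

end Resolvent

/-! ### Unitary groups with bounded generators -/

section Exponential

variable {X : Type*} [NormedAddCommGroup X] [InnerProductSpace ℂ X] [CompleteSpace X]
  {A B : X →L[ℂ] X}

/-- The exponential `exp (i τ A)`. -/
def expI (A : X →L[ℂ] X) (τ : ℝ) : X →L[ℂ] X := NormedSpace.exp (τ • (I • A))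

theorem expI_zero (A : X →L[ℂ] X) : expI A 0 = 1 := by
  rw [expI, zero_smul, NormedSpace.exp_zero]

theorem exists_unitary_eq_expI (hA : IsSelfAdjoint A) (τ : ℝ) :
    ∃ U : unitary (X →L[ℂ] X), (U : X →L[ℂ] X) = expI A τ := by
  have h : IsSelfAdjoint (τ • A) := by
    have h1 : τ • A = (τ : ℂ) • A := rfl
    rw [IsSelfAdjoint, h1, star_smul, hA.star_eq]
    congr 1
    exact conj_ofReal τ
  refine ⟨selfAdjoint.expUnitary ⟨τ • A, h⟩, ?_⟩
  rw [selfAdjoint.expUnitary_coe, expI, smul_comm]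

theorem norm_expI_mul (hA : IsSelfAdjoint A) (τ : ℝ) (Z : X →L[ℂ] X) :
    ‖expI A τ * Z‖ = ‖Z‖ := by
  obtain ⟨U, hU⟩ := exists_unitary_eq_expI hA τ
  rw [← hU, CStarRing.norm_coe_unitary_mul]

theorem norm_mul_expI (hA : IsSelfAdjoint A) (τ : ℝ) (Z : X →L[ℂ] X) :
    ‖Z * expI A τ‖ = ‖Z‖ := by
  obtain ⟨U, hU⟩ := exists_unitary_eq_expI hA τ
  rw [← hU, CStarRing.norm_mul_coe_unitary]

theorem hasDerivAt_expI (A : X →L[ℂ] X) (τ : ℝ) :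
    HasDerivAt (expI A) (expI A τ * (I • A)) τ :=
  hasDerivAt_exp_smul_const (𝕂 := ℝ) (I • A) τ

theorem hasDerivAt_expI' (A : X →L[ℂ] X) (τ : ℝ) :
    HasDerivAt (expI A) ((I • A) * expI A τ) τ :=
  hasDerivAt_exp_smul_const' (𝕂 := ℝ) (I • A) τ

/-- B need not be self-adjoint. In the interaction picture exp(-isA)exp(isB) the generator has norm
at most ‖B - A‖, and Grönwall applies; this is used with B a conjugate of A. -/
theorem norm_expI_le_of_nonneg (hA : IsSelfAdjoint A) (B : X →L[ℂ] X) {τ : ℝ} (hτ : 0 ≤ τ) :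
    ‖expI B τ‖ ≤ Real.exp (‖B - A‖ * τ) := by
  have hd (s : ℝ) : HasDerivAt (fun s => expI A (-s) * expI B s)
      (expI A (-s) * (I • (B - A)) * expI B s) s := by
    have h1 : HasDerivAt (fun s => expI A (-s)) (-(expI A (-s) * (I • A))) s := by
      have h := (hasDerivAt_expI A (-s)).scomp s (hasDerivAt_neg s)
      rwa [neg_one_smul] at h
    refine (h1.mul (hasDerivAt_expI' B s)).congr_deriv ?_
    rw [smul_sub]
    noncomm_ring
  have h := norm_le_gronwallBound_of_norm_deriv_right_le (δ := 1) (K := ‖B - A‖) (ε := 0)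
    (a := 0) (b := τ) (f := fun s => expI A (-s) * expI B s)
    (fun s _ => (hd s).continuousAt.continuousWithinAt)
    (fun s _ => (hd s).hasDerivWithinAt)
    (by
      rw [neg_zero, expI_zero, expI_zero, mul_one]
      exact ContinuousLinearMap.norm_id_le)
    (fun s _ => by
      rw [norm_expI_mul hA, mul_assoc, norm_expI_mul hA, add_zero]
      refine (norm_mul_le _ _).trans_eq ?_
      rw [norm_smul, norm_I, one_mul]) τ ⟨hτ, le_rfl⟩
  rwa [norm_expI_mul hA, gronwallBound_ε0, one_mul, sub_zero] at h

theorem norm_expI_le (hA : IsSelfAdjoint A) (B : X →L[ℂ] X) (τ : ℝ) :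
    ‖expI B τ‖ ≤ Real.exp (‖B - A‖ * |τ|) := by
  rcases le_total 0 τ with h | h
  · rw [abs_of_nonneg h]
    exact norm_expI_le_of_nonneg hA B h
  · have h1 := norm_expI_le_of_nonneg hA.neg (-B) (neg_nonneg.2 h)
    have h2 : expI (-B) (-τ) = expI B τ := by rw [expI, expI, smul_neg, neg_smul_neg]
    rwa [h2, ← neg_sub', norm_neg, ← abs_of_nonpos h] at h1

/-- Duhamel's formula. The unitary exp(i(τ-s)B) on the right drops out of the norm, so the
localization P only has to be moved through the group of A. -/
theorem norm_mul_expI_sub_expI_le (hB : IsSelfAdjoint B)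
    (P : X →L[ℂ] X) {τ C : ℝ} (h : ∀ σ, |σ| ≤ |τ| → ‖P * expI A σ * (A - B)‖ ≤ C) :
    ‖P * (expI A τ - expI B τ)‖ ≤ C * |τ| := by
  have hd (s : ℝ) : HasDerivAt (fun s => P * expI A s * expI B (τ - s))
      (P * expI A s * (I • (A - B)) * expI B (τ - s)) s := by
    have h1 : HasDerivAt (fun s => expI B (τ - s)) (-((I • B) * expI B (τ - s))) s := by
      have h := (hasDerivAt_expI' B (τ - s)).scomp s ((hasDerivAt_id s).const_sub τ)
      rwa [neg_one_smul] at h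
    refine (((hasDerivAt_expI A s).const_mul P).mul h1).congr_deriv ?_
    rw [smul_sub]
    noncomm_ring
  have h2 := (convex_uIcc (0 : ℝ) τ).norm_image_sub_le_of_norm_hasDerivWithin_le
    (f := fun s => P * expI A s * expI B (τ - s)) (C := C)
    (fun s _ => (hd s).hasDerivWithinAt) (fun s hs => by
      rw [norm_mul_expI hB, mul_smul_comm, norm_smul, norm_I, one_mul]
      refine h s ?_
      have := Set.abs_sub_left_of_mem_uIcc hs
      simpa using this) Set.left_mem_uIcc Set.right_mem_uIcc
  rw [sub_self, sub_zero, expI_zero, expI_zero, mul_one, mul_one, ← mul_sub,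
    Real.norm_eq_abs] at h2
  exact h2

theorem mul_expI_mul_inverse {W W' : X →L[ℂ] X} (h1 : W * W' = 1) (h2 : W' * W = 1)
    (A : X →L[ℂ] X) (τ : ℝ) : expI (W * A * W') τ = W * expI A τ * W' := by
  let _ : NormedAlgebra ℚ (X →L[ℂ] X) := NormedAlgebra.restrictScalars ℚ ℝ _
  have h := NormedSpace.exp_units_conj (⟨W, W', h1, h2⟩ : (X →L[ℂ] X)ˣ) (τ • (I • A))
  rw [expI, expI]
  refine Eq.trans ?_ h
  congr 1
  rw [mul_smul_comm, mul_smul_comm, smul_mul_assoc, smul_mul_assoc]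
  rfl

/-- W'W = 1 is inserted between the factors. When the weight W is large on the support of P and of
size one on that of Q, the first factor is small and the last stays bounded. -/
theorem norm_mul_expI_mul_le (hA : IsSelfAdjoint A) {W W' : X →L[ℂ] X} (h1 : W * W' = 1)
    (h2 : W' * W = 1) (P Q : X →L[ℂ] X) (τ : ℝ) :
    ‖P * expI A τ * A * Q‖
      ≤ ‖P * W'‖ * Real.exp (‖W * A * W' - A‖ * |τ|) * ‖W * A * W'‖ * ‖W * Q‖ := by
  have h : P * expI A τ * A * Q = P * W' * expI (W * A * W') τ * (W * A * W') * (W * Q) := by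
    rw [mul_expI_mul_inverse h1 h2]
    calc P * expI A τ * A * Q
        = P * 1 * expI A τ * 1 * A * 1 * Q := by simp
      _ = P * (W' * W) * expI A τ * (W' * W) * A * (W' * W) * Q := by rw [h2]
      _ = _ := by noncomm_ring
  rw [h]
  refine (norm_mul_le _ _).trans ?_
  gcongr
  refine (norm_mul_le _ _).trans ?_
  gcongr
  refine (norm_mul_le _ _).trans ?_
  gcongr
  exact norm_expI_le hA _ τ

end Exponential

/-! ### The free resolvent conjugated by exponential weights -/

section Weights

open LineDeriv

variable {N : ℕ} {κ : ℝ}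

theorem opNorm_le_of_schwartz {Z : L2 N →L[ℂ] L2 N} {C : ℝ} (hC : 0 ≤ C)
    (h : ∀ f : 𝓢(Space N, ℂ), ‖Z (f.toLp 2 volume)‖ ≤ C * ‖(f.toLp 2 volume : L2 N)‖) :
    ‖Z‖ ≤ C := by
  refine ContinuousLinearMap.opNorm_le_bound _ hC fun y => ?_
  refine (SchwartzMap.denseRange_toLpCLM (E := Space N) (F := ℂ) (μ := volume) (p := 2)
    ENNReal.ofNat_ne_top).induction_on y
    (isClosed_le (by fun_prop) (by fun_prop)) h

theorem norm2_le_of_fourier {φ ψ : 𝓢(Space N, ℂ)} (h : ∀ ξ, ‖𝓕 φ ξ‖ ≤ ‖𝓕 ψ ξ‖) :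
    norm2 φ ≤ norm2 ψ := by
  rw [← norm2_fourier, ← norm2_fourier ψ]
  exact norm2_le_of_norm_le h

theorem norm2_le_norm2_helmholtz (hκ : 1 ≤ κ) (u : 𝓢(Space N, ℂ)) :
    norm2 u ≤ norm2 (helmholtz κ u) := by
  refine norm2_le_of_fourier fun ξ => ?_
  rw [fourier_helmholtz, norm_mul, norm_real, Real.norm_of_nonneg (by positivity)]
  refine le_mul_of_one_le_left (norm_nonneg _) ?_
  have : 0 ≤ 4 * Real.pi ^ 2 * ‖ξ‖ ^ 2 := by positivity
  linarith

/-- The partial derivative `∂_j u` of a Schwartz function. -/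
def schwartzDeriv (j : Fin N) (u : 𝓢(Space N, ℂ)) : 𝓢(Space N, ℂ) :=
  ∂_{EuclideanSpace.single j (1 : ℝ)} u

theorem schwartzDeriv_apply (j : Fin N) (u : 𝓢(Space N, ℂ)) (x : Space N) :
    schwartzDeriv j u x = fderiv ℝ u x (EuclideanSpace.single j 1) := rfl

theorem norm2_lineDeriv_le_norm2_helmholtz (hκ : 1 ≤ κ) (u : 𝓢(Space N, ℂ)) (j : Fin N) :
    norm2 (schwartzDeriv j u) ≤ norm2 (helmholtz κ u) := by
  refine norm2_le_of_fourier fun ξ => ?_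
  have h : 𝓕 (schwartzDeriv j u) ξ = (2 * Real.pi * I * ξ j : ℂ) * 𝓕 u ξ := by
    rw [schwartzDeriv, SchwartzMap.lineDeriv_eq_fourierMultiplierCLM, FourierTransform.fourier_smul,
      SchwartzMap.fourierMultiplierCLM_apply, FourierTransform.fourier_fourierInv_eq,
      smul_apply, SchwartzMap.smulLeftCLM_apply_apply (by fun_prop)]
    simp [EuclideanSpace.inner_single_right]
    ring
  rw [h, fourier_helmholtz, norm_mul _ (𝓕 u ξ), norm_mul _ (𝓕 u ξ), norm_real,
    Real.norm_of_nonneg (by positivity)]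
  refine mul_le_mul_of_nonneg_right ?_ (norm_nonneg _)
  have h1 : ‖(2 * Real.pi * I * ξ j : ℂ)‖ = 2 * Real.pi * |ξ j| := by
    simp [abs_of_pos Real.pi_pos]
  have h2 : |ξ j| ≤ ‖ξ‖ := PiLp.norm_apply_le ξ j
  rw [h1]
  calc 2 * Real.pi * |ξ j| ≤ 2 * Real.pi * ‖ξ‖ := by gcongr
    _ ≤ (2 * Real.pi * ‖ξ‖) ^ 2 + 1 := by nlinarith [sq_nonneg (2 * Real.pi * ‖ξ‖ - 1)]
    _ ≤ _ := by nlinarith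

/-- A smooth function that is constant outside a compact set. -/
structure IsWeight (σ : Space N → ℝ) : Prop where
  smooth : ContDiff ℝ ∞ σ
  const : ∃ c, HasCompactSupport fun x => σ x - c

variable {σ : Space N → ℝ}

theorem IsWeight.neg (hσ : IsWeight σ) : IsWeight fun x => -σ x := by
  refine ⟨hσ.smooth.neg, ?_⟩
  obtain ⟨c, hc⟩ := hσ.const
  refine ⟨-c, ?_⟩
  have h : (fun x => -σ x - -c) = (fun y => -y) ∘ fun x => σ x - c := by
    funext x
    simp only [Function.comp_apply]
    ring
  rw [h]
  exact hc.comp_left neg_zero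

theorem IsWeight.hasTemperateGrowth_exp (hσ : IsWeight σ) :
    Function.HasTemperateGrowth fun x => (Real.exp (σ x) : ℂ) := by
  obtain ⟨c, hc⟩ := hσ.const
  have hs : ContDiff ℝ ∞ fun x => Real.exp (σ x) - Real.exp c :=
    (Real.contDiff_exp.comp hσ.smooth).sub contDiff_const
  have hc' : HasCompactSupport fun x => Real.exp (σ x) - Real.exp c := by
    have h := hc.comp_left (g := fun y => Real.exp (y + c) - Real.exp c) (by simp)
    convert h using 2 with x
    simp
  have h := (hc'.toSchwartzMap hs).hasTemperateGrowth.add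
    (Function.HasTemperateGrowth.const (Real.exp c))
  refine Function.Complex.hasTemperateGrowth_ofReal.comp (Eq.mp (congrArg _ (funext fun x => ?_)) h)
  change Real.exp (σ x) - Real.exp c + Real.exp c = _
  ring

theorem IsWeight.exists_bound (hσ : IsWeight σ) : ∃ M, ∀ x, |σ x| ≤ M := by
  obtain ⟨c, hc⟩ := hσ.const
  obtain ⟨M, hM⟩ := hc.exists_bound_of_continuous (by
    have := hσ.smooth.continuous
    fun_prop)
  refine ⟨M + |c|, fun x => ?_⟩
  have h1 := hM x
  rw [Real.norm_eq_abs] at h1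
  calc |σ x| = |(σ x - c) + c| := by ring_nf
    _ ≤ |σ x - c| + |c| := abs_add_le _ _
    _ ≤ M + |c| := by gcongr

theorem IsWeight.memLp_exp (hσ : IsWeight σ) : MemLp (fun x => (Real.exp (σ x) : ℂ)) ∞ volume := by
  obtain ⟨M, hM⟩ := hσ.exists_bound
  refine memLp_top_of_continuous (C := Real.exp M) ?_ fun x => ?_
  · have := hσ.smooth.continuous
    fun_prop
  · rw [norm_real, Real.norm_of_nonneg (Real.exp_pos _).le]
    exact Real.exp_le_exp.2 ((le_abs_self _).trans (hM x))

theorem IsWeight.mulOp_exp_mul (hσ : IsWeight σ) :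
    mulOp (fun x => (Real.exp (σ x) : ℂ)) * mulOp (fun x => (Real.exp (-σ x) : ℂ)) = 1 := by
  rw [mulOp_mul hσ.memLp_exp hσ.neg.memLp_exp]
  refine Eq.trans (congrArg mulOp (funext fun x => ?_)) ((mulOp_const 1).trans (one_smul ℂ _))
  rw [← ofReal_mul, ← Real.exp_add, add_neg_cancel, Real.exp_zero, ofReal_one]

theorem IsWeight.mulOp_exp_neg_mul (hσ : IsWeight σ) :
    mulOp (fun x => (Real.exp (-σ x) : ℂ)) * mulOp (fun x => (Real.exp (σ x) : ℂ)) = 1 := by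
  have h := hσ.neg.mulOp_exp_mul
  simpa only [neg_neg] using h

/-- The partial derivative `∂_j σ`. -/
def partialDeriv (j : Fin N) (σ : Space N → ℝ) (x : Space N) : ℝ :=
  fderiv ℝ σ x (EuclideanSpace.single j 1)

theorem contDiff_partialDeriv (hσ : ContDiff ℝ ∞ σ) (j : Fin N) :
    ContDiff ℝ ∞ (partialDeriv j σ) :=
  (hσ.fderiv_right (m := ∞) le_rfl).clm_apply contDiff_const

theorem fderiv_exp_neg_mul (hσ : Differentiable ℝ σ) {w : Space N → ℂ} (hw : Differentiable ℝ w)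
    (j : Fin N) (x : Space N) :
    fderiv ℝ (fun y => (Real.exp (-σ y) : ℂ) * w y) x (EuclideanSpace.single j 1)
      = (Real.exp (-σ x) : ℂ) * (fderiv ℝ w x (EuclideanSpace.single j 1)
        - partialDeriv j σ x * w x) := by
  have h1 : HasFDerivAt (fun y => Real.exp (-σ y)) (Real.exp (-σ x) • -fderiv ℝ σ x) x :=
    (hσ x).hasFDerivAt.neg.exp
  rw [fderiv_ofReal_mul h1.differentiableAt (hw x), h1.fderiv, partialDeriv]
  simp
  ring

theorem lineDeriv_lineDeriv_exp_neg_mul (hσ : ContDiff ℝ ∞ σ) {u v : 𝓢(Space N, ℂ)}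
    (hv : ∀ x, v x = (Real.exp (-σ x) : ℂ) * u x) (j : Fin N) (x : Space N) :
    schwartzDeriv j (schwartzDeriv j v) x
      = (Real.exp (-σ x) : ℂ) *
        (schwartzDeriv j (schwartzDeriv j u) x
          - ((2 * partialDeriv j σ x : ℝ) : ℂ) * (schwartzDeriv j u) x
          - ((partialDeriv j (partialDeriv j σ) x - partialDeriv j σ x ^ 2 : ℝ) : ℂ) * u x) := by
  have hσd : Differentiable ℝ σ := hσ.differentiable (by simp)
  have hsd : Differentiable ℝ (partialDeriv j σ) :=
    (contDiff_partialDeriv hσ j).differentiable (by simp)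
  have h1 : ⇑(schwartzDeriv j v) = fun y => (Real.exp (-σ y) : ℂ) *
      ((schwartzDeriv j u) y - partialDeriv j σ y * u y) := by
    funext y
    rw [schwartzDeriv_apply, funext hv, fderiv_exp_neg_mul hσd u.differentiable]
    rfl
  have h2 : Differentiable ℝ fun y => ((partialDeriv j σ y : ℝ) : ℂ) * u y :=
    (ofRealCLM.differentiable.comp hsd).mul u.differentiable
  have h3 := (schwartzDeriv j u).differentiable
  rw [schwartzDeriv_apply, h1, fderiv_exp_neg_mul hσd (h3.fun_sub h2),
    fderiv_fun_sub (h3 x) (h2 x), sub_apply, fderiv_ofReal_mul (hsd x) (u.differentiable x),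
    ← schwartzDeriv_apply, ← schwartzDeriv_apply]
  simp only [partialDeriv]
  push_cast
  ring

theorem helmholtz_exp_neg_mul (hσ : ContDiff ℝ ∞ σ) {u v : 𝓢(Space N, ℂ)}
    (hv : ∀ x, v x = (Real.exp (-σ x) : ℂ) * u x) (x : Space N) :
    helmholtz κ v x = (Real.exp (-σ x) : ℂ) * (helmholtz κ u x
      + ∑ j, (((2 * partialDeriv j σ x : ℝ) : ℂ) * (schwartzDeriv j u) x
        + ((partialDeriv j (partialDeriv j σ) x - partialDeriv j σ x ^ 2 : ℝ) : ℂ) * u x)) := by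
  have h (w : 𝓢(Space N, ℂ)) : (Δ w) x = ∑ j,
      schwartzDeriv j (schwartzDeriv j w) x := by
    rw [SchwartzMap.laplacian_eq_sum (EuclideanSpace.basisFun (Fin N) ℝ), sum_apply]
    simp only [EuclideanSpace.basisFun_apply]
    rfl
  rw [helmholtz_apply, helmholtz_apply, h, h, hv]
  simp_rw [lineDeriv_lineDeriv_exp_neg_mul hσ hv]
  rw [← Finset.mul_sum, Finset.sum_sub_distrib, Finset.sum_sub_distrib, Finset.sum_add_distrib]
  ring

/-- The operator `∑_j (c_j ∂_j + d_j)`. -/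
def firstOrder (c d : Fin N → Space N → ℂ) (u : 𝓢(Space N, ℂ)) : L2 N :=
  ∑ j, (mulOp (c j) ((schwartzDeriv j u).toLp 2 volume) + mulOp (d j) (u.toLp 2 volume))

theorem firstOrder_ae {c d : Fin N → Space N → ℂ} (hc : ∀ j, MemLp (c j) ∞ volume)
    (hd : ∀ j, MemLp (d j) ∞ volume) (u : 𝓢(Space N, ℂ)) :
    ∀ᵐ x, firstOrder c d u x = ∑ j, (c j x * schwartzDeriv j u x + d j x * u x) := by
  have hj : ∀ᵐ x, ∀ j, (mulOp (c j) ((schwartzDeriv j u).toLp 2 volume)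
      + mulOp (d j) (u.toLp 2 volume) : L2 N) x = c j x * schwartzDeriv j u x + d j x * u x := by
    refine ae_all_iff.2 fun j => ?_
    filter_upwards [Lp.coeFn_add (mulOp (c j) ((schwartzDeriv j u).toLp 2 volume))
      (mulOp (d j) (u.toLp 2 volume)), mulOp_ae (hc j) ((schwartzDeriv j u).toLp 2 volume),
      mulOp_ae (hd j) (u.toLp 2 volume), u.coeFn_toLp 2 volume,
      (schwartzDeriv j u).coeFn_toLp 2 volume] with x a1 a2 a3 a4 a5
    rw [a1, Pi.add_apply, a2, a3, a4, a5]
  filter_upwards [hj, Lp.coeFn_finsetSum Finset.univ fun j =>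
    (mulOp (c j) ((schwartzDeriv j u).toLp 2 volume)
      + mulOp (d j) (u.toLp 2 volume) : L2 N)] with x h1 h2
  rw [firstOrder, h2, Finset.sum_apply]
  exact Finset.sum_congr rfl fun j _ => h1 j

theorem norm_firstOrder_le (hκ : 1 ≤ κ) {c d : Fin N → Space N → ℂ} {p q : ℝ} (hp : 0 ≤ p)
    (hq : 0 ≤ q) (hc : ∀ j x, ‖c j x‖ ≤ p) (hd : ∀ j x, ‖d j x‖ ≤ q) (u : 𝓢(Space N, ℂ)) :
    ‖firstOrder c d u‖ ≤ N * (p + q) * ‖((helmholtz κ u).toLp 2 volume : L2 N)‖ := by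
  have hj (j : Fin N) : ‖mulOp (c j) ((schwartzDeriv j u).toLp 2 volume)
      + mulOp (d j) (u.toLp 2 volume)‖ ≤ (p + q) * ‖((helmholtz κ u).toLp 2 volume : L2 N)‖ := by
    rw [add_mul]
    refine (norm_add_le _ _).trans (add_le_add ?_ ?_)
    · exact (ContinuousLinearMap.le_opNorm _ _).trans
        (mul_le_mul (norm_mulOp_le hp (hc j)) (norm2_lineDeriv_le_norm2_helmholtz hκ u j)
          (norm_nonneg _) hp)
    · exact (ContinuousLinearMap.le_opNorm _ _).trans
        (mul_le_mul (norm_mulOp_le hq (hd j)) (norm2_le_norm2_helmholtz hκ u)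
          (norm_nonneg _) hq)
  refine (norm_sum_le _ _).trans ((Finset.sum_le_sum fun j _ => hj j).trans_eq ?_)
  rw [Finset.sum_const, Finset.card_univ, Fintype.card_fin, nsmul_eq_mul, ← mul_assoc]

/-- For f = (κ-Δ)u, conjugation gives (κ-Δ)(e^{-σ}u) = e^{-σ}(f + e), where e is of first order in u
with coefficients built from derivatives of σ. Since κ-Δ controls u and ∂_j u, the smallness
hypothesis `hN` yields ‖e‖ ≤ ½‖f‖. -/
theorem exists_conjugated_freeResolvent_eq (hκ : 1 ≤ κ) (hσ : IsWeight σ) {b : ℝ} (hb : 0 ≤ b)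
    (h1 : ∀ j x, |partialDeriv j σ x| ≤ b)
    (h2 : ∀ j x, |partialDeriv j (partialDeriv j σ) x| ≤ b)
    (hN : N * (3 * b + b ^ 2) ≤ 1 / 2) (f : 𝓢(Space N, ℂ)) :
    ∃ e : L2 N, ‖e‖ ≤ 1 / 2 * ‖(f.toLp 2 volume : L2 N)‖ ∧
      mulOp (fun x => (Real.exp (σ x) : ℂ)) (freeResolvent N hκ
        (mulOp (fun x => (Real.exp (-σ x) : ℂ)) (f.toLp 2 volume + e)))
        = freeResolvent N hκ (f.toLp 2 volume) := by
  let c : Fin N → Space N → ℂ := fun j x => ((2 * partialDeriv j σ x : ℝ) : ℂ)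
  let d : Fin N → Space N → ℂ := fun j x =>
    ((partialDeriv j (partialDeriv j σ) x - partialDeriv j σ x ^ 2 : ℝ) : ℂ)
  have hm1 (j : Fin N) (x : Space N) : ‖c j x‖ ≤ 2 * b := by
    rw [norm_real, Real.norm_eq_abs, abs_mul, abs_two]
    linarith [h1 j x]
  have hm2 (j : Fin N) (x : Space N) : ‖d j x‖ ≤ b + b ^ 2 := by
    rw [norm_real, Real.norm_eq_abs]
    refine (abs_sub _ _).trans (add_le_add (h2 j x) ?_)
    rw [abs_pow]
    gcongr
    exact h1 j x
  have hc1 (j : Fin N) := (contDiff_partialDeriv hσ.smooth j).continuous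
  have hc2 (j : Fin N) :=
    (contDiff_partialDeriv (contDiff_partialDeriv hσ.smooth j) j).continuous
  have hp1 (j : Fin N) : MemLp (c j) ∞ volume :=
    memLp_top_of_continuous (by have := hc1 j; fun_prop) (hm1 j)
  have hp2 (j : Fin N) : MemLp (d j) ∞ volume :=
    memLp_top_of_continuous (by have := hc1 j; have := hc2 j; fun_prop) (hm2 j)
  obtain ⟨u, rfl⟩ := exists_helmholtz_eq hκ f
  let v : 𝓢(Space N, ℂ) := SchwartzMap.smulLeftCLM ℂ (fun x => (Real.exp (-σ x) : ℂ)) u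
  have hv (x) : v x = (Real.exp (-σ x) : ℂ) * u x :=
    SchwartzMap.smulLeftCLM_apply_apply hσ.neg.hasTemperateGrowth_exp u x
  refine ⟨firstOrder c d u, ?_, ?_⟩
  · refine (norm_firstOrder_le hκ (by positivity) (by positivity) hm1 hm2 u).trans ?_
    gcongr
    exact (congrArg _ (by ring)).trans_le hN
  · have h3 : mulOp (fun x => (Real.exp (-σ x) : ℂ))
        ((helmholtz κ u).toLp 2 volume + firstOrder c d u) = (helmholtz κ v).toLp 2 volume := by
      refine mulOp_apply_eq hσ.neg.memLp_exp ?_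
      filter_upwards [firstOrder_ae hp1 hp2 u, (helmholtz κ v).coeFn_toLp 2 volume,
        (helmholtz κ u).coeFn_toLp 2 volume,
        Lp.coeFn_add ((helmholtz κ u).toLp 2 volume : L2 N) (firstOrder c d u)] with x a1 a2 a3 a4
      rw [a2, a4, Pi.add_apply, a3, a1, helmholtz_exp_neg_mul hσ.smooth hv]
    rw [h3, freeResolvent_helmholtz, freeResolvent_helmholtz, ← mulOp_toLp hσ.neg.memLp_exp hv,
      ← mul_apply_eq_comp, hσ.mulOp_exp_mul, one_apply_eq_self]

/-- The conjugated operator satisfies Zf = Rf - Ze with ‖e‖ ≤ ½‖f‖. Absorbing gives ‖Z‖ ≤ 1 + ½‖Z‖,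
which is meaningful because Z is bounded beforehand, the weight being bounded; then ‖Z - R‖ ≤ 2 · ½.
-/
theorem conjugated_freeResolvent_bound (hκ : 1 ≤ κ) (hσ : IsWeight σ) {b : ℝ} (hb : 0 ≤ b)
    (h1 : ∀ j x, |partialDeriv j σ x| ≤ b)
    (h2 : ∀ j x, |partialDeriv j (partialDeriv j σ) x| ≤ b)
    (hN : N * (3 * b + b ^ 2) ≤ 1 / 2) :
    ‖mulOp (fun x => (Real.exp (σ x) : ℂ)) * freeResolvent N hκ
        * mulOp (fun x => (Real.exp (-σ x) : ℂ))‖ ≤ 2 ∧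
    ‖mulOp (fun x => (Real.exp (σ x) : ℂ)) * freeResolvent N hκ
        * mulOp (fun x => (Real.exp (-σ x) : ℂ)) - freeResolvent N hκ‖ ≤ 1 := by
  set R := freeResolvent N hκ with hR
  set Z := mulOp (fun x => (Real.exp (σ x) : ℂ)) * R * mulOp (fun x => (Real.exp (-σ x) : ℂ))
    with hZ
  have hRn : ‖R‖ ≤ 1 := (norm_freeResolvent_le hκ).trans (inv_le_one_of_one_le₀ hκ)
  have key (f : 𝓢(Space N, ℂ)) : ∃ e : L2 N, ‖e‖ ≤ 1 / 2 * ‖(f.toLp 2 volume : L2 N)‖ ∧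
      Z (f.toLp 2 volume) = R (f.toLp 2 volume) - Z e := by
    obtain ⟨e, he, h3⟩ := exists_conjugated_freeResolvent_eq hκ hσ hb h1 h2 hN f
    refine ⟨e, he, eq_sub_of_add_eq ?_⟩
    rw [← map_add]
    exact h3
  have hZ2 : ‖Z‖ ≤ 2 := by
    have : ‖Z‖ ≤ 1 + ‖Z‖ * (1 / 2) := by
      refine opNorm_le_of_schwartz (by positivity) fun f => ?_
      obtain ⟨e, he, hf⟩ := key f
      rw [hf, add_mul, mul_assoc]
      exact (norm_sub_le _ _).trans (add_le_add
        ((R.le_opNorm _).trans (mul_le_mul_of_nonneg_right hRn (norm_nonneg _)))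
        ((Z.le_opNorm _).trans (mul_le_mul_of_nonneg_left he (norm_nonneg _))))
    linarith
  refine ⟨hZ2, opNorm_le_of_schwartz zero_le_one fun f => ?_⟩
  obtain ⟨e, he, hf⟩ := key f
  rw [sub_apply, hf, sub_sub_cancel_left, norm_neg]
  calc ‖Z e‖ ≤ 2 * (1 / 2 * ‖(f.toLp 2 volume : L2 N)‖) :=
        (Z.le_opNorm _).trans (mul_le_mul hZ2 he (norm_nonneg _) zero_le_two)
    _ = _ := by ring

end Weights

/-! ### Propagation bounds -/

section Propagation

variable {N : ℕ} {κ : ℝ} {σ : Space N → ℝ}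

theorem hasCompactSupport_partialDeriv (hσ : HasCompactSupport σ) (j : Fin N) :
    HasCompactSupport (partialDeriv j σ) :=
  hσ.fderiv_apply ℝ (EuclideanSpace.single j 1)

theorem partialDeriv_sub_const (σ : Space N → ℝ) (c : ℝ) (j : Fin N) :
    partialDeriv j (fun x => σ x - c) = partialDeriv j σ := by
  funext x
  rw [partialDeriv, fderiv_sub_const, partialDeriv]

theorem IsWeight.exists_partialDeriv_le (hσ : IsWeight σ) : ∃ B, 0 ≤ B ∧ ∀ j x,
    |partialDeriv j σ x| ≤ B ∧ |partialDeriv j (partialDeriv j σ) x| ≤ B := by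
  obtain ⟨c, hc⟩ := hσ.const
  have h (j : Fin N) : ∃ B, 0 ≤ B ∧ ∀ x,
      |partialDeriv j σ x| ≤ B ∧ |partialDeriv j (partialDeriv j σ) x| ≤ B := by
    have h1 := hasCompactSupport_partialDeriv hc j
    rw [partialDeriv_sub_const] at h1
    obtain ⟨B₁, hB₁⟩ := h1.exists_bound_of_continuous (contDiff_partialDeriv hσ.smooth j).continuous
    obtain ⟨B₂, hB₂⟩ := (hasCompactSupport_partialDeriv h1 j).exists_bound_of_continuous
      (contDiff_partialDeriv (contDiff_partialDeriv hσ.smooth j) j).continuous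
    exact ⟨max B₁ B₂, ((norm_nonneg _).trans (hB₁ 0)).trans (le_max_left _ _), fun x =>
      ⟨(hB₁ x).trans (le_max_left _ _), (hB₂ x).trans (le_max_right _ _)⟩⟩
  choose B hB0 hB using h
  refine ⟨∑ j, B j, Finset.sum_nonneg fun j _ => hB0 j, fun j x => ?_⟩
  have h1 := Finset.single_le_sum (fun i _ => hB0 i) (Finset.mem_univ j)
  exact ⟨(hB j x).1.trans h1, (hB j x).2.trans h1⟩

theorem partialDeriv_mul_comp_smul (hσ : Differentiable ℝ σ) (c s : ℝ) (j : Fin N) :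
    partialDeriv j (fun x => c * σ (s • x)) = fun x => c * s * partialDeriv j σ (s • x) := by
  funext x
  have h1 : HasFDerivAt (fun x : Space N => s • x) (s • ContinuousLinearMap.id ℝ (Space N)) x :=
    (hasFDerivAt_id x).const_smul s
  have h2 := ((hσ (s • x)).hasFDerivAt.comp x h1).const_mul c
  rw [partialDeriv, partialDeriv]
  refine (congrArg (fun L : Space N →L[ℝ] ℝ => L (EuclideanSpace.single j 1)) h2.fderiv).trans ?_
  simp
  ring

variable {F : ℝ → ℝ} {ε : ℝ}

theorem IsSmoothCutoff.isWeight (hF : IsSmoothCutoff F ε) (c : ℝ) {s : ℝ} (hs : 0 < s) :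
    IsWeight fun x : Space N => c * F (‖s⁻¹ • x‖) := by
  have h (x : Space N) : F (‖s⁻¹ • x‖) = scaled F 1 s x := by
    rw [scaled, Real.rpow_one, norm_smul, norm_inv, Real.norm_of_nonneg hs.le, inv_mul_eq_div]
  simp_rw [h]
  refine ⟨contDiff_const.mul (contDiff_scaled hF.smooth hF.zero 1 hs), c, ?_⟩
  have h1 : HasCompactSupport (scaled (fun l => F l - 1) 1 s : Space N → ℝ) :=
    hasCompactSupport_scaled (b := 1 + ε) (fun l hl => by rw [hF.one l hl.le, sub_self]) 1 hs
  have h2 : (fun x : Space N => c * scaled F 1 s x - c)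
      = (fun y => c * y) ∘ scaled (fun l => F l - 1) 1 s := by
    funext x
    simp only [Function.comp_apply, scaled]
    ring
  rw [h2]
  exact h1.comp_left (mul_zero c)

/-- If τ ≥ as/2, then s is at most a multiple of τ and the value 1 suffices. Otherwise the exponent
is at most -as/2 and beats every power of s. -/
theorem exists_min_exp_le {a m : ℝ} (ha : 0 < a) (hm : 0 ≤ m) : ∃ C, 0 ≤ C ∧
    ∀ s τ : ℝ, 0 < s → 0 ≤ τ →
      min 1 (Real.exp (-(a * s) + τ)) ≤ C * (1 + τ) ^ m * s ^ (-m) := by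
  obtain ⟨n, hn⟩ := exists_nat_ge m
  refine ⟨(2 / a) ^ m + n.factorial * (2 / a) ^ n * Real.exp (a / 2), by positivity,
    fun s τ hs hτ => ?_⟩
  have h1 : (1 : ℝ) ≤ (1 + τ) ^ m := Real.one_le_rpow (by linarith) hm
  have hsm : 0 < s ^ m := by positivity
  rw [Real.rpow_neg hs.le, ← div_eq_mul_inv, le_div_iff₀ hsm, add_mul]
  rcases le_total (a * s / 2) τ with h | h
  · calc min 1 (Real.exp (-(a * s) + τ)) * s ^ m ≤ 1 * s ^ m := by
          gcongr
          exact min_le_left _ _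
      _ = s ^ m := one_mul _
      _ ≤ (2 / a * (1 + τ)) ^ m := by
          refine Real.rpow_le_rpow hs.le ?_ hm
          rw [div_mul_eq_mul_div, le_div_iff₀ ha]
          linarith
      _ = (2 / a) ^ m * (1 + τ) ^ m := Real.mul_rpow (by positivity) (by positivity)
      _ ≤ _ := le_add_of_nonneg_right (by positivity)
  · have h2 := Real.pow_div_factorial_le_exp (a / 2 * (1 + s)) (by positivity) n
    have hf : (0 : ℝ) < n.factorial := by positivity
    have h3 : (1 + s) ^ n ≤ n.factorial * (2 / a) ^ n * Real.exp (a / 2) * Real.exp (a * s / 2) := by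
      rw [div_le_iff₀ hf, mul_pow] at h2
      calc (1 + s) ^ n = (2 / a) ^ n * ((a / 2) ^ n * (1 + s) ^ n) := by
            rw [← mul_assoc, ← mul_pow]
            field_simp
            simp
        _ ≤ (2 / a) ^ n * (Real.exp (a / 2 * (1 + s)) * n.factorial) := by gcongr
        _ = _ := by
            rw [show a / 2 * (1 + s) = a / 2 + a * s / 2 by ring, Real.exp_add]
            ring
    have h4 : s ^ m ≤ (1 + s) ^ n := by
      calc s ^ m ≤ (1 + s) ^ m := Real.rpow_le_rpow hs.le (by linarith) hm
        _ ≤ (1 + s) ^ (n : ℝ) := Real.rpow_le_rpow_of_exponent_le (by linarith) hn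
        _ = (1 + s) ^ n := Real.rpow_natCast _ _
    calc min 1 (Real.exp (-(a * s) + τ)) * s ^ m
        ≤ Real.exp (-(a * s / 2)) *
          (n.factorial * (2 / a) ^ n * Real.exp (a / 2) * Real.exp (a * s / 2)) := by
          refine mul_le_mul ((min_le_right _ _).trans (Real.exp_le_exp.2 ?_)) (h4.trans h3)
            hsm.le (Real.exp_pos _).le
          linarith
      _ = n.factorial * (2 / a) ^ n * Real.exp (a / 2) := by
          rw [mul_comm, mul_assoc, ← Real.exp_add, add_neg_cancel, Real.exp_zero, mul_one]
      _ ≤ n.factorial * (2 / a) ^ n * Real.exp (a / 2) * (1 + τ) ^ m :=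
          le_mul_of_one_le_right (by positivity) h1
      _ ≤ _ := le_add_of_nonneg_left (by positivity)

variable {V : Space N → ℝ} {m : ℝ}

theorem one_le_japanese (hm : 0 ≤ m) (x : Space N) : 1 ≤ (1 + ‖x‖ ^ 2) ^ (m / 2) :=
  Real.one_le_rpow (le_add_of_nonneg_right (by positivity)) (by positivity)

theorem abs_le_of_decay {K : ℝ} (hm : 0 ≤ m) (hK : ∀ x, (1 + ‖x‖ ^ 2) ^ (m / 2) * |V x| ≤ K)
    (x : Space N) : |V x| ≤ K :=
  (le_mul_of_one_le_left (abs_nonneg _) (one_le_japanese hm x)).trans (hK x)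

theorem abs_le_rpow_of_decay {K : ℝ} (hm : 0 ≤ m)
    (hK : ∀ x, (1 + ‖x‖ ^ 2) ^ (m / 2) * |V x| ≤ K) {s : ℝ} (hs : 0 < s) {x : Space N}
    (hx : s ≤ ‖x‖) : |V x| ≤ K * s ^ (-m) := by
  rw [Real.rpow_neg hs.le, ← div_eq_mul_inv, le_div_iff₀ (by positivity), mul_comm]
  refine le_trans ?_ (hK x)
  gcongr
  calc s ^ m = (s ^ (2 : ℝ)) ^ (m / 2) := by
        rw [← Real.rpow_mul hs.le]
        congr 1
        ring
    _ ≤ _ := by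
        refine Real.rpow_le_rpow (by positivity) ?_ (by positivity)
        rw [Real.rpow_two]
        nlinarith [norm_nonneg x]

theorem IsSmoothCutoff.exists_propagation_bound (hF : IsSmoothCutoff F ε) (hV : Measurable V)
    (hm : 0 ≤ m) (hVm : ∃ K, ∀ x, (1 + ‖x‖ ^ 2) ^ (m / 2) * |V x| ≤ K) (hκ : 1 ≤ κ) :
    ∃ C, 0 ≤ C ∧ ∀ T : ℝ, 0 < T → 1 ≤ T → ∀ τ : ℝ,
      ‖mulOp (fun x : Space N => ((F (‖x‖ / T) : ℝ) : ℂ)) * expI (freeResolvent N hκ) τ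
        * freeResolvent N hκ * mulOp (fun x => (V x : ℂ))‖ ≤ C * (1 + |τ|) ^ m * T ^ (-m) := by
  obtain ⟨K, hK⟩ := hVm
  have hK0 : 0 ≤ K := (abs_nonneg _).trans (abs_le_of_decay hm hK 0)
  have hε := hF.pos
  have h1 := hF.isWeight (N := N) 1 one_pos
  simp only [one_mul, inv_one, one_smul] at h1
  obtain ⟨B, hB0, hB⟩ := h1.exists_partialDeriv_le
  -- Chosen so that b = a(1+ε)B satisfies (N+1)b ≤ 1/8, which implies the smallness N(3b+b²) ≤ 1/2.
  set a : ℝ := 1 / (8 * (N + 1) * (1 + ε) * (B + 1)) with ha_def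
  have ha : 0 < a := by positivity
  obtain ⟨C₀, hC₀, hmin⟩ := exists_min_exp_le ha hm
  refine ⟨(2 * K * C₀ + K) * (1 + ε) ^ m, by positivity, fun T hT0 hT τ => ?_⟩
  set R := freeResolvent N hκ with hR
  -- The weight below is 0 for |x| ≤ s and as for |x| ≥ (1+ε)s = T, thus constant where F₁ lives.
  -- Its gradient is of size a, and its second derivatives of size a/s ≤ a(1+ε) because T ≥ 1.
  set s := T / (1 + ε) with hs_def
  have hs : 0 < s := by positivity
  have hs1 : s⁻¹ ≤ 1 + ε := by
    rw [hs_def, inv_div, div_le_iff₀ hT0]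
    exact le_mul_of_one_le_right (by positivity) hT
  set σ : Space N → ℝ := fun x => a * s * F (‖s⁻¹ • x‖) with hσ_def
  have hσ : IsWeight σ := hF.isWeight (a * s) hs
  set b : ℝ := a * (1 + ε) * B with hb_def
  have hb0 : 0 ≤ b := by positivity
  have hd : Differentiable ℝ fun x : Space N => F ‖x‖ := h1.smooth.differentiable (by simp)
  have hp (j : Fin N) : partialDeriv j σ = fun x => a * partialDeriv j (fun y => F ‖y‖) (s⁻¹ • x) := by
    rw [hσ_def, partialDeriv_mul_comp_smul hd]
    funext x
    rw [mul_assoc a, mul_inv_cancel₀ hs.ne', mul_one]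
  have hb1 (j : Fin N) (x : Space N) : |partialDeriv j σ x| ≤ b := by
    rw [hp, abs_mul, abs_of_pos ha, hb_def, mul_assoc]
    gcongr
    exact (hB j _).1.trans (le_mul_of_one_le_left hB0 (by linarith))
  have hb2 (j : Fin N) (x : Space N) : |partialDeriv j (partialDeriv j σ) x| ≤ b := by
    rw [hp, partialDeriv_mul_comp_smul
      ((contDiff_partialDeriv h1.smooth j).differentiable (by simp)), abs_mul,
      abs_of_pos (by positivity)]
    exact mul_le_mul (by gcongr) (hB j _).2 (abs_nonneg _) (by positivity)
  have hbN : (N + 1) * b ≤ 1 / 8 := by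
    have : (N + 1) * b = 1 / 8 * (B / (B + 1)) := by
      rw [hb_def, ha_def]
      field_simp
    rw [this]
    have : B / (B + 1) ≤ 1 := (div_le_one (by positivity)).2 (by linarith)
    linarith
  have hN : N * (3 * b + b ^ 2) ≤ 1 / 2 := by
    have hN0 : (0 : ℝ) ≤ N := Nat.cast_nonneg N
    have hb3 : b ≤ 1 := by nlinarith
    nlinarith [mul_nonneg hN0 hb0]
  obtain ⟨hX1, hX2⟩ := conjugated_freeResolvent_bound hκ hσ hb0 hb1 hb2 hN
  set W := mulOp (fun x => (Real.exp (σ x) : ℂ)) with hW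
  set W' := mulOp (fun x => (Real.exp (-σ x) : ℂ)) with hW'
  set P := mulOp (fun x : Space N => ((F (‖x‖ / T) : ℝ) : ℂ)) with hP
  -- The near part of V, on which the weight is trivial; the far part is already O(s^{-m}).
  let Vn : Space N → ℂ := fun x => if ‖x‖ ≤ s then (V x : ℂ) else 0
  let Vf : Space N → ℂ := fun x => if ‖x‖ ≤ s then 0 else (V x : ℂ)
  have hms : MeasurableSet {x : Space N | ‖x‖ ≤ s} := measurableSet_le measurable_norm measurable_const
  have hVc : Measurable fun x => (V x : ℂ) := measurable_ofReal.comp hV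
  have hVnb (x) : ‖Vn x‖ ≤ K := by
    simp only [Vn]
    split_ifs
    · rw [norm_real]; exact abs_le_of_decay hm hK x
    · rwa [norm_zero]
  have hVfb (x) : ‖Vf x‖ ≤ K * s ^ (-m) := by
    simp only [Vf]
    split_ifs with h
    · rw [norm_zero]; positivity
    · rw [norm_real]; exact abs_le_rpow_of_decay hm hK hs (not_le.1 h).le
  have hVn : MemLp Vn ∞ volume :=
    memLp_top_of_bound (hVc.ite hms measurable_const).aestronglyMeasurable K
      (Filter.Eventually.of_forall hVnb)
  have hVf : MemLp Vf ∞ volume :=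
    memLp_top_of_bound (measurable_const.ite hms hVc).aestronglyMeasurable _
      (Filter.Eventually.of_forall hVfb)
  have hVs : mulOp (fun x => (V x : ℂ)) = mulOp Vn + mulOp Vf := by
    rw [← mulOp_add hVn hVf]
    refine congrArg mulOp (funext fun x => ?_)
    simp only [Vn, Vf]
    split_ifs <;> simp
  have hFb (x : Space N) : ‖((F (‖x‖ / T) : ℝ) : ℂ)‖ ≤ 1 := by
    rw [norm_real, Real.norm_of_nonneg (hF.nonneg _)]
    exact hF.le_one _
  have hPn : ‖P‖ ≤ 1 := norm_mulOp_le zero_le_one hFb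
  have hPm : MemLp (fun x : Space N => ((F (‖x‖ / T) : ℝ) : ℂ)) ∞ volume :=
    memLp_top_of_continuous (by have := hF.smooth.continuous; fun_prop) hFb
  have hRn : ‖R‖ ≤ 1 := (norm_freeResolvent_le hκ).trans (inv_le_one_of_one_le₀ hκ)
  have hRsa : IsSelfAdjoint R := isSelfAdjoint_freeResolvent hκ
  have htriv (Q : L2 N →L[ℂ] L2 N) : ‖P * expI R τ * R * Q‖ ≤ ‖Q‖ := by
    have e1 : P * expI R τ * R * Q = P * (expI R τ * (R * Q)) := by noncomm_ring
    rw [e1]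
    calc ‖P * (expI R τ * (R * Q))‖ ≤ 1 * (1 * ‖Q‖) := by
          refine (norm_mul_le _ _).trans (mul_le_mul hPn ?_ (norm_nonneg _) zero_le_one)
          rw [norm_expI_mul hRsa]
          exact (norm_mul_le _ _).trans (mul_le_mul_of_nonneg_right hRn (norm_nonneg _))
      _ = ‖Q‖ := by ring
  have hfs (x : Space N) : ‖s⁻¹ • x‖ = ‖x‖ / s := by
    rw [norm_smul, norm_inv, Real.norm_of_nonneg hs.le, inv_mul_eq_div]
  have hPW : ‖P * W'‖ ≤ Real.exp (-(a * s)) := by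
    rw [hP, hW', mulOp_mul hPm hσ.neg.memLp_exp]
    refine norm_mulOp_le (Real.exp_pos _).le fun x => ?_
    rcases le_total ‖x‖ T with h | h
    · rw [hF.zero _ ((div_le_one hT0).2 h), ofReal_zero, zero_mul, norm_zero]
      exact (Real.exp_pos _).le
    · have e1 : σ x = a * s := by
        simp only [hσ_def]
        rw [hfs, hF.one, mul_one]
        rw [le_div_iff₀ hs, hs_def]
        field_simp
        exact h
      rw [norm_mul, e1, norm_real (Real.exp _), Real.norm_of_nonneg (Real.exp_pos _).le]
      exact mul_le_of_le_one_left (Real.exp_pos _).le (hFb x)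
  have hWV : ‖W * mulOp Vn‖ ≤ K := by
    rw [hW, mulOp_mul hσ.memLp_exp hVn]
    refine norm_mulOp_le hK0 fun x => ?_
    by_cases h : ‖x‖ ≤ s
    · have e1 : σ x = 0 := by
        simp only [hσ_def]
        rw [hfs, hF.zero _ ((div_le_one hs).2 h), mul_zero]
      rw [e1, Real.exp_zero, ofReal_one, one_mul]
      exact hVnb x
    · simp only [Vn, if_neg h, mul_zero, norm_zero]
      exact hK0
  have hnear : ‖P * expI R τ * R * mulOp Vn‖ ≤ 2 * K * min 1 (Real.exp (-(a * s) + |τ|)) := by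
    rw [mul_min_of_nonneg _ _ (by positivity)]
    refine le_min ?_ ?_
    · refine (htriv _).trans ((norm_mulOp_le hK0 hVnb).trans ?_)
      linarith
    · refine (norm_mul_expI_mul_le hRsa hσ.mulOp_exp_mul hσ.mulOp_exp_neg_mul P (mulOp Vn) τ).trans ?_
      calc _ ≤ Real.exp (-(a * s)) * Real.exp (1 * |τ|) * 2 * K := by
            refine mul_le_mul (mul_le_mul (mul_le_mul hPW ?_ ?_ ?_) hX1 ?_ ?_) hWV ?_ ?_ <;>
              first | positivity | skip
            exact Real.exp_le_exp.2 (by gcongr)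
        _ = _ := by
            rw [one_mul, ← Real.exp_add]
            ring
  have hτ1 : (1 : ℝ) ≤ (1 + |τ|) ^ m := Real.one_le_rpow (by linarith [abs_nonneg τ]) hm
  have hsT : s ^ (-m) = (1 + ε) ^ m * T ^ (-m) := by
    rw [hs_def, Real.div_rpow hT0.le (by positivity), Real.rpow_neg (by positivity : (0:ℝ) ≤ 1 + ε),
      div_inv_eq_mul, mul_comm]
  rw [hVs, mul_add]
  calc _ ≤ 2 * K * (C₀ * (1 + |τ|) ^ m * s ^ (-m)) + K * s ^ (-m) * (1 + |τ|) ^ m := by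
        refine (norm_add_le _ _).trans (add_le_add (hnear.trans ?_) ?_)
        · gcongr
          exact hmin s |τ| hs (abs_nonneg τ)
        · refine (htriv _).trans ((norm_mulOp_le (by positivity) hVfb).trans ?_)
          exact le_mul_of_one_le_right (by positivity) hτ1
    _ = _ := by
        rw [hsT]
        ring

end Propagation

/-! ### Fourier decay of energy cutoffs in the resolvent variable -/

section FourierDecay

theorem norm_fourier_le (f : ℝ → ℂ) (s : ℝ) : ‖𝓕 f s‖ ≤ ∫ x, ‖f x‖ :=
  VectorFourier.norm_fourierIntegral_le_integral_norm _ _ _ _ _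

theorem continuous_fourier {f : ℝ → ℂ} (hf : Integrable f) : Continuous (𝓕 f) :=
  VectorFourier.fourierIntegral_continuous Real.continuous_fourierChar
    (by exact continuous_inner) hf

theorem norm_fourier_comp_add (f : ℝ → ℂ) (a s : ℝ) : ‖𝓕 (fun x => f (x + a)) s‖ = ‖𝓕 f s‖ := by
  have h := congrFun (VectorFourier.fourierIntegral_comp_add_right Real.fourierChar volume
    (innerₗ ℝ) f a) s
  refine (congrArg norm h).trans ?_
  rw [Circle.norm_smul]
  rfl

theorem fourier_mul_sub_mul {f g : ℝ → ℂ} (hf : Integrable f) (hg : Integrable g) (a b : ℂ)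
    (s : ℝ) : 𝓕 (fun x => a * f x - b * g x) s = a * 𝓕 f s - b * 𝓕 g s := by
  have h1 := (Real.fourierIntegral_convergent_iff s).2 hf
  have h2 := (Real.fourierIntegral_convergent_iff s).2 hg
  rw [Real.fourier_eq, Real.fourier_eq, Real.fourier_eq, ← integral_const_mul,
    ← integral_const_mul, ← integral_sub (h1.const_mul a) (h2.const_mul b)]
  refine integral_congr_ae (Filter.Eventually.of_forall fun x => ?_)
  simp only [Circle.smul_def, smul_eq_mul]
  ring

theorem norm_mul_fourier_eq {f f' : ℝ → ℂ} (hf : Integrable f) (hf' : Integrable f')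
    (h : ∀ x, HasDerivAt f (f' x) x) (s : ℝ) : 2 * Real.pi * |s| * ‖𝓕 f s‖ = ‖𝓕 f' s‖ := by
  have hd : deriv f = f' := funext fun x => (h x).deriv
  have h1 := congrFun (Real.fourier_deriv hf (fun x => (h x).differentiableAt) (by rwa [hd])) s
  rw [hd] at h1
  rw [h1, norm_smul]
  simp [abs_of_pos Real.pi_pos]

/-- The function `Ψ ((1 / r - κ) / η) q (1 / r)` of `r > 0`, extended by zero. -/
def profile (κ η : ℝ) (Ψ : ℝ → ℝ) (q : Polynomial ℝ) (r : ℝ) : ℝ :=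
  if r ≤ 0 then 0 else Ψ ((r⁻¹ - κ) / η) * q.eval r⁻¹

variable {κ η δ : ℝ} {Ψ : ℝ → ℝ}

theorem profile_eq_zero (hκ : 1 ≤ κ) (hη : 0 < η) (hδ : 0 < δ)
    (h0 : ∀ x, x < 1 ∨ 1 + δ < x → Ψ x = 0) (q : Polynomial ℝ) {r : ℝ}
    (hr : r ∉ Set.Icc (κ + (1 + δ) * η)⁻¹ (κ + η)⁻¹) : profile κ η Ψ q r = 0 := by
  rw [profile]
  split_ifs with h
  · rfl
  · rw [not_le] at h
    have h1 : 0 < κ + (1 + δ) * η := by positivity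
    have h2 : 0 < κ + η := by positivity
    rw [h0, zero_mul]
    by_contra! hc
    refine hr ⟨?_, ?_⟩
    · rw [inv_le_comm₀ h1 h]
      have := (div_le_iff₀ hη).1 hc.2
      linarith
    · rw [le_inv_comm₀ h h2]
      have := (le_div_iff₀ hη).1 hc.1
      linarith

/-- Profiles are closed under differentiation, the inner derivative -r⁻² being absorbed into the
polynomial in 1/r. Only a derivative that falls on Ψ costs η⁻¹. -/
theorem hasDerivAt_profile (hκ : 1 ≤ κ) (hη : 0 < η) (hδ : 0 < δ) (hΨ : Differentiable ℝ Ψ)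
    (h0 : ∀ x, x < 1 ∨ 1 + δ < x → Ψ x = 0) (q : Polynomial ℝ) (r : ℝ) :
    HasDerivAt (profile κ η Ψ q)
      (-η⁻¹ * profile κ η (deriv Ψ) (q * Polynomial.X ^ 2) r
        - profile κ η Ψ (q.derivative * Polynomial.X ^ 2) r) r := by
  rcases le_or_gt r 0 with hr | hr
  · have h1 : profile κ η Ψ q =ᶠ[nhds r] fun _ => 0 := by
      have h2 : (0 : ℝ) < (κ + (1 + δ) * η)⁻¹ := by positivity
      filter_upwards [Iio_mem_nhds (hr.trans_lt h2)] with x hx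
      exact profile_eq_zero hκ hη hδ h0 q fun h => absurd h.1 (not_le.2 hx)
    refine ((hasDerivAt_const r (0 : ℝ)).congr_of_eventuallyEq h1).congr_deriv ?_
    simp [profile, hr]
  · have h1 : profile κ η Ψ q =ᶠ[nhds r] fun x => Ψ ((x⁻¹ - κ) / η) * q.eval x⁻¹ := by
      filter_upwards [Ioi_mem_nhds hr] with x hx
      rw [profile, if_neg (not_le.2 hx)]
    have h2 := hasDerivAt_inv hr.ne'
    have h3 : HasDerivAt (fun x => (x⁻¹ - κ) / η) (-(r ^ 2)⁻¹ / η) r :=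
      (h2.sub_const κ).div_const η
    have h4 := (hΨ ((r⁻¹ - κ) / η)).hasDerivAt.comp r h3
    have h5 := (q.hasDerivAt r⁻¹).comp r h2
    refine ((h4.mul h5).congr_of_eventuallyEq h1).congr_deriv ?_
    rw [profile, profile, if_neg (not_le.2 hr), if_neg (not_le.2 hr)]
    simp only [Function.comp_apply, Polynomial.eval_mul, Polynomial.eval_pow, Polynomial.eval_X]
    field_simp
    ring

theorem exists_abs_profile_le (hκ : 1 ≤ κ) (hδ : 0 < δ) (hΨ : Continuous Ψ)
    (h0 : ∀ x, x < 1 ∨ 1 + δ < x → Ψ x = 0) (q : Polynomial ℝ) (η₀ : ℝ) :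
    ∃ C, 0 ≤ C ∧ ∀ η, 0 < η → η ≤ η₀ → ∀ r, |profile κ η Ψ q r| ≤ C := by
  obtain ⟨A, -, hA⟩ := exists_abs_le_of_eq_zero_outside hΨ h0
  obtain ⟨B, hB⟩ := (isCompact_Icc (a := (0 : ℝ)) (b := κ + (1 + δ) * η₀)).exists_bound_of_continuousOn
    q.continuous.continuousOn
  refine ⟨|A| * |B|, by positivity, fun η hη hη0 r => ?_⟩
  by_cases hr : r ∈ Set.Icc (κ + (1 + δ) * η)⁻¹ (κ + η)⁻¹
  · have h1 : 0 < κ + (1 + δ) * η := by positivity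
    have hr0 : 0 < r := (inv_pos.2 h1).trans_le hr.1
    rw [profile, if_neg (not_le.2 hr0), abs_mul]
    refine mul_le_mul ((hA _).trans (le_abs_self A)) ((hB _ ⟨by positivity, ?_⟩).trans (le_abs_self B))
      (abs_nonneg _) (abs_nonneg _)
    have h2 : 0 < η₀ := hη.trans_le hη0
    rw [inv_le_comm₀ hr0 (by positivity)]
    refine le_trans ?_ hr.1
    gcongr
  · rw [profile_eq_zero hκ hη hδ h0 q hr, abs_zero]
    positivity

theorem continuous_profile (hκ : 1 ≤ κ) (hη : 0 < η) (hδ : 0 < δ) (hΨ : Differentiable ℝ Ψ)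
    (h0 : ∀ x, x < 1 ∨ 1 + δ < x → Ψ x = 0) (q : Polynomial ℝ) :
    Continuous (profile κ η Ψ q) :=
  continuous_iff_continuousAt.2 fun r => (hasDerivAt_profile hκ hη hδ hΨ h0 q r).continuousAt

theorem hasCompactSupport_profile (hκ : 1 ≤ κ) (hη : 0 < η) (hδ : 0 < δ)
    (h0 : ∀ x, x < 1 ∨ 1 + δ < x → Ψ x = 0) (q : Polynomial ℝ) :
    HasCompactSupport (profile κ η Ψ q) :=
  HasCompactSupport.intro isCompact_Icc fun _ hr => profile_eq_zero hκ hη hδ h0 q hr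

theorem integrable_profile (hκ : 1 ≤ κ) (hη : 0 < η) (hδ : 0 < δ) (hΨ : Differentiable ℝ Ψ)
    (h0 : ∀ x, x < 1 ∨ 1 + δ < x → Ψ x = 0) (q : Polynomial ℝ) :
    Integrable fun r => (profile κ η Ψ q r : ℂ) :=
  ((continuous_profile hκ hη hδ hΨ h0 q).integrable_of_hasCompactSupport
    (hasCompactSupport_profile hκ hη hδ h0 q)).ofReal

/-- The support in r has length at most δη, since inversion does not increase distances on [κ, ∞)
when κ ≥ 1. -/
theorem integral_norm_profile_le (hκ : 1 ≤ κ) (hη : 0 < η) (hδ : 0 < δ)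
    (h0 : ∀ x, x < 1 ∨ 1 + δ < x → Ψ x = 0) (q : Polynomial ℝ) {C : ℝ} (hC : 0 ≤ C)
    (h : ∀ r, |profile κ η Ψ q r| ≤ C) : ∫ r, ‖(profile κ η Ψ q r : ℂ)‖ ≤ C * (δ * η) := by
  have h1 : 0 < κ + (1 + δ) * η := by positivity
  have h2 : 0 < κ + η := by positivity
  have h3 : (κ + (1 + δ) * η)⁻¹ ≤ (κ + η)⁻¹ := by
    gcongr
    nlinarith
  have h4 : (κ + η)⁻¹ - (κ + (1 + δ) * η)⁻¹ ≤ δ * η := by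
    rw [inv_sub_inv h2.ne' h1.ne', div_le_iff₀ (by positivity)]
    have e1 : 1 ≤ κ + η := by linarith
    have e2 : 1 ≤ κ + (1 + δ) * η := by nlinarith [mul_pos hδ hη]
    have e3 : 1 ≤ (κ + η) * (κ + (1 + δ) * η) := one_le_mul_of_one_le_of_one_le e1 e2
    nlinarith [mul_pos hδ hη]
  rw [← setIntegral_eq_integral_of_forall_compl_eq_zero
    (s := Set.Icc (κ + (1 + δ) * η)⁻¹ (κ + η)⁻¹) fun r hr => by
      rw [profile_eq_zero hκ hη hδ h0 q hr, ofReal_zero, norm_zero]]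
  have h5 := norm_setIntegral_le_of_norm_le_const (μ := volume)
    (s := Set.Icc (κ + (1 + δ) * η)⁻¹ (κ + η)⁻¹) (f := fun r => ‖(profile κ η Ψ q r : ℂ)‖) (C := C)
    measure_Icc_lt_top fun r _ => by
      rw [norm_norm, norm_real]
      exact h r
  refine (le_abs_self _).trans (h5.trans ?_)
  rw [Real.volume_real_Icc_of_le h3]
  gcongr

/-- Induction over all Ψ and q simultaneously: each power of η|s| is traded for one derivative. The
constants are uniform for η ≤ η₀ because 1/r stays in a fixed compact interval on the support. -/
theorem exists_fourier_profile_le (hκ : 1 ≤ κ) (hδ : 0 < δ) {η₀ : ℝ} (hη₀ : 0 < η₀) (M : ℕ) :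
    ∀ Ψ : ℝ → ℝ, ContDiff ℝ ∞ Ψ → (∀ x, x < 1 ∨ 1 + δ < x → Ψ x = 0) → ∀ q : Polynomial ℝ,
      ∃ C, 0 ≤ C ∧ ∀ η, 0 < η → η ≤ η₀ → ∀ s,
        (2 * Real.pi * |s| * η) ^ M * ‖𝓕 (fun r => (profile κ η Ψ q r : ℂ)) s‖ ≤ C * η := by
  induction M with
  | zero =>
    intro Ψ hΨ h0 q
    obtain ⟨C, hC, h⟩ := exists_abs_profile_le hκ hδ hΨ.continuous h0 q η₀
    refine ⟨C * δ, by positivity, fun η hη hη0 s => ?_⟩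
    rw [pow_zero, one_mul, mul_assoc]
    exact (norm_fourier_le _ s).trans
      (integral_norm_profile_le hκ hη hδ h0 q hC (h η hη hη0))
  | succ M ih =>
    intro Ψ hΨ h0 q
    have hΨ' : ContDiff ℝ ∞ (deriv Ψ) := (contDiff_infty_iff_deriv.1 hΨ).2
    have h0' := deriv_eq_zero_outside h0
    have hd : Differentiable ℝ Ψ := hΨ.differentiable (by simp)
    have hd' : Differentiable ℝ (deriv Ψ) := hΨ'.differentiable (by simp)
    obtain ⟨C₁, hC₁, h₁⟩ := ih (deriv Ψ) hΨ' h0' (q * Polynomial.X ^ 2)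
    obtain ⟨C₂, hC₂, h₂⟩ := ih Ψ hΨ h0 (q.derivative * Polynomial.X ^ 2)
    refine ⟨C₁ + η₀ * C₂, by positivity, fun η hη hη0 s => ?_⟩
    have hi := integrable_profile hκ hη hδ hd h0 q
    have hi1 := integrable_profile hκ hη hδ hd' h0' (q * Polynomial.X ^ 2)
    have hi2 := integrable_profile hκ hη hδ hd h0 (q.derivative * Polynomial.X ^ 2)
    set f₁ : ℝ → ℂ := fun r => (profile κ η (deriv Ψ) (q * Polynomial.X ^ 2) r : ℂ) with hf₁
    set f₂ : ℝ → ℂ := fun r => (profile κ η Ψ (q.derivative * Polynomial.X ^ 2) r : ℂ) with hf₂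
    have hderiv (r : ℝ) : HasDerivAt (fun r => (profile κ η Ψ q r : ℂ))
        (((-η⁻¹ : ℝ) : ℂ) * f₁ r - 1 * f₂ r) r := by
      refine (hasDerivAt_profile hκ hη hδ hd h0 q r).ofReal_comp.congr_deriv ?_
      rw [hf₁, hf₂]
      push_cast
      ring
    have h3 : _ = ‖𝓕 (fun r => ((-η⁻¹ : ℝ) : ℂ) * f₁ r - 1 * f₂ r) s‖ :=
      norm_mul_fourier_eq hi ((hi1.const_mul _).sub (hi2.const_mul 1)) hderiv s
    have h4 : ‖𝓕 (fun r => ((-η⁻¹ : ℝ) : ℂ) * f₁ r - 1 * f₂ r) s‖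
        ≤ η⁻¹ * ‖𝓕 f₁ s‖ + ‖𝓕 f₂ s‖ := by
      rw [fourier_mul_sub_mul hi1 hi2, one_mul]
      refine (norm_sub_le _ _).trans_eq ?_
      rw [norm_mul, norm_real, norm_neg, Real.norm_of_nonneg (by positivity)]
    set y := 2 * Real.pi * |s| * η with hy
    have hy0 : 0 ≤ y := by positivity
    calc y ^ (M + 1) * ‖𝓕 (fun r => (profile κ η Ψ q r : ℂ)) s‖
        = y ^ M * η * (2 * Real.pi * |s| * ‖𝓕 (fun r => (profile κ η Ψ q r : ℂ)) s‖) := by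
          rw [pow_succ, hy]
          ring
      _ ≤ y ^ M * η * (η⁻¹ * ‖𝓕 f₁ s‖ + ‖𝓕 f₂ s‖) := by
          rw [h3]
          gcongr
      _ = y ^ M * ‖𝓕 f₁ s‖ + η * (y ^ M * ‖𝓕 f₂ s‖) := by
          field_simp
      _ ≤ C₁ * η + η₀ * (C₂ * η) := by
          refine add_le_add (h₁ η hη hη0 s) (mul_le_mul hη0 (h₂ η hη hη0 s) ?_ hη₀.le)
          positivity
      _ = _ := by ring

end FourierDecay

/-! ### Kernels of energy cutoffs -/

section Kernel

/-- The function `r ↦ Φ ((1 / r - κ) / η)`, extended by one to `r ≤ 0`. -/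
def resolventCutoff (κ η : ℝ) (Φ : ℝ → ℝ) (r : ℝ) : ℝ :=
  if r ≤ 0 then 1 else Φ ((1 / r - κ) / η)

variable {κ η δ : ℝ} {Φ : ℝ → ℝ}

theorem resolventCutoff_eq_zero (hΦ : IsSmoothCutoff Φ δ) (hκ : 1 ≤ κ) (hη : 0 < η) {r : ℝ}
    (hr : 1 ≤ r) : resolventCutoff κ η Φ r = 0 := by
  have hr0 : 0 < r := by linarith
  rw [resolventCutoff, if_neg (not_le.2 hr0)]
  refine hΦ.zero _ ?_
  rw [div_le_iff₀ hη]
  have : 1 / r ≤ 1 := (div_le_one hr0).2 hr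
  linarith

theorem hasDerivAt_resolventCutoff (hΦ : IsSmoothCutoff Φ δ) (hκ : 1 ≤ κ) (hη : 0 < η) (r : ℝ) :
    HasDerivAt (resolventCutoff κ η Φ)
      (-η⁻¹ * profile κ η (deriv Φ) (Polynomial.X ^ 2) r) r := by
  have hδ := hΦ.pos
  rcases le_or_gt r 0 with hr | hr
  · have h1 : resolventCutoff κ η Φ =ᶠ[nhds r] fun _ => 1 := by
      have h2 : (0 : ℝ) < (κ + (1 + δ) * η)⁻¹ := by positivity
      filter_upwards [Iio_mem_nhds (hr.trans_lt h2)] with x hx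
      rw [resolventCutoff]
      split_ifs with h
      · rfl
      · have hx0 : 0 < x := not_le.1 h
        refine hΦ.one _ ?_
        rw [le_div_iff₀ hη, one_div]
        have := (lt_inv_comm₀ hx0 (by positivity)).1 hx
        linarith
    refine ((hasDerivAt_const r (1 : ℝ)).congr_of_eventuallyEq h1).congr_deriv ?_
    simp [profile, hr]
  · have h1 : resolventCutoff κ η Φ =ᶠ[nhds r] fun x => Φ ((x⁻¹ - κ) / η) := by
      filter_upwards [Ioi_mem_nhds hr] with x hx
      rw [resolventCutoff, if_neg (not_le.2 hx), one_div]
    have h3 : HasDerivAt (fun x => (x⁻¹ - κ) / η) (-(r ^ 2)⁻¹ / η) r :=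
      ((hasDerivAt_inv hr.ne').sub_const κ).div_const η
    have h4 := (hΦ.smooth.differentiable (by simp) ((r⁻¹ - κ) / η)).hasDerivAt.comp r h3
    refine (h4.congr_of_eventuallyEq h1).congr_deriv ?_
    rw [profile, if_neg (not_le.2 hr)]
    simp only [Polynomial.eval_pow, Polynomial.eval_X]
    field_simp

theorem continuous_resolventCutoff (hΦ : IsSmoothCutoff Φ δ) (hκ : 1 ≤ κ) (hη : 0 < η) :
    Continuous (resolventCutoff κ η Φ) :=
  continuous_iff_continuousAt.2 fun r => (hasDerivAt_resolventCutoff hΦ hκ hη r).continuousAt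

/-- A compactly supported function that equals `resolventCutoff` on `[-1, 1]`. -/
def cutoffKernel (κ η : ℝ) (Φ : ℝ → ℝ) (r : ℝ) : ℝ :=
  resolventCutoff κ η Φ r - resolventCutoff κ η Φ (r + 2)

theorem cutoffKernel_eq (hΦ : IsSmoothCutoff Φ δ) (hκ : 1 ≤ κ) (hη : 0 < η) {r : ℝ}
    (hr : -1 ≤ r) : cutoffKernel κ η Φ r = resolventCutoff κ η Φ r := by
  rw [cutoffKernel, resolventCutoff_eq_zero hΦ hκ hη (r := r + 2) (by linarith), sub_zero]

theorem continuous_cutoffKernel (hΦ : IsSmoothCutoff Φ δ) (hκ : 1 ≤ κ) (hη : 0 < η) :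
    Continuous (cutoffKernel κ η Φ) := by
  have := continuous_resolventCutoff hΦ hκ hη
  exact this.sub (this.comp (continuous_add_const 2))

/-- To the left of -2 both translates equal one, and to the right of 1 both vanish. The subtraction
creates an integrable kernel without changing it on [-1, 1], where the spectra of the resolvents
lie. -/
theorem hasCompactSupport_cutoffKernel (hΦ : IsSmoothCutoff Φ δ) (hκ : 1 ≤ κ) (hη : 0 < η) :
    HasCompactSupport (cutoffKernel κ η Φ) := by
  refine HasCompactSupport.intro (isCompact_Icc (a := (-2 : ℝ)) (b := 1)) fun r hr => ?_
  rcases lt_or_ge r (-2) with h | h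
  · rw [cutoffKernel, resolventCutoff, resolventCutoff, if_pos (by linarith), if_pos (by linarith),
      sub_self]
  · have h1 : 1 ≤ r := by
      by_contra hc
      exact hr ⟨h, (not_le.1 hc).le⟩
    rw [cutoffKernel_eq hΦ hκ hη (by linarith), resolventCutoff_eq_zero hΦ hκ hη h1]

theorem integrable_cutoffKernel (hΦ : IsSmoothCutoff Φ δ) (hκ : 1 ≤ κ) (hη : 0 < η) :
    Integrable fun r => (cutoffKernel κ η Φ r : ℂ) :=
  ((continuous_cutoffKernel hΦ hκ hη).integrable_of_hasCompactSupport
    (hasCompactSupport_cutoffKernel hΦ hκ hη)).ofReal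

theorem norm_mul_fourier_cutoffKernel_le (hΦ : IsSmoothCutoff Φ δ) (hκ : 1 ≤ κ) (hη : 0 < η)
    (s : ℝ) : 2 * Real.pi * |s| * ‖𝓕 (fun r => (cutoffKernel κ η Φ r : ℂ)) s‖
      ≤ 2 * η⁻¹ * ‖𝓕 (fun r => (profile κ η (deriv Φ) (Polynomial.X ^ 2) r : ℂ)) s‖ := by
  set f : ℝ → ℂ := fun r => (profile κ η (deriv Φ) (Polynomial.X ^ 2) r : ℂ) with hf
  have hd' : Differentiable ℝ (deriv Φ) := hΦ.contDiff_deriv.differentiable (by simp)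
  have hi : Integrable f :=
    integrable_profile hκ hη hΦ.pos hd' hΦ.deriv_eq_zero_outside _
  have hi2 : Integrable fun r => f (r + 2) := hi.comp_add_right 2
  have hderiv (r : ℝ) : HasDerivAt (fun r => (cutoffKernel κ η Φ r : ℂ))
      (((-η⁻¹ : ℝ) : ℂ) * f r - ((-η⁻¹ : ℝ) : ℂ) * f (r + 2)) r := by
    have h1 := hasDerivAt_resolventCutoff hΦ hκ hη r
    have h2 := (hasDerivAt_resolventCutoff hΦ hκ hη (r + 2)).comp_add_const r 2
    refine (h1.sub h2).ofReal_comp.congr_deriv ?_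
    rw [hf]
    push_cast
    ring
  have h3 : _ = ‖𝓕 (fun r => ((-η⁻¹ : ℝ) : ℂ) * f r - ((-η⁻¹ : ℝ) : ℂ) * f (r + 2)) s‖ :=
    norm_mul_fourier_eq (integrable_cutoffKernel hΦ hκ hη)
      ((hi.const_mul _).sub (hi2.const_mul _)) hderiv s
  rw [h3, fourier_mul_sub_mul hi hi2]
  refine (norm_sub_le _ _).trans_eq ?_
  rw [norm_mul, norm_mul, norm_fourier_comp_add, norm_real, norm_neg,
    Real.norm_of_nonneg (by positivity)]
  ring

theorem exists_fourier_cutoffKernel_le (hΦ : IsSmoothCutoff Φ δ) (hκ : 1 ≤ κ) {m η₀ : ℝ}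
    (hm : 0 ≤ m) (hη₀ : 0 < η₀) : ∃ C, 0 ≤ C ∧ ∀ η, 0 < η → η ≤ η₀ → ∀ s,
      2 * Real.pi * |s| * ‖𝓕 (fun r => (cutoffKernel κ η Φ r : ℂ)) s‖ * (1 + 2 * Real.pi * |s|) ^ m
        ≤ C * η ^ (-m) * (1 + (η * s) ^ 2)⁻¹ := by
  obtain ⟨n, hn⟩ := exists_nat_ge m
  obtain ⟨C₁, hC₁, h₁⟩ := exists_fourier_profile_le hκ hΦ.pos hη₀ 0 _ hΦ.contDiff_deriv
    hΦ.deriv_eq_zero_outside (Polynomial.X ^ 2)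
  -- With n ≥ m, n powers of 1 + η|s| pay for the weight (1+|s|)^m and two more give integrability
  -- in s.
  obtain ⟨C₂, hC₂, h₂⟩ := exists_fourier_profile_le hκ hΦ.pos hη₀ (n + 2) _ hΦ.contDiff_deriv
    hΦ.deriv_eq_zero_outside (Polynomial.X ^ 2)
  refine ⟨2 * (C₁ + C₂) * ((1 + η₀) ^ m * 2 ^ (n + 1)), by positivity, fun η hη hη0 s => ?_⟩
  set p := ‖𝓕 (fun r => (profile κ η (deriv Φ) (Polynomial.X ^ 2) r : ℂ)) s‖ with hp
  set y := 2 * Real.pi * |s| * η with hy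
  have hy0 : 0 ≤ y := by positivity
  have e1 : p ≤ C₁ * η := by simpa using h₁ η hη hη0 s
  have e2 : y ^ (n + 2) * p ≤ C₂ * η := h₂ η hη hη0 s
  have e3 : (1 + 2 * Real.pi * |s|) ^ m ≤ (1 + η₀) ^ m * η ^ (-m) * (1 + y) ^ n := by
    have e4 : 1 + 2 * Real.pi * |s| ≤ (1 + η₀) * η⁻¹ * (1 + y) := by
      rw [show (1 + η₀) * η⁻¹ * (1 + y) = (1 + η₀) * (1 + y) / η by ring, le_div_iff₀ hη, add_mul,
        one_mul, ← hy]
      nlinarith [mul_nonneg hη₀.le hy0]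
    calc (1 + 2 * Real.pi * |s|) ^ m ≤ ((1 + η₀) * η⁻¹ * (1 + y)) ^ m :=
          Real.rpow_le_rpow (by positivity) e4 hm
      _ = (1 + η₀) ^ m * η ^ (-m) * (1 + y) ^ m := by
          rw [Real.mul_rpow (by positivity) (by positivity),
            Real.mul_rpow (by positivity) (by positivity), Real.inv_rpow hη.le, Real.rpow_neg hη.le]
      _ ≤ (1 + η₀) ^ m * η ^ (-m) * (1 + y) ^ (n : ℝ) := by
          gcongr
          linarith
      _ = _ := by rw [Real.rpow_natCast]
  have e5 : 1 + (η * s) ^ 2 ≤ (1 + y) ^ 2 := by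
    have e6 : |η * s| ≤ y := by
      rw [abs_mul, abs_of_pos hη, hy]
      nlinarith [Real.pi_gt_three, mul_nonneg hη.le (abs_nonneg s)]
    have e7 : (η * s) ^ 2 ≤ y ^ 2 := by
      rw [← sq_abs]
      gcongr
    nlinarith
  have e8 : (1 + y) ^ (n + 2) ≤ 2 ^ (n + 1) * (1 + y ^ (n + 2)) := by
    have := add_pow_le zero_le_one hy0 (n + 2)
    rwa [one_pow] at this
  have hpos : 0 < 1 + (η * s) ^ 2 := by positivity
  rw [← div_eq_mul_inv, le_div_iff₀ hpos]
  calc _ ≤ 2 * η⁻¹ * p * ((1 + η₀) ^ m * η ^ (-m) * (1 + y) ^ n) * (1 + y) ^ 2 := by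
        have e9 := norm_mul_fourier_cutoffKernel_le hΦ hκ hη s
        exact mul_le_mul (mul_le_mul e9 e3 (by positivity) (by positivity)) e5 hpos.le
          (by positivity)
    _ = 2 * η⁻¹ * ((1 + η₀) ^ m * η ^ (-m)) * (p * (1 + y) ^ (n + 2)) := by ring
    _ ≤ 2 * η⁻¹ * ((1 + η₀) ^ m * η ^ (-m)) * (2 ^ (n + 1) * ((C₁ + C₂) * η)) := by
        refine mul_le_mul_of_nonneg_left ?_ (by positivity)
        calc p * (1 + y) ^ (n + 2) ≤ p * (2 ^ (n + 1) * (1 + y ^ (n + 2))) := by gcongr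
          _ = 2 ^ (n + 1) * (p + y ^ (n + 2) * p) := by ring
          _ ≤ 2 ^ (n + 1) * ((C₁ + C₂) * η) := by
              refine mul_le_mul_of_nonneg_left ?_ (by positivity)
              linarith
    _ = _ := by field_simp

theorem integrable_inv_one_add_mul_sq (hη : 0 < η) :
    Integrable fun s : ℝ => (1 + (η * s) ^ 2)⁻¹ :=
  integrable_inv_one_add_sq.comp_mul_left' hη.ne'

theorem integral_inv_one_add_mul_sq (hη : 0 < η) :
    ∫ s : ℝ, (1 + (η * s) ^ 2)⁻¹ = η⁻¹ * Real.pi := by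
  rw [Measure.integral_comp_mul_left (fun s : ℝ => (1 + s ^ 2)⁻¹), integral_univ_inv_one_add_sq,
    abs_of_pos (inv_pos.2 hη), smul_eq_mul]

/-- The decay bound carries a factor |s| and says nothing near s = 0; there the L¹ norm of the
kernel bounds its transform. -/
theorem integrable_fourier_cutoffKernel (hΦ : IsSmoothCutoff Φ δ) (hκ : 1 ≤ κ) (hη : 0 < η) :
    Integrable (𝓕 fun r => (cutoffKernel κ η Φ r : ℂ)) := by
  obtain ⟨C, hC, h⟩ := exists_fourier_cutoffKernel_le hΦ hκ le_rfl hη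
  have hi := integrable_cutoffKernel hΦ hκ hη
  set A := ∫ r, ‖(cutoffKernel κ η Φ r : ℂ)‖
  have hA : 0 ≤ A := integral_nonneg fun _ => norm_nonneg _
  refine ((integrable_inv_one_add_mul_sq hη).const_mul (C + A * (1 + η ^ 2))).mono'
    (continuous_fourier hi).aestronglyMeasurable (Filter.Eventually.of_forall fun s => ?_)
  have hpos : 0 < 1 + (η * s) ^ 2 := by positivity
  rcases le_total |s| 1 with hs | hs
  · refine (norm_fourier_le _ s).trans ?_
    rw [← div_eq_mul_inv, le_div_iff₀ hpos]
    have : (η * s) ^ 2 ≤ η ^ 2 := by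
      rw [mul_pow, ← sq_abs s]
      exact mul_le_of_le_one_right (by positivity) (pow_le_one₀ (abs_nonneg s) hs)
    calc A * (1 + (η * s) ^ 2) ≤ A * (1 + η ^ 2) := by gcongr
      _ ≤ _ := le_add_of_nonneg_left hC
  · have h1 := h η hη le_rfl s
    rw [Real.rpow_zero, mul_one, neg_zero, Real.rpow_zero, mul_one] at h1
    calc ‖𝓕 (fun r => (cutoffKernel κ η Φ r : ℂ)) s‖
        ≤ 2 * Real.pi * |s| * ‖𝓕 (fun r => (cutoffKernel κ η Φ r : ℂ)) s‖ := by
          refine le_mul_of_one_le_left (norm_nonneg _) ?_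
          nlinarith [Real.pi_gt_three]
      _ ≤ C * (1 + (η * s) ^ 2)⁻¹ := h1
      _ ≤ _ := by
          gcongr
          exact le_add_of_nonneg_right (by positivity)

end Kernel

/-! ### Fourier representation of the functional calculus -/

section FourierCalculus

variable {X : Type*} [NormedAddCommGroup X] [InnerProductSpace ℂ X] [CompleteSpace X]
  {A B : X →L[ℂ] X} {g k : ℝ → ℝ}

theorem norm_le_one_of_mem_spectrum {𝕜 : Type*} [NormedField 𝕜] [NormedAlgebra 𝕜 (X →L[ℂ] X)]
    (hA1 : ‖A‖ ≤ 1) {z : 𝕜} (hz : z ∈ spectrum 𝕜 A) : ‖z‖ ≤ 1 :=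
  (spectrum.norm_le_norm_mul_of_mem hz).trans
    (mul_le_one₀ hA1 (norm_nonneg _) ContinuousLinearMap.norm_id_le)

theorem cfc_exp_mul (hA : IsSelfAdjoint A) (c : ℂ) :
    cfc (p := IsStarNormal) (fun z : ℂ => NormedSpace.exp (c * z)) A = NormedSpace.exp (c • A) := by
  have hn : IsStarNormal A := hA.isStarNormal
  have hcont : Continuous (NormedSpace.exp : ℂ → ℂ) := NormedSpace.exp_continuous
  rw [cfc_comp_const_mul c NormedSpace.exp A hcont.continuousOn, CFC.exp_eq_normedSpace_exp]

/-- Fourier inversion of k at each spectral point, followed by interchanging the functional calculus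
with the integral. Agreement of g and k on [-1, 1] suffices because ‖A‖ ≤ 1. -/
theorem boundedFun_eq_integral (hA : IsSelfAdjoint A) (hA1 : ‖A‖ ≤ 1) (hk : Continuous k)
    (hki : Integrable fun r => (k r : ℂ)) (hkf : Integrable (𝓕 fun r => (k r : ℂ)))
    (hgk : ∀ r, |r| ≤ 1 → g r = k r) :
    boundedFun g A = ∫ s : ℝ, (𝓕 fun r => (k r : ℂ)) s • expI A (2 * Real.pi * s) := by
  set K := 𝓕 fun r => (k r : ℂ) with hK
  have hn : IsStarNormal A := hA.isStarNormal
  have h1 : boundedFun g A = cfc (p := IsSelfAdjoint) k A := by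
    rw [boundedFun]
    exact cfc_congr fun r hr => hgk r (norm_le_one_of_mem_spectrum hA1 hr)
  have hreal (z : ℂ) (hz : z ∈ spectrum ℂ A) : z = (z.re : ℂ) := hA.mem_spectrum_eq_re hz
  have h2 (z : ℂ) (hz : z ∈ spectrum ℂ A) :
      (k z.re : ℂ) = ∫ s : ℝ, K s * NormedSpace.exp ((2 * Real.pi * s * I : ℂ) * z) := by
    have hc : Continuous fun r => (k r : ℂ) := continuous_ofReal.comp hk
    have h := congrFun (hc.fourierInv_fourier_eq hki hkf) z.re
    rw [← h, Real.fourierInv_eq']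
    refine integral_congr_ae (Filter.Eventually.of_forall fun s => ?_)
    simp only [smul_eq_mul]
    rw [mul_comm, ← Complex.exp_eq_exp_ℂ]
    congr 2
    nth_rewrite 2 [hreal z hz]
    simp
    ring
  have h3 := cfc_integral (p := IsStarNormal) (μ := volume)
    (fun (s : ℝ) (z : ℂ) => K s * NormedSpace.exp ((2 * Real.pi * s * I : ℂ) * z))
    (fun s => ‖K s‖) A (by
      have hKc : Continuous K := continuous_fourier hki
      have he : Continuous (NormedSpace.exp : ℂ → ℂ) := NormedSpace.exp_continuous
      refine Continuous.continuousOn ?_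
      simp only [Function.uncurry_def]
      fun_prop)
    (Filter.Eventually.of_forall fun s z hz => by
      rw [norm_mul, hreal z hz, ← Complex.exp_eq_exp_ℂ, Complex.norm_exp]
      simp)
    hkf.norm.2
  rw [h1, cfc_real_eq_complex k, cfc_congr h2, h3]
  refine integral_congr_ae (Filter.Eventually.of_forall fun s => ?_)
  have he : Continuous fun z : ℂ => NormedSpace.exp ((2 * Real.pi * s * I : ℂ) * z) :=
    NormedSpace.exp_continuous.comp (continuous_const_mul _)
  simp only
  rw [cfc_const_mul _ _ _ he.continuousOn, cfc_exp_mul hA, expI, ← smul_assoc]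
  congr 2
  simp

theorem integrable_smul_expI (hA : IsSelfAdjoint A) {K : ℝ → ℂ} (hK : Integrable K) :
    Integrable fun s : ℝ => K s • expI A (2 * Real.pi * s) := by
  have hc : Continuous (expI A) :=
    continuous_iff_continuousAt.2 fun τ => (hasDerivAt_expI A τ).continuousAt
  refine hK.norm.mono' (hK.1.smul
    (hc.comp (continuous_const_mul (2 * Real.pi))).aestronglyMeasurable)
    (Filter.Eventually.of_forall fun s => ?_)
  rw [norm_smul]
  refine mul_le_of_le_one_right (norm_nonneg _) ?_
  have h := norm_expI_mul hA (2 * Real.pi * s) 1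
  rw [mul_one] at h
  rw [h]
  exact ContinuousLinearMap.norm_id_le

theorem norm_mul_boundedFun_sub_le (hA : IsSelfAdjoint A) (hA1 : ‖A‖ ≤ 1) (hB : IsSelfAdjoint B)
    (hB1 : ‖B‖ ≤ 1) (hk : Continuous k) (hki : Integrable fun r => (k r : ℂ))
    (hkf : Integrable (𝓕 fun r => (k r : ℂ))) (hgk : ∀ r, |r| ≤ 1 → g r = k r)
    (P : X →L[ℂ] X) {E : ℝ → ℝ} (hE : Integrable E)
    (h : ∀ s, ‖(𝓕 fun r => (k r : ℂ)) s‖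
      * ‖P * (expI A (2 * Real.pi * s) - expI B (2 * Real.pi * s))‖ ≤ E s) :
    ‖P * (boundedFun g A - boundedFun g B)‖ ≤ ∫ s, E s := by
  have hiA := integrable_smul_expI hA hkf
  have hiB := integrable_smul_expI hB hkf
  rw [boundedFun_eq_integral hA hA1 hk hki hkf hgk, boundedFun_eq_integral hB hB1 hk hki hkf hgk,
    ← integral_sub hiA hiB, ← integral_const_mul_of_integrable (by exact hiA.sub hiB)]
  refine norm_integral_le_of_norm_le hE (Filter.Eventually.of_forall fun s => ?_)
  rw [← smul_sub, mul_smul_comm, norm_smul]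
  exact h s

end FourierCalculus

/-! ### Comparison of energy cutoffs -/

section Comparison

open scoped BoundedContinuousFunction

variable {N : ℕ} {κ η δ ε : ℝ} {Φ F : ℝ → ℝ} {V : Space N → ℝ}

/-- Evaluation at a point, as a star homomorphism on bounded continuous functions. -/
def evalHom (ξ : Space N) : (Space N →ᵇ ℂ) →⋆ₐ[ℂ] ℂ where
  toFun b := b ξ
  map_one' := rfl
  map_mul' _ _ := rfl
  map_zero' := rfl
  map_add' _ _ := rfl
  commutes' a := by simp [Algebra.algebraMap_eq_smul_one]
  map_star' _ := rfl

/-- Links the calculus of the free resolvent to Fourier multipliers: evaluating the symbol at ξ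
turns 1/r - κ back into 4π²|ξ|². -/
theorem boundedFun_freeResolvent_toLp (hΦ : IsSmoothCutoff Φ δ) (hκ : 1 ≤ κ) (hη : 0 < η)
    (ψ : 𝓢(Space N, ℂ)) :
    boundedFun (resolventCutoff κ η Φ) (freeResolvent N hκ) (ψ.toLp 2 volume)
      = (freeFun (fun l => Φ (l / η)) ψ).toLp 2 volume := by
  obtain ⟨b, hb, hχ⟩ := boundedFun_map (fourierOpHom N) (isSelfAdjoint_freeSymbol hκ)
    (continuous_resolventCutoff hΦ hκ hη)
  have h1 : boundedFun (resolventCutoff κ η Φ) (freeResolvent N hκ) = fourierOpHom N b := hb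
  rw [h1]
  refine fourierOp_toLp b fun ξ => ?_
  rw [fourier_freeFun (hasTemperateGrowth_cutoff hΦ hη)]
  congr 1
  have h2 : b ξ = resolventCutoff κ η Φ (freeSymbol N hκ ξ).re := hχ (evalHom ξ)
  have h3 : 0 < (4 * Real.pi ^ 2 * ‖ξ‖ ^ 2 + κ)⁻¹ := by positivity
  rw [h2, freeSymbol_apply, ofReal_re, resolventCutoff, if_neg (not_le.2 h3), one_div, inv_inv,
    add_sub_cancel_right]

theorem norm2_le_norm2_japD {m : ℝ} (hm : 0 ≤ m) (ψ : 𝓢(Space N, ℂ)) :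
    norm2 ψ ≤ norm2 (japD m ψ) := by
  refine norm2_le_of_fourier fun ξ => ?_
  rw [japD, fourier_freeFun (hasTemperateGrowth_one_add_rpow _), norm_mul, norm_real]
  refine le_mul_of_one_le_left (norm_nonneg _) ?_
  have h : 1 ≤ (1 + 4 * Real.pi ^ 2 * ‖ξ‖ ^ 2) ^ (m / 2) :=
    Real.one_le_rpow (le_add_of_nonneg_right (by positivity)) (by positivity)
  exact h.trans (le_abs_self _)

/-- Duhamel with A - R = AVR and ‖R‖ ≤ 1 leaves the free propagation bound times |τ|. Integrated
against the kernel it gives η^{-m}, and the integral π/η of (1+(ηs)²)⁻¹ supplies the remaining power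
of η. -/
theorem IsSmoothCutoff.exists_norm_mul_boundedFun_sub_le (hF : IsSmoothCutoff F ε)
    (hΦ : IsSmoothCutoff Φ δ) (hV : Measurable V) {m : ℝ} (hm : 0 ≤ m)
    (hVm : ∃ K, ∀ x, (1 + ‖x‖ ^ 2) ^ (m / 2) * |V x| ≤ K) {η₀ : ℝ} (hη₀ : 0 < η₀) :
    ∃ C, 0 ≤ C ∧ ∀ η, 0 < η → η ≤ η₀ → ∀ T : ℝ, 1 ≤ T →
      ‖mulOp (fun x : Space N => ((F (‖x‖ / T) : ℝ) : ℂ)) *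
        (boundedFun (resolventCutoff (shift V) η Φ) (freeResolvent N (one_le_shift V))
          - boundedFun (resolventCutoff (shift V) η Φ) (resolventOp V))‖
        ≤ C * η ^ (-m - 1) * T ^ (-m) := by
  have hb : ∃ K, ∀ x, |V x| ≤ K := hVm.imp fun K hK => abs_le_of_decay hm hK
  obtain ⟨hRsa, hR1, hRR⟩ := exists_resolventOp_eq hV hb
  have hκ := one_le_shift V
  set A := freeResolvent N (one_le_shift V) with hA
  set R := resolventOp V with hR
  have hAsa : IsSelfAdjoint A := isSelfAdjoint_freeResolvent hκ
  have hA1 : ‖A‖ ≤ 1 := (norm_freeResolvent_le hκ).trans (inv_le_one_of_one_le₀ hκ)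
  obtain ⟨C₁, hC₁, h₁⟩ := hF.exists_propagation_bound hV hm hVm hκ
  obtain ⟨C₂, hC₂, h₂⟩ := exists_fourier_cutoffKernel_le hΦ hκ hm hη₀
  refine ⟨C₁ * C₂ * Real.pi, by positivity, fun η hη hη0 T hT => ?_⟩
  have hT0 : 0 < T := by linarith
  set P := mulOp (fun x : Space N => ((F (‖x‖ / T) : ℝ) : ℂ)) with hP
  have hexp (τ : ℝ) : ‖P * (expI A τ - expI R τ)‖ ≤ C₁ * (1 + |τ|) ^ m * T ^ (-m) * |τ| := by
    refine norm_mul_expI_sub_expI_le hRsa P fun σ hσ => ?_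
    rw [hRR, ← mul_assoc, ← mul_assoc]
    refine (norm_mul_le _ _).trans ((mul_le_of_le_one_right (norm_nonneg _) hR1).trans ?_)
    refine (h₁ T hT0 hT σ).trans ?_
    gcongr
  have hbound := norm_mul_boundedFun_sub_le hAsa hA1 hRsa hR1
    (continuous_cutoffKernel hΦ hκ hη) (integrable_cutoffKernel hΦ hκ hη)
    (integrable_fourier_cutoffKernel hΦ hκ hη)
    (fun r hr => (cutoffKernel_eq hΦ hκ hη (abs_le.1 hr).1).symm) P
    ((integrable_inv_one_add_mul_sq hη).const_mul (C₁ * T ^ (-m) * (C₂ * η ^ (-m))))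
    (fun s => by
      have h3 := hexp (2 * Real.pi * s)
      have h4 : |2 * Real.pi * s| = 2 * Real.pi * |s| := by
        rw [abs_mul, abs_of_pos (by positivity)]
      rw [h4] at h3
      refine (mul_le_mul_of_nonneg_left h3 (norm_nonneg _)).trans ?_
      calc _ = C₁ * T ^ (-m) * (2 * Real.pi * |s|
              * ‖(𝓕 fun r => (cutoffKernel (shift V) η Φ r : ℂ)) s‖
              * (1 + 2 * Real.pi * |s|) ^ m) := by ring
        _ ≤ C₁ * T ^ (-m) * (C₂ * η ^ (-m) * (1 + (η * s) ^ 2)⁻¹) := by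
            refine mul_le_mul_of_nonneg_left (h₂ η hη hη0 s) (by positivity)
        _ = _ := by ring)
  refine hbound.trans_eq ?_
  rw [integral_const_mul, integral_inv_one_add_mul_sq hη, Real.rpow_sub hη, Real.rpow_one]
  ring

theorem localizationError_le_of_norm_le {V : Space N → ℝ} (hF : IsSmoothCutoff F ε)
    (hΦ : IsSmoothCutoff Φ δ) (hη : 0 < η) {α t C : ℝ}
    (h : ‖mulOp (fun x : Space N => ((F (‖x‖ / t ^ α) : ℝ) : ℂ)) *
        (boundedFun (resolventCutoff (shift V) η Φ) (freeResolvent N (one_le_shift V))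
          - boundedFun (resolventCutoff (shift V) η Φ) (resolventOp V))‖ ≤ C)
    (ψ : 𝓢(Space N, ℂ)) :
    localizationError V F Φ α t η ψ ≤ ENNReal.ofReal (C * norm2 ψ) := by
  set P := mulOp (fun x : Space N => ((F (‖x‖ / t ^ α) : ℝ) : ℂ)) with hP
  set φ := freeFun (fun l => Φ (l / η)) ψ with hφ
  set G := boundedFun (resolventCutoff (shift V) η Φ) (resolventOp V) with hG
  have hG' : hamiltonianFun V (fun l => Φ (l / η)) = G := rfl
  have hFb (x : Space N) : ‖((F (‖x‖ / t ^ α) : ℝ) : ℂ)‖ ≤ 1 := by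
    rw [norm_real, Real.norm_of_nonneg (hF.nonneg _)]
    exact hF.le_one _
  have hPm : MemLp (fun x : Space N => ((F (‖x‖ / t ^ α) : ℝ) : ℂ)) ∞ volume :=
    memLp_top_of_continuous (by have := hF.smooth.continuous; fun_prop) hFb
  have h1 : localizationError V F Φ α t η ψ
      = eLpNorm (P (φ.toLp 2 volume - G (ψ.toLp 2 volume))) 2 volume := by
    rw [localizationError, hG', ← hφ]
    rw [← eLpNorm_neg]
    refine eLpNorm_congr_ae ?_
    filter_upwards [mulOp_ae hPm (φ.toLp 2 volume - G (ψ.toLp 2 volume)),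
      Lp.coeFn_sub (φ.toLp 2 volume : L2 N) (G (ψ.toLp 2 volume)),
      φ.coeFn_toLp 2 volume] with x a1 a2 a3
    rw [a1, a2, Pi.neg_apply, Pi.sub_apply, a3, scaled]
    ring
  rw [h1, ← Lp.enorm_def, ← ofReal_norm]
  refine ENNReal.ofReal_le_ofReal ?_
  rw [hφ, ← boundedFun_freeResolvent_toLp hΦ (one_le_shift V) hη, ← sub_apply,
    ← mul_apply_eq_comp]
  exact (ContinuousLinearMap.le_opNorm _ _).trans
    (mul_le_mul_of_nonneg_right h (norm_nonneg _))

theorem IsSmoothCutoff.exists_localizationError_le (hF : IsSmoothCutoff F ε)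
    (hΦ : IsSmoothCutoff Φ δ) (hV : Measurable V) {m : ℝ} (hm : 0 ≤ m)
    (hVm : ∃ K, ∀ x, (1 + ‖x‖ ^ 2) ^ (m / 2) * |V x| ≤ K) {α : ℝ} (hα : 0 ≤ α) {η₀ : ℝ}
    (hη₀ : 0 < η₀) :
    ∃ C, ∀ η, 0 < η → η ≤ η₀ → ∀ t : ℝ, 1 ≤ t → ∀ ψ : 𝓢(Space N, ℂ),
      localizationError V F Φ α t η ψ
        ≤ ENNReal.ofReal (C * η ^ (-m - 1) * t ^ (-(m * α)) * norm2 ψ) ∧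
      localizationError V F Φ α t η ψ
        ≤ ENNReal.ofReal (C * η ^ (-m - 1) * t ^ (-(m * α)) * norm2 (japD m ψ)) := by
  obtain ⟨C, hC, h⟩ := hF.exists_norm_mul_boundedFun_sub_le hΦ hV hm hVm hη₀
  refine ⟨C, fun η hη hη0 t ht ψ => ?_⟩
  have h1 := h η hη hη0 (t ^ α) (Real.one_le_rpow ht hα)
  rw [← Real.rpow_mul (by linarith), show α * -m = -(m * α) by ring] at h1
  have h2 := localizationError_le_of_norm_le hF hΦ hη h1 ψ
  -- The bound with ⟨D⟩^m is weaker than the first one, because the symbol of ⟨D⟩^m is at least 1.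
  refine ⟨h2, h2.trans (ENNReal.ofReal_le_ofReal ?_)⟩
  have := norm2_le_norm2_japD hm ψ
  gcongr

end Comparison

end

end TwoBody

theorem mainTheorem7 (N : ℕ) (hN : 1 ≤ N) (α : ℝ) (hα : 1 / 3 < α) (hα' : α < 1)
    (F : ℝ → ℝ) (ε : ℝ) (hF : TwoBody.IsSmoothCutoff F ε)
    (g : TwoBody.Space N → TwoBody.Space N) (hg : TwoBody.IsRadialField g) :
    -- symmetrization of `γ² F₁' + F₁' γ²`
    (∃ C : ℝ, ∀ t : ℝ, 1 ≤ t → ∀ u v : 𝓢(TwoBody.Space N, ℂ),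
      ‖TwoBody.symForm g F α t u v - 2 * TwoBody.gammaForm g F α t u v‖
        ≤ C * t ^ (-(2 * α)) * TwoBody.norm2 u * TwoBody.norm2 v) ∧
    (∃ C : ℝ, ∀ t : ℝ, 1 ≤ t → 2 ≤ t ^ α → ∀ u v : 𝓢(TwoBody.Space N, ℂ),
      ‖TwoBody.symForm g F α t u v - 2 * TwoBody.radialForm F α t u v‖
        ≤ C * t ^ (-(2 * α)) * TwoBody.norm2 u * TwoBody.norm2 v) ∧
    -- comparison of `t^{-α} F₁' α |x| / t` with `α F₁' / t`
    (∀ t : ℝ, 1 ≤ t → ∀ x : TwoBody.Space N,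
      α * TwoBody.scaled (deriv F) α t x / t
        ≤ TwoBody.scaled (deriv F) α t x * (α * ‖x‖ / t) * t ^ (-α) ∧
      TwoBody.scaled (deriv F) α t x * (α * ‖x‖ / t) * t ^ (-α)
        ≤ (1 + ε) * (α * TwoBody.scaled (deriv F) α t x / t)) ∧
    -- control of `⟨F₁' γ / t⟩`
    (∀ a : ℝ, 0 < a → ∃ C : ℝ, ∀ t : ℝ, 1 ≤ t → ∀ ψ : 𝓢(TwoBody.Space N, ℂ),
      |(∫ x, ((TwoBody.scaled (deriv F) α t x / t : ℝ) : ℂ) * TwoBody.gamma g ψ x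
          * conj (ψ x)).re|
        ≤ a * (t ^ (-α) * (TwoBody.gammaForm g F α t ψ ψ).re)
          + C * (t ^ (-(1 + (1 - α))) * TwoBody.densityForm (deriv F) α t ψ)) ∧
    -- replacement of the energy cutoff of `H` by that of `-Δ`
    (∀ (Φ : ℝ → ℝ) (δ : ℝ), TwoBody.IsSmoothCutoff Φ δ →
      ∀ V : TwoBody.Space N → ℝ, Measurable V →
      ∀ m : ℝ, 0 ≤ m → (∃ K : ℝ, ∀ x, (1 + ‖x‖ ^ 2) ^ (m / 2) * |V x| ≤ K) →
      ∀ η₀ : ℝ, 0 < η₀ → ∃ C : ℝ, ∀ η : ℝ, 0 < η → η ≤ η₀ → ∀ t : ℝ, 1 ≤ t →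
      ∀ ψ : 𝓢(TwoBody.Space N, ℂ),
        TwoBody.localizationError V F Φ α t η ψ
          ≤ ENNReal.ofReal (C * η ^ (-m - 1) * t ^ (-(m * α)) * TwoBody.norm2 ψ) ∧
        TwoBody.localizationError V F Φ α t η ψ
          ≤ ENNReal.ofReal
              (C * η ^ (-m - 1) * t ^ (-(m * α)) * TwoBody.norm2 (TwoBody.japD m ψ))) ∧
    -- positivity
    (∀ (Φ : ℝ → ℝ) (δ : ℝ), TwoBody.IsSmoothCutoff Φ δ →
      ∃ (Ft : ℝ → ℝ) (c₁ c₂ C : ℝ), ContDiff ℝ ∞ Ft ∧ 0 < c₁ ∧ 0 < c₂ ∧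
        (∀ l, c₁ * (F l * deriv F l) ≤ Ft l ∧ Ft l ≤ c₂ * (F l * deriv F l)) ∧
        ∀ η : ℝ, 0 < η → ∀ t : ℝ, 1 ≤ t → ∀ ψ φ : 𝓢(TwoBody.Space N, ℂ),
          φ = TwoBody.freeFun (fun l => Φ (l / η)) ψ →
          1 / 2 * η * (t ^ (-α) * TwoBody.densityForm Ft α t φ)
              - C * t ^ (-(3 * α)) * TwoBody.norm2 ψ ^ 2
            ≤ t ^ (-α) * (TwoBody.radialForm F α t φ φ).re
              + TwoBody.angularForm F α t φ) := by
  have hα0 : 0 ≤ α := by linarith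
  refine ⟨TwoBody.symForm_sub_gammaForm_le hF hg α, TwoBody.symForm_sub_radialForm_le hF hg α,
    fun t ht x => TwoBody.cutoffDeriv_div_le hF hα0 (by linarith) x,
    fun a ha => TwoBody.abs_re_integral_gamma_le hF hg α ha, ?_,
    fun Φ δ hΦ => hF.exists_positivity hα0 hΦ⟩
  intro Φ δ hΦ V hV m hm hVm η₀ hη₀
  exact hF.exists_localizationError_le hΦ hV hm hVm hα0 hη₀
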